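/- Let $k$ be an algebraically closed field, let $Q$ be a finite quiver, and let $I\subseteq kQ$ be an admissible ideal generated by paths of length at least two, so that $A=kQ/I$ is a (finite-dimensional) monomial algebra. Grade $A=\bigoplus_{i\ge 0}A_i$ by giving each arrow degree one. Assume that $A$ is Gorenstein, i.e. that $A$ has finite injective dimension both as a left and as a right $A$-module. Let $\mathrm{mod}^{\mathbb Z}A$ be the abelian category of finitely generated $\mathbb Z$-graded left $A$-modules with degree-preserving $A$-linear maps, let $\mathrm{proj}^{\mathbb Z}A$ be its full subcategory of projective objects, and let $$D_{sg}(\mathrm{mod}^{\mathbb Z}A)=D^b(\mathrm{mod}^{\mathbb Z}A)/K^b(\mathrm{proj}^{\mathbb Z}A)$$ be the Verdier quotient. Call an object $T$ of a triangulated category $\mathcal T$ tilting if $\mathrm{Hom}_{\mathcal T}(T,T[i])=0$ for all $i\neq 0$ and the smallest triangulated subcategory of $\mathcal T$ that contains $T$ and is closed under direct summands is $\mathcal T$ itself. Then $D_{sg}(\mathrm{mod}^{\mathbb Z}A)$ has a tilting object. More precisely, for every integer $l\ge 0$ with $A_n=0$ for all $n>l$, the graded module $$T=\bigoplus_{0\le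 i\le l}A(i)_{\le 0},$$ regarded as a complex concentrated in degree zero, is a tilting object of $D_{sg}(\mathrm{mod}^{\mathbb Z}A)$. Here, for a graded module $X$, the shift $X(i)$ has components $X(i)_j=X_{i+j}$, and $X_{\le n}=X/X_{\ge n+1}$, where $X_{\ge n+1}=\bigoplus_{j\ge n+1}X_j$. -/

import Mathlib

open CategoryTheory CategoryTheory.Limits
open scoped ZeroObject

universe w v u

section PathAlgebra

/-- The paths of a quiver: a path starts at `p.src` and ends at `p.tgt`. -/
structure QPath (V : Type u) [Quiver.{u} V] where
  {src : V}
  {tgt : V}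
  path : Quiver.Path src tgt

namespace QPath

variable {V : Type u} [Quiver.{u} V]

/-- The number of arrows of a path. -/
def length (p : QPath V) : ℕ := p.path.length

/-- The trivial path `e_v`. -/
def trivial (v : V) : QPath V := ⟨(Quiver.Path.nil : Quiver.Path v v)⟩

/-- The composite `p q` of paths with `s(p) = t(q)`, which is `q` followed by `p`. -/
def comp (p q : QPath V) (h : q.tgt = p.src) : QPath V := ⟨q.path.comp (p.path.cast h.symm rfl)⟩

@[simp] lemma comp_src (p q : QPath V) (h : q.tgt = p.src) : (p.comp q h).src = q.src := rfl
@[simp] lemma comp_tgt (p q : QPath V) (h : q.tgt = p.src) : (p.comp q h).tgt = p.tgt := rfl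

lemma comp_assoc (p q r : QPath V) (h : q.tgt = p.src) (h' : r.tgt = q.src) :
    (p.comp q h).comp r h' = p.comp (q.comp r h') h := by
  obtain ⟨p⟩ := p
  obtain ⟨q⟩ := q
  obtain ⟨r⟩ := r
  dsimp at h h'
  subst h h'
  simp [comp]

lemma comp_trivial (p : QPath V) : p.comp (trivial p.src) rfl = p := by
  obtain ⟨p⟩ := p
  simp [comp, trivial]

lemma trivial_comp (p : QPath V) : (trivial p.tgt).comp p rfl = p := by
  obtain ⟨p⟩ := p
  simp [comp, trivial]

lemma length_comp (p q : QPath V) (h : q.tgt = p.src) :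
    (p.comp q h).length = p.length + q.length := by
  obtain ⟨p⟩ := p
  obtain ⟨q⟩ := q
  dsimp at h
  subst h
  simp [comp, length, add_comm]

end QPath

/-- The path algebra `kQ`: the `k`-vector space with basis the paths of the quiver, where the
product of two paths is their composite if they are composable and zero otherwise. -/
def PathAlgebra (k V : Type u) [Field k] [Quiver.{u} V] : Type u := QPath V →₀ k

namespace PathAlgebra

variable (k : Type u) {V : Type u} [Field k] [Quiver.{u} V]

noncomputable instance : AddCommGroup (PathAlgebra k V) :=
  inferInstanceAs (AddCommGroup (QPath V →₀ k))

noncomputable instance : Module k (PathAlgebra k V) :=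
  inferInstanceAs (Module k (QPath V →₀ k))

/-- The paths form a basis of the path algebra. -/
noncomputable def basis : Module.Basis (QPath V) k (PathAlgebra k V) := ⟨LinearEquiv.refl k _⟩

/-- A path, as an element of the path algebra. -/
noncomputable def of (p : QPath V) : PathAlgebra k V := basis k p

open Classical in
/-- The product of two paths. -/
noncomputable def pathMul (p q : QPath V) : PathAlgebra k V :=
  if h : q.tgt = p.src then of k (p.comp q h) else 0

/-- The bilinear extension of the product of paths. -/
noncomputable def mulHom : PathAlgebra k V →ₗ[k] PathAlgebra k V →ₗ[k] PathAlgebra k V :=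
  (basis k).constr k fun p => (basis k).constr k fun q => pathMul k p q

noncomputable instance : Mul (PathAlgebra k V) := ⟨fun x y => mulHom k x y⟩

lemma mul_def (x y : PathAlgebra k V) : x * y = mulHom k x y := rfl

lemma of_mul_of (p q : QPath V) : of k p * of k q = pathMul k p q := by
  simp [mul_def, mulHom, of]

lemma of_mul_of_eq {p q : QPath V} (h : q.tgt = p.src) :
    of k p * of k q = of k (p.comp q h) := by
  rw [of_mul_of, pathMul, dif_pos h]

lemma of_mul_of_ne {p q : QPath V} (h : q.tgt ≠ p.src) : of k p * of k q = 0 := by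
  rw [of_mul_of, pathMul, dif_neg h]

noncomputable instance : NonUnitalNonAssocRing (PathAlgebra k V) where
  left_distrib x y z := map_add _ _ _
  right_distrib x y z := by simp [mul_def]
  zero_mul x := by simp [mul_def]
  mul_zero x := by simp [mul_def]

instance : IsScalarTower k (PathAlgebra k V) (PathAlgebra k V) :=
  ⟨fun a x y => by simp [mul_def]⟩

instance : SMulCommClass k (PathAlgebra k V) (PathAlgebra k V) :=
  ⟨fun a x y => by simp [mul_def]⟩

variable {k} in
lemma induction {p : PathAlgebra k V → Prop} (x : PathAlgebra k V) (zero : p 0)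
    (add : ∀ x y, p x → p y → p (x + y)) (smul_of : ∀ (a : k) q, p (a • of k q)) : p x := by
  rw [← (basis k).linearCombination_repr x, Finsupp.linearCombination_apply]
  exact Finsupp.induction_linear ((basis k).repr x) (by simpa using zero)
    (fun f g hf hg => by
      rw [Finsupp.sum_add_index' (by simp) (by simp [add_smul])]
      exact add _ _ hf hg)
    (fun q a => by simpa [of] using smul_of a q)

noncomputable instance : NonUnitalRing (PathAlgebra k V) where
  mul_assoc x y z := by
    induction x using induction with
    | zero => simp
    | add x x' hx hx' => simp [add_mul, hx, hx']
    | smul_of a p =>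
    induction y using induction with
    | zero => simp
    | add x x' hx hx' => simp [add_mul, mul_add, hx, hx']
    | smul_of b q =>
    induction z using induction with
    | zero => simp
    | add x x' hx hx' => simp [mul_add, hx, hx']
    | smul_of c r =>
    simp only [smul_mul_assoc, mul_smul_comm]
    congr 3
    by_cases h : q.tgt = p.src
    · by_cases h' : r.tgt = q.src
      · rw [of_mul_of_eq k h, of_mul_of_eq k h', of_mul_of_eq k (p := p.comp q h) h',
          of_mul_of_eq k (q := q.comp r h') h, QPath.comp_assoc]
      · rw [of_mul_of_eq k h, of_mul_of_ne k h', of_mul_of_ne k (p := p.comp q h) h', mul_zero]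
    · by_cases h' : r.tgt = q.src
      · rw [of_mul_of_ne k h, of_mul_of_eq k h', of_mul_of_ne k (q := q.comp r h') h, zero_mul]
      · rw [of_mul_of_ne k h, of_mul_of_ne k h', zero_mul, mul_zero]

variable [Fintype V]

noncomputable instance : One (PathAlgebra k V) := ⟨∑ v : V, of k (QPath.trivial v)⟩

lemma one_def : (1 : PathAlgebra k V) = ∑ v : V, of k (QPath.trivial v) := rfl

noncomputable instance : Ring (PathAlgebra k V) where
  one_mul x := by
    induction x using induction with
    | zero => simp
    | add x y hx hy => rw [mul_add, hx, hy]
    | smul_of a p =>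
      rw [mul_smul_comm, one_def, Finset.sum_mul, Finset.sum_eq_single p.tgt]
      · rw [of_mul_of_eq k (p := QPath.trivial p.tgt) rfl, QPath.trivial_comp]
      · intro v _ hv
        exact of_mul_of_ne k (p := QPath.trivial v) hv.symm
      · simp
  mul_one x := by
    induction x using induction with
    | zero => simp
    | add x y hx hy => rw [add_mul, hx, hy]
    | smul_of a p =>
      rw [smul_mul_assoc, one_def, Finset.mul_sum, Finset.sum_eq_single p.src]
      · rw [of_mul_of_eq k (q := QPath.trivial p.src) rfl, QPath.comp_trivial]
      · intro v _ hv
        exact of_mul_of_ne k (q := QPath.trivial v) hv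
      · simp

noncomputable instance : Algebra k (PathAlgebra k V) :=
  Algebra.ofModule smul_mul_assoc mul_smul_comm

end PathAlgebra

end PathAlgebra

/-- Finitely generated `ℤ`-graded left modules `M = ⨁ i, M_i` over the ring `A` with grading `𝒜`. -/
structure GrMod {k A : Type u} [CommRing k] [Ring A] [Algebra k A] (𝒜 : ℤ → Submodule k A) where
  carrier : Type u
  [addCommGroup : AddCommGroup carrier]
  [module : Module A carrier]
  [finite : Module.Finite A carrier]
  grading : ℤ → AddSubgroup carrier
  isInternal : DirectSum.IsInternal grading
  smul_mem : ∀ {i j : ℤ} {a : A} {m : carrier}, a ∈ 𝒜 i → m ∈ grading j →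
    a • m ∈ grading (i + j)

namespace GrMod

attribute [instance] addCommGroup module finite

variable {k A : Type u} [CommRing k] [Ring A] [Algebra k A] {𝒜 : ℤ → Submodule k A}

/-- Morphisms are the `A`-linear maps that preserve degrees. -/
@[ext]
structure Hom (X Y : GrMod 𝒜) where
  lin : X.carrier →ₗ[A] Y.carrier
  map_mem : ∀ {i : ℤ} {x : X.carrier}, x ∈ X.grading i → lin x ∈ Y.grading i

instance : Category (GrMod 𝒜) where
  Hom := Hom
  id X := ⟨LinearMap.id, fun h => h⟩
  comp f g := ⟨g.lin ∘ₗ f.lin, fun h => g.map_mem (f.map_mem h)⟩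

@[ext]
lemma hom_ext {X Y : GrMod 𝒜} {f g : X ⟶ Y} (h : ∀ x, f.lin x = g.lin x) : f = g :=
  Hom.ext (LinearMap.ext h)

@[simp] lemma id_lin (X : GrMod 𝒜) (x : X.carrier) : Hom.lin (𝟙 X) x = x := rfl

@[simp] lemma comp_lin {X Y Z : GrMod 𝒜} (f : X ⟶ Y) (g : Y ⟶ Z) (x : X.carrier) :
    (f ≫ g).lin x = g.lin (f.lin x) := rfl

section Preadditive

variable {X Y : GrMod 𝒜}

instance : Zero (X ⟶ Y) := ⟨⟨0, fun _ => zero_mem _⟩⟩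
instance : Add (X ⟶ Y) :=
  ⟨fun f g => ⟨f.lin + g.lin, fun h => add_mem (f.map_mem h) (g.map_mem h)⟩⟩
instance : Neg (X ⟶ Y) := ⟨fun f => ⟨-f.lin, fun h => neg_mem (f.map_mem h)⟩⟩

@[simp] lemma zero_lin (x : X.carrier) : (0 : X ⟶ Y).lin x = 0 := rfl
@[simp] lemma add_lin (f g : X ⟶ Y) (x : X.carrier) : (f + g).lin x = f.lin x + g.lin x := rfl
@[simp] lemma neg_lin (f : X ⟶ Y) (x : X.carrier) : (-f).lin x = -f.lin x := rfl

instance : AddCommGroup (X ⟶ Y) where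
  add_assoc f g h := by ext x; simp [add_assoc]
  zero_add f := by ext x; simp
  add_zero f := by ext x; simp
  add_comm f g := by ext x; simp [add_comm]
  neg_add_cancel f := by ext x; simp
  nsmul := nsmulRec
  zsmul := zsmulRec

end Preadditive

instance : Preadditive (GrMod 𝒜) where
  add_comp _ _ _ f f' g := by ext x; simp
  comp_add _ _ _ f g g' := by ext x; simp

/-! Homogeneous components. -/

/-- The projection of `X` onto its homogeneous component of degree `i`. -/
noncomputable def proj (X : GrMod 𝒜) (i : ℤ) : X.carrier →+ X.carrier :=
  (X.grading i).subtype.comp ((DFinsupp.evalAddMonoidHom i).comp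
    (AddEquiv.ofBijective (DirectSum.coeAddMonoidHom X.grading) X.isInternal).symm.toAddMonoidHom)

lemma proj_mem (X : GrMod 𝒜) (i : ℤ) (x : X.carrier) : X.proj i x ∈ X.grading i :=
  SetLike.coe_mem _

lemma proj_coe (X : GrMod 𝒜) (i : ℤ) (x : DirectSum ℤ fun i => X.grading i) :
    X.proj i (DirectSum.coeAddMonoidHom X.grading x) = x i := by
  have := (AddEquiv.ofBijective (DirectSum.coeAddMonoidHom X.grading)
    X.isInternal).symm_apply_apply x
  dsimp [proj]
  erw [this]
  rfl

lemma proj_of_mem (X : GrMod 𝒜) {i : ℤ} {x : X.carrier} (hx : x ∈ X.grading i) :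
    X.proj i x = x := by
  have := X.proj_coe i (DirectSum.of (fun i => X.grading i) i ⟨x, hx⟩)
  simpa using this

lemma proj_of_mem_ne (X : GrMod 𝒜) {i j : ℤ} {x : X.carrier} (hx : x ∈ X.grading j)
    (hij : j ≠ i) : X.proj i x = 0 := by
  have := X.proj_coe i (DirectSum.of (fun i => X.grading i) j ⟨x, hx⟩)
  rw [DirectSum.of_eq_of_ne _ _ _ hij.symm] at this
  simpa using this

lemma mem_closure (X : GrMod 𝒜) (x : X.carrier) : x ∈ ⨆ i, X.grading i := by
  obtain ⟨y, rfl⟩ := X.isInternal.2 x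
  induction y using DirectSum.induction_on with
  | zero => simp
  | of i y => simpa using AddSubgroup.mem_iSup_of_mem i y.2
  | add a b ha hb => simpa using add_mem ha hb

lemma induction_on (X : GrMod 𝒜) {p : X.carrier → Prop} (x : X.carrier)
    (hom : ∀ i, ∀ x ∈ X.grading i, p x) (add : ∀ x y, p x → p y → p (x + y)) : p x :=
  AddSubgroup.iSup_induction (C := p) _ (X.mem_closure x) hom (hom 0 0 (zero_mem _)) add

lemma ext_proj (X : GrMod 𝒜) {x y : X.carrier} (h : ∀ i, X.proj i x = X.proj i y) : x = y := by
  obtain ⟨a, rfl⟩ := X.isInternal.2 x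
  obtain ⟨b, rfl⟩ := X.isInternal.2 y
  congr 1
  ext i
  simpa [proj_coe] using h i

lemma proj_mem_of_homogeneous (X : GrMod 𝒜) {x : X.carrier} {i j : ℤ} (hx : x ∈ X.grading j) :
    X.proj i x = if j = i then x else 0 := by
  split_ifs with h
  · subst h; exact X.proj_of_mem hx
  · exact X.proj_of_mem_ne hx h

lemma map_proj {X Y : GrMod 𝒜} (f : X ⟶ Y) (i : ℤ) (x : X.carrier) :
    f.lin (X.proj i x) = Y.proj i (f.lin x) := by
  induction x using X.induction_on with
  | hom j x hx =>
    rw [X.proj_mem_of_homogeneous hx, Y.proj_mem_of_homogeneous (f.map_mem hx)]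
    split_ifs <;> simp
  | add x y hx hy => simp [hx, hy]

lemma proj_smul (X : GrMod 𝒜) {i : ℤ} {a : A} (ha : a ∈ 𝒜 i) (j : ℤ) (x : X.carrier) :
    X.proj (i + j) (a • x) = a • X.proj j x := by
  induction x using X.induction_on with
  | hom l x hx =>
    rw [X.proj_mem_of_homogeneous hx, X.proj_mem_of_homogeneous (X.smul_mem ha hx)]
    by_cases h : l = j
    · simp [h]
    · simp [h]
  | add x y hx hy => simp [hx, hy]

lemma isInternal_of_proj {M : Type u} [AddCommGroup M] (ℳ : ℤ → AddSubgroup M)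
    (p : ℤ → M →+ M) (h : ∀ i j, ∀ x ∈ ℳ j, p i x = if j = i then x else 0)
    (hsup : ∀ x, x ∈ ⨆ i, ℳ i) : DirectSum.IsInternal ℳ := by
  have key : ∀ (y : DirectSum ℤ fun i => ℳ i) (i : ℤ),
      p i (DirectSum.coeAddMonoidHom ℳ y) = y i := by
    intro y i
    induction y using DirectSum.induction_on with
    | zero => simp
    | of j y =>
      rw [DirectSum.coeAddMonoidHom_of, h i j y y.2]
      split_ifs with hij
      · subst hij; simp
      · rw [DirectSum.of_eq_of_ne _ _ _ (Ne.symm hij)]; simp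
    | add a b ha hb => simp [ha, hb]
  constructor
  · intro a b hab
    ext i
    rw [← key, ← key, hab]
  · intro x
    refine AddSubgroup.iSup_induction (C := fun x => ∃ a, DirectSum.coeAddMonoidHom ℳ a = x) ℳ
      (hsup x) ?_ ⟨0, by simp⟩ ?_
    · intro i x hx
      exact ⟨DirectSum.of (fun i => ℳ i) i ⟨x, hx⟩, by simp⟩
    · rintro _ _ ⟨a, rfl⟩ ⟨b, rfl⟩
      exact ⟨a + b, by simp⟩

/-- An `A`-submodule of a graded module is graded (homogeneous) if it contains the homogeneous
components of its elements. -/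
def IsGradedSub (X : GrMod 𝒜) (N : Submodule A X.carrier) : Prop :=
  ∀ i, ∀ x ∈ N, X.proj i x ∈ N

/-- A graded submodule, as a graded module, with components `N ∩ X_i`. -/
def sub (X : GrMod 𝒜) (N : Submodule A X.carrier) (hN : X.IsGradedSub N) [Module.Finite A N] :
    GrMod 𝒜 where
  carrier := N
  grading i := (X.grading i).comap N.subtype.toAddMonoidHom
  isInternal := by
    refine isInternal_of_proj _
      (fun i => ((X.proj i).comp N.subtype.toAddMonoidHom).codRestrict N.toAddSubgroup
        (fun x => hN i x x.2)) ?_ ?_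
    · intro i j x hx
      ext
      have : X.proj i x.1 = if j = i then x.1 else 0 := X.proj_mem_of_homogeneous hx
      change X.proj i x.1 = _
      rw [this]
      split_ifs <;> rfl
    · intro x
      classical
      obtain ⟨y, hy⟩ := X.isInternal.2 x.1
      have hx : x = ∑ i ∈ y.support, (⟨X.proj i x.1, hN i _ x.2⟩ : N) := by
        ext
        rw [AddSubmonoidClass.coe_finsetSum]
        simp only
        conv_lhs => rw [← hy]
        rw [DirectSum.coeAddMonoidHom_eq_dfinsuppSum]
        refine Finset.sum_congr rfl fun i _ => ?_
        rw [← hy, proj_coe]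
      rw [hx]
      exact sum_mem fun i _ => AddSubgroup.mem_iSup_of_mem i (X.proj_mem i x.1)
  smul_mem ha hm := X.smul_mem ha hm

/-- The quotient by a graded submodule, with components the images of the `X_i`. -/
def quot (X : GrMod 𝒜) (N : Submodule A X.carrier) (hN : X.IsGradedSub N) : GrMod 𝒜 where
  carrier := X.carrier ⧸ N
  grading i := (X.grading i).map N.mkQ.toAddMonoidHom
  isInternal := by
    refine isInternal_of_proj _
      (fun i => QuotientAddGroup.map N.toAddSubgroup N.toAddSubgroup (X.proj i)
        (fun x hx => hN i x hx)) ?_ ?_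
    · rintro i j _ ⟨x, hx, rfl⟩
      change N.mkQ (X.proj i x) = if j = i then N.mkQ x else 0
      rw [X.proj_mem_of_homogeneous hx]
      split_ifs <;> simp
    · intro x
      obtain ⟨x, rfl⟩ := N.mkQ_surjective x
      induction x using X.induction_on with
      | hom i x hx => exact AddSubgroup.mem_iSup_of_mem i ⟨x, hx, rfl⟩
      | add x y hx hy => rw [map_add]; exact add_mem hx hy
  smul_mem := by
    rintro i j a _ ha ⟨m, hm, rfl⟩
    exact ⟨a • m, X.smul_mem ha hm, by simp⟩

lemma isGradedSub_ker {X Y : GrMod 𝒜} (f : X ⟶ Y) : X.IsGradedSub (LinearMap.ker f.lin) := by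
  intro i x hx
  rw [LinearMap.mem_ker] at hx ⊢
  rw [map_proj, hx, map_zero]

lemma isGradedSub_range {X Y : GrMod 𝒜} (f : X ⟶ Y) :
    Y.IsGradedSub (LinearMap.range f.lin) := by
  rintro i _ ⟨x, rfl⟩
  exact ⟨X.proj i x, map_proj f i x⟩

/-- The zero graded module. -/
def zero : GrMod 𝒜 where
  carrier := PUnit
  grading _ := ⊥
  isInternal := isInternal_of_proj _ (fun _ => 0) (fun _ _ _ _ => Subsingleton.elim _ _)
    (fun x => by rw [Subsingleton.elim x 0]; exact zero_mem _)
  smul_mem _ _ := Subsingleton.elim _ _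

instance : HasZeroObject (GrMod 𝒜) :=
  ⟨zero, by
    rw [IsZero.iff_id_eq_zero]
    ext x
    rfl⟩

/-- The direct sum of two graded modules, with components `X_i ⊕ Y_i`. -/
def prod (X Y : GrMod 𝒜) : GrMod 𝒜 where
  carrier := X.carrier × Y.carrier
  grading i := (X.grading i).prod (Y.grading i)
  isInternal := by
    refine isInternal_of_proj _ (fun i => (X.proj i).prodMap (Y.proj i)) ?_ ?_
    · rintro i j ⟨x, y⟩ ⟨hx, hy⟩
      ext
      · simp [X.proj_mem_of_homogeneous hx, apply_ite Prod.fst]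
      · simp [Y.proj_mem_of_homogeneous hy, apply_ite Prod.snd]
    · rintro ⟨x, y⟩
      have h1 : ((x, 0) : X.carrier × Y.carrier) ∈
          ⨆ i, (X.grading i).prod (Y.grading i) := by
        induction x using X.induction_on with
        | hom i x hx => exact AddSubgroup.mem_iSup_of_mem i ⟨hx, zero_mem _⟩
        | add x y hx hy => simpa using add_mem hx hy
      have h2 : ((0, y) : X.carrier × Y.carrier) ∈
          ⨆ i, (X.grading i).prod (Y.grading i) := by
        induction y using Y.induction_on with
        | hom i y hy => exact AddSubgroup.mem_iSup_of_mem i ⟨zero_mem _, hy⟩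
        | add x y hx hy => simpa using add_mem hx hy
      simpa using add_mem h1 h2
  smul_mem ha hm := ⟨X.smul_mem ha hm.1, Y.smul_mem ha hm.2⟩

instance : HasBinaryBiproducts (GrMod 𝒜) where
  has_binary_biproduct X Y := by
    refine hasBinaryBiproduct_of_total
      { pt := X.prod Y
        fst := ⟨LinearMap.fst A _ _, fun h => h.1⟩
        snd := ⟨LinearMap.snd A _ _, fun h => h.2⟩
        inl := ⟨LinearMap.inl A _ _, fun h => ⟨h, zero_mem _⟩⟩
        inr := ⟨LinearMap.inr A _ _, fun h => ⟨zero_mem _, h⟩⟩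
        inl_fst := rfl
        inl_snd := rfl
        inr_fst := rfl
        inr_snd := rfl } ?_
    apply hom_ext
    rintro ⟨x, y⟩
    change ((x, 0) + (0, y) : X.carrier × Y.carrier) = (x, y)
    simp

instance : HasFiniteProducts (GrMod 𝒜) :=
  hasFiniteProducts_of_has_binary_and_terminal

instance : HasFiniteBiproducts (GrMod 𝒜) :=
  HasFiniteBiproducts.of_hasFiniteProducts

section Cokernel

variable {X Y : GrMod 𝒜} (f : X ⟶ Y)

/-- The projection onto a quotient by a graded submodule. -/
def quotMk (X : GrMod 𝒜) (N : Submodule A X.carrier) (hN : X.IsGradedSub N) :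
    X ⟶ X.quot N hN :=
  ⟨N.mkQ, fun hx => ⟨_, hx, rfl⟩⟩

/-- Factorization through a quotient. -/
def quotDesc (X : GrMod 𝒜) (N : Submodule A X.carrier) (hN : X.IsGradedSub N) {Z : GrMod 𝒜}
    (g : X ⟶ Z) (hg : N ≤ LinearMap.ker g.lin) : X.quot N hN ⟶ Z :=
  ⟨N.liftQ g.lin hg, by
    rintro i _ ⟨x, hx, rfl⟩
    exact g.map_mem hx⟩

lemma range_le_ker {Z : GrMod 𝒜} (g : Y ⟶ Z) (w : f ≫ g = 0) :
    LinearMap.range f.lin ≤ LinearMap.ker g.lin := by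
  rintro _ ⟨x, rfl⟩
  have := congrArg (fun h : X ⟶ Z => h.lin x) w
  exact this

lemma comp_quotMk_range : f ≫ Y.quotMk _ (isGradedSub_range f) = 0 := by
  apply hom_ext
  intro x
  exact (Submodule.Quotient.mk_eq_zero _).2 ⟨x, rfl⟩

/-- The quotient by the range is the cokernel. -/
def cokernelIsColimit :
    IsColimit (CokernelCofork.ofπ (Y.quotMk _ (isGradedSub_range f)) (comp_quotMk_range f)) :=
  CokernelCofork.IsColimit.ofπ _ _
    (fun g w => Y.quotDesc _ (isGradedSub_range f) g (range_le_ker f g w))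
    (fun g w => rfl)
    (fun g w m hm => by
      apply hom_ext
      intro x
      obtain ⟨x, rfl⟩ := Submodule.mkQ_surjective _ x
      exact congrArg (fun h : Y ⟶ _ => h.lin x) hm)

instance : HasCokernels (GrMod 𝒜) where
  has_colimit f := ⟨⟨⟨_, cokernelIsColimit f⟩⟩⟩

lemma surjective_of_epi [Epi f] : Function.Surjective f.lin := by
  intro y
  have h0 : Y.quotMk _ (isGradedSub_range f) = 0 := by
    rw [← cancel_epi f, comp_quotMk_range, comp_zero]
  have := congrArg (fun h => Hom.lin h y) h0
  exact (Submodule.Quotient.mk_eq_zero _).1 this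

lemma isIso_of_bijective (h : Function.Bijective f.lin) : IsIso f := by
  let e := LinearEquiv.ofBijective f.lin h
  have he : ∀ y, f.lin (e.symm y) = y := e.apply_symm_apply
  refine ⟨⟨e.symm.toLinearMap, ?_⟩, ?_, ?_⟩
  · intro i y hy
    have : e.symm y = X.proj i (e.symm y) := by
      apply h.1
      rw [map_proj, he, Y.proj_of_mem hy]
    change e.symm y ∈ _
    rw [this]
    exact X.proj_mem _ _
  · apply hom_ext
    exact e.symm_apply_apply
  · apply hom_ext
    exact he

end Cokernel

section Kernel

/-- The inclusion of a graded submodule. -/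
def subIncl (X : GrMod 𝒜) (N : Submodule A X.carrier) (hN : X.IsGradedSub N)
    [Module.Finite A N] : X.sub N hN ⟶ X :=
  ⟨N.subtype, fun h => h⟩

variable [IsNoetherianRing A] {X Y : GrMod 𝒜} (f : X ⟶ Y)

lemma subIncl_ker_comp : X.subIncl _ (isGradedSub_ker f) ≫ f = 0 := by
  apply hom_ext
  intro x
  exact x.2

/-- The kernel of a morphism of graded modules. -/
def kernelIsLimit :
    IsLimit (KernelFork.ofι (X.subIncl _ (isGradedSub_ker f)) (subIncl_ker_comp f)) :=
  KernelFork.IsLimit.ofι _ _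
    (fun g w => ⟨LinearMap.codRestrict (LinearMap.ker f.lin) g.lin
      (fun x => congrArg (fun h => Hom.lin h x) w), fun h => g.map_mem h⟩)
    (fun g w => rfl)
    (fun g w m hm => by
      apply hom_ext
      intro x
      apply Subtype.ext
      exact congrArg (fun h => Hom.lin h x) hm)

instance : HasKernels (GrMod 𝒜) where
  has_limit f := ⟨⟨⟨_, kernelIsLimit f⟩⟩⟩

lemma injective_of_mono [Mono f] : Function.Injective f.lin := by
  rw [← LinearMap.ker_eq_bot, eq_bot_iff]
  intro x hx
  have h0 : X.subIncl _ (isGradedSub_ker f) = 0 := by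
    rw [← cancel_mono f, subIncl_ker_comp, zero_comp]
  exact congrArg (fun h => Hom.lin h (⟨x, hx⟩ : LinearMap.ker f.lin)) h0

end Kernel

section

variable [IsNoetherianRing A]

noncomputable instance : Abelian (GrMod 𝒜) where
  normalMonoOfMono {X Y} f hf := ⟨by
    let g := Y.quotMk _ (isGradedSub_range f)
    let φ : X ⟶ Y.sub _ (isGradedSub_ker g) :=
      ⟨f.lin.codRestrict _ (fun x => congrArg (fun h => Hom.lin h x) (comp_quotMk_range f)),
        fun h => f.map_mem h⟩
    have : IsIso φ := by
      apply isIso_of_bijective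
      constructor
      · intro x y hxy
        exact injective_of_mono f (congrArg Subtype.val hxy)
      · rintro ⟨y, hy⟩
        obtain ⟨x, hx⟩ := (Submodule.Quotient.mk_eq_zero _).1 hy
        exact ⟨x, Subtype.ext hx⟩
    exact ⟨_, g, comp_quotMk_range f, IsLimit.ofIsoLimit (kernelIsLimit g)
      (Fork.ext (asIso φ) rfl).symm⟩⟩
  normalEpiOfEpi {X Y} f hf := ⟨by
    let g := X.subIncl _ (isGradedSub_ker f)
    let φ : X.quot _ (isGradedSub_range g) ⟶ Y :=
      X.quotDesc _ _ f (range_le_ker g f (subIncl_ker_comp f))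
    have : IsIso φ := by
      apply isIso_of_bijective
      constructor
      · rw [← LinearMap.ker_eq_bot, eq_bot_iff]
        intro x hx
        obtain ⟨x, rfl⟩ := Submodule.mkQ_surjective _ x
        exact (Submodule.Quotient.mk_eq_zero _).2 ⟨⟨x, hx⟩, rfl⟩
      · intro y
        obtain ⟨x, rfl⟩ := surjective_of_epi f y
        exact ⟨Submodule.mkQ _ x, rfl⟩
    exact ⟨_, g, subIncl_ker_comp f, IsColimit.ofIsoColimit (cokernelIsColimit g)
      (Cofork.ext (asIso φ) rfl)⟩⟩

end

/-- The degree shift `X(n)`, with `X(n)_j = X_{n+j}`. -/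
def shift (X : GrMod 𝒜) (n : ℤ) : GrMod 𝒜 where
  carrier := X.carrier
  grading j := X.grading (n + j)
  isInternal := by
    refine isInternal_of_proj _ (fun i => X.proj (n + i)) ?_ ?_
    · intro i j x hx
      simp [X.proj_mem_of_homogeneous hx]
    · intro x
      induction x using X.induction_on with
      | hom i x hx => exact AddSubgroup.mem_iSup_of_mem (i - n) (by simpa using hx)
      | add x y hx hy => exact add_mem hx hy
  smul_mem {i j a m} ha hm := by
    have := X.smul_mem ha hm
    rwa [add_left_comm] at this

section Truncation

variable [GradedAlgebra 𝒜]

/-- The regular module `A`. -/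
def regular (𝒜 : ℤ → Submodule k A) [GradedAlgebra 𝒜] : GrMod 𝒜 where
  carrier := A
  grading i := (𝒜 i).toAddSubgroup
  isInternal := by
   exact DirectSum.Decomposition.isInternal 𝒜
  smul_mem ha hm := SetLike.mul_mem_graded ha hm

/-- `A` is positively graded: `A = ⨁_{i ≥ 0} A_i`. -/
class IsPositivelyGraded (𝒜 : ℤ → Submodule k A) : Prop where
  eq_bot_of_neg : ∀ i < 0, 𝒜 i = ⊥

/-- The submodule `X_{≥ n}` of elements all of whose components of degree `< n` vanish. -/
def geSubmodule [IsPositivelyGraded 𝒜] (X : GrMod 𝒜) (n : ℤ) : Submodule A X.carrier where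
  carrier := {x | ∀ j < n, X.proj j x = 0}
  zero_mem' := by simp
  add_mem' ha hb j hj := by simp [ha j hj, hb j hj]
  smul_mem' a x hx := by
    induction a using DirectSum.Decomposition.inductionOn 𝒜 with
    | zero => simp
    | @homogeneous i a =>
      intro j hj
      obtain hi | hi := lt_or_ge i 0
      · have : (a : A) = 0 :=
          (Submodule.mem_bot k).1 ((IsPositivelyGraded.eq_bot_of_neg (𝒜 := 𝒜) i hi).le a.2)
        simp [this]
      · have := X.proj_smul a.2 (j - i) x
        rw [add_sub_cancel] at this
        rw [this, hx (j - i) (by lia), smul_zero]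
    | add a b ha hb =>
      intro j hj
      rw [add_smul, map_add, ha j hj, hb j hj, add_zero]

lemma isGradedSub_geSubmodule [IsPositivelyGraded 𝒜] (X : GrMod 𝒜) (n : ℤ) : X.IsGradedSub (X.geSubmodule n) := by
  intro i x hx j hj
  rw [X.proj_mem_of_homogeneous (X.proj_mem i x)]
  split_ifs with h
  · subst h; exact hx _ hj
  · rfl

/-- The truncation `X_{≤ n} = X / X_{≥ n+1}`. -/
def truncLE [IsPositivelyGraded 𝒜] (X : GrMod 𝒜) (n : ℤ) : GrMod 𝒜 :=
  X.quot (X.geSubmodule (n + 1)) (X.isGradedSub_geSubmodule (n + 1))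

end Truncation

end GrMod

namespace SingCat

section

variable (C : Type u) [Category.{v} C] [Abelian C] [HasDerivedCategory.{w} C]

/-- The objects of the derived category that are isomorphic to a bounded complex of
projective objects of `C`. -/
def perfect : ObjectProperty (DerivedCategory C) := fun X =>
  ∃ K : CochainComplex C ℤ,
    (∃ a b : ℤ, ∀ i : ℤ, (i < a ∨ b < i) → IsZero (K.X i)) ∧
    (∀ i : ℤ, Projective (K.X i)) ∧
    Nonempty (X ≅ DerivedCategory.Q.obj K)

instance : (perfect C).IsClosedUnderIsomorphisms where
  of_iso := by
    rintro X Y e ⟨K, hb, hp, ⟨e'⟩⟩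
    exact ⟨K, hb, hp, ⟨e.symm ≪≫ e'⟩⟩

instance : (perfect C).ContainsZero where
  exists_zero := by
    refine ⟨DerivedCategory.Q.obj 0, Functor.map_isZero _ (isZero_zero _), 0, ⟨0, 0, ?_⟩, ?_,
      ⟨Iso.refl _⟩⟩
    · intro i _
      exact (HomologicalComplex.eval C _ i).map_isZero (isZero_zero _)
    · intro i
      exact Projective.of_iso
        ((isZero_zero C).iso ((HomologicalComplex.eval C _ i).map_isZero (isZero_zero _)))
        inferInstance

instance : (perfect C).IsStableUnderShift ℤ where
  isStableUnderShiftBy n :=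
    { le_shift := by
        rintro X ⟨K, ⟨a, b, hb⟩, hp, ⟨e⟩⟩
        refine ⟨K⟦n⟧, ⟨a - n, b - n, fun i hi => hb _ (by dsimp; lia)⟩, fun i => hp _, ⟨?_⟩⟩
        exact (shiftFunctor _ n).mapIso e ≪≫ (DerivedCategory.Q.commShiftIso n).symm.app K }

instance : (perfect C).IsTriangulated where
  toIsTriangulatedClosed₂ := by
    have h3 : (perfect C).IsTriangulatedClosed₃ := by
      refine .mk' fun T hT ↦ ?_
      rintro ⟨K, ⟨a, b, hK⟩, hKp, ⟨e⟩⟩ ⟨L, ⟨a', b', hL⟩, hLp, ⟨e'⟩⟩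
      have : K.IsStrictlyLE b := by
        rw [CochainComplex.isStrictlyLE_iff]
        exact fun i hi => hK i (Or.inr hi)
      have := CochainComplex.isKProjective_of_projective K b
      obtain ⟨f, hf⟩ : ∃ f : K ⟶ L, DerivedCategory.Q.map f = e.inv ≫ T.mor₁ ≫ e'.hom := by
        obtain ⟨g, hg⟩ := (CochainComplex.IsKProjective.Qh_map_bijective K
          ((HomotopyCategory.quotient _ _).obj L)).surjective
          ((DerivedCategory.quotientCompQhIso C).hom.app K ≫ (e.inv ≫ T.mor₁ ≫ e'.hom) ≫
            (DerivedCategory.quotientCompQhIso C).inv.app L)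
        obtain ⟨f, rfl⟩ := (HomotopyCategory.quotient _ _).map_surjective g
        refine ⟨f, ?_⟩
        have := (DerivedCategory.quotientCompQhIso C).hom.naturality f
        dsimp at this
        rw [hg] at this
        simpa using this.symm
      refine ⟨CochainComplex.mappingCone f, ⟨min (a - 1) a', max b b', fun i hi => ?_⟩,
        fun i => ?_, ?_⟩
      · rw [CochainComplex.mappingCone.isZero_X_iff]
        exact ⟨hK _ (by lia), hL _ (by lia)⟩
      · exact Projective.of_iso
          (HomologicalComplex.homotopyCofiber.XIsoBiprod f i (i + 1) (by simp)).symm inferInstance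
      · obtain ⟨e₃, -, -⟩ := Pretriangulated.exists_iso_of_arrow_iso T _ hT
          (DerivedCategory.mappingCone_triangle_distinguished f)
          (Arrow.isoMk e e' (by change e.hom ≫ DerivedCategory.Q.map f = T.mor₁ ≫ e'.hom; rw [hf]; simp))
        exact ⟨Pretriangulated.Triangle.π₃.mapIso e₃⟩
    exact ObjectProperty.IsTriangulatedClosed₂.of_isTriangulatedClosed₃

/-- The full subcategory `K^b(proj C)` of `D^b(C)`, where `D^b(C)` is the full subcategory of the
derived category on the objects with bounded cohomology. -/
abbrev boundedPerfect : ObjectProperty (DerivedCategory.Bounded C) :=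
  (perfect C).inverseImage DerivedCategory.Bounded.ι

/-- The singularity category of `C`: the Verdier quotient `D^b(C)/K^b(proj C)`, that is the
localization at the morphisms whose cone is in `K^b(proj C)`, with its triangulated structure
induced from that of `D^b(C)`. -/
abbrev SingularityCategory : Type (max u v) := (boundedPerfect C).trW.Localization

/-- The localization functor `D^b(C) ⥤ D^b(C)/K^b(proj C)`. -/
noncomputable abbrev quotientFunctor : DerivedCategory.Bounded C ⥤ SingularityCategory C :=
  (boundedPerfect C).trW.Q

variable {C} in
/-- An object of `C`, as a complex concentrated in degree zero, in the singularity category. -/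
noncomputable def stalk (M : C) : SingularityCategory C :=
  (quotientFunctor C).obj
    ⟨(DerivedCategory.singleFunctor C 0).obj M, ⟨0, inferInstance⟩, ⟨0, inferInstance⟩⟩

end

/-- An object `X` of a triangulated category is tilting if `Hom(X, X[i]) = 0` for all `i ≠ 0` and
the smallest triangulated subcategory that contains `X` and is closed under direct summands is
the whole category. -/
structure IsTilting {T : Type u} [Category.{v} T] [HasZeroObject T] [HasShift T ℤ] [Preadditive T]
    [∀ n : ℤ, (shiftFunctor T n).Additive] [Pretriangulated T] (X : T) : Prop where
  hom_shift_eq_zero : ∀ i : ℤ, i ≠ 0 → ∀ f : X ⟶ X⟦i⟧, f = 0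
  thick_eq_top : (ObjectProperty.singleton X).IsClassicalTriangulatedGenerator

end SingCat

/-! Monomial algebras -/

section Monomial

open PathAlgebra

variable {k V : Type u} [Field k] [Quiver.{u} V] [Fintype V]

/-- The ideal `I` of `kQ` is admissible: `J^N ⊆ I ⊆ J^2` for some `N`, where `J` is the ideal
generated by the arrows, so that `J^m` is the span of the paths of length at least `m`. -/
def IsAdmissible (I : TwoSidedIdeal (PathAlgebra k V)) : Prop :=
  (∃ N : ℕ, ∀ p : QPath V, N ≤ p.length → of k p ∈ I) ∧
    ∀ x ∈ I, ∀ p : QPath V, (basis k).repr x p ≠ 0 → 2 ≤ p.length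

/-- The ideal `I` of `kQ` is monomial: it is admissible, and generated by some paths of length at
least two. -/
class IsMonomial (I : TwoSidedIdeal (PathAlgebra k V)) : Prop where
  isAdmissible : IsAdmissible I
  exists_paths : ∃ S : Set (QPath V), (∀ p ∈ S, 2 ≤ p.length) ∧
    I = TwoSidedIdeal.span (of k '' S)

/-- The algebra `kQ/I`. -/
abbrev QuotAlgebra (I : TwoSidedIdeal (PathAlgebra k V)) : Type u := I.ringCon.Quotient

namespace QuotAlgebra

variable (I : TwoSidedIdeal (PathAlgebra k V))

/-- The quotient map `kQ → kQ/I`. -/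
noncomputable def mk : PathAlgebra k V →ₐ[k] QuotAlgebra I := I.ringCon.mkₐ (α := k)

lemma mk_surjective : Function.Surjective (mk I) := RingCon.mkₐ_surjective _

lemma mk_eq_zero {x : PathAlgebra k V} (hx : x ∈ I) : mk I x = 0 :=
  (RingCon.eq I.ringCon).2 hx

/-- The grading of `kQ/I` in which each arrow has degree one: the component of degree `n` is
spanned by the classes of the paths of length `n`. -/
noncomputable def grading (n : ℤ) : Submodule k (QuotAlgebra I) :=
  Submodule.span k {x | ∃ p : QPath V, (p.length : ℤ) = n ∧ x = mk I (of k p)}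

lemma mk_of_mem (p : QPath V) {n : ℤ} (h : (p.length : ℤ) = n) : mk I (of k p) ∈ grading I n :=
  Submodule.subset_span ⟨p, h, rfl⟩

instance : GrMod.IsPositivelyGraded (grading I) where
  eq_bot_of_neg i hi := by
    rw [grading, Submodule.span_eq_bot]
    rintro x ⟨p, hp, -⟩
    lia

instance : SetLike.GradedMonoid (grading I) where
  one_mem := by
    rw [← map_one (mk I), one_def, map_sum]
    exact sum_mem fun v _ => mk_of_mem I _ rfl
  mul_mem i j x y hx hy := by
    have h := Submodule.mul_mem_mul hx hy
    rw [grading, grading, Submodule.span_mul_span] at h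
    refine Submodule.span_le.2 ?_ h
    rintro _ ⟨_, ⟨p, hp, rfl⟩, _, ⟨q, hq, rfl⟩, rfl⟩
    dsimp only
    rw [← map_mul]
    by_cases h : q.tgt = p.src
    · rw [of_mul_of_eq k h]
      exact mk_of_mem I _ (by rw [QPath.length_comp]; push_cast; lia)
    · rw [of_mul_of_ne k h, map_zero]
      exact zero_mem _

/-- The projection of `kQ` onto the span of the paths of length `n`. -/
noncomputable def projLength (k : Type u) {V : Type u} [Field k] [Quiver.{u} V] (n : ℤ) :
    PathAlgebra k V →ₗ[k] PathAlgebra k V :=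
  (basis k).constr k fun p => if (p.length : ℤ) = n then of k p else 0

lemma projLength_of (n : ℤ) (p : QPath V) :
    projLength k n (of k p) = if (p.length : ℤ) = n then of k p else 0 := by
  simp [projLength, of]

lemma projLength_mem [h : IsMonomial I] (n : ℤ) {x : PathAlgebra k V} (hx : x ∈ I) :
    projLength k n x ∈ I := by
  obtain ⟨S, -, hS⟩ := h.exists_paths
  have hI : ∀ p ∈ S, of k p ∈ I := fun p hp => by
    rw [hS]; exact TwoSidedIdeal.subset_span ⟨p, hp, rfl⟩
  have hsmul : ∀ (a : k) (y : PathAlgebra k V), y ∈ I → a • y ∈ I := fun a y hy => by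
    rw [← smul_one_mul a y]
    exact I.mul_mem_left _ _ hy
  have key : ∀ r : QPath V, of k r ∈ I → projLength k n (of k r) ∈ I := fun r hr => by
    rw [projLength_of]
    split_ifs
    · exact hr
    · exact I.zero_mem
  rw [hS, TwoSidedIdeal.mem_span_iff_mem_addSubgroup_closure] at hx
  induction hx using AddSubgroup.closure_induction with
  | zero => rw [map_zero]; exact I.zero_mem
  | add x y _ _ hx hy => rw [map_add]; exact I.add_mem hx hy
  | neg x _ hx => rw [map_neg]; exact I.neg_mem hx
  | mem x hx =>
    obtain ⟨y, ⟨a, -, _, ⟨s, hs, rfl⟩, rfl⟩, b, -, rfl⟩ := hx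
    dsimp only
    induction a using PathAlgebra.induction with
    | zero => simp
    | add a a' ha ha' => simpa [add_mul] using I.add_mem ha ha'
    | smul_of c p =>
    induction b using PathAlgebra.induction with
    | zero => simp
    | add a a' ha ha' => simpa [mul_add] using I.add_mem ha ha'
    | smul_of d q =>
    simp only [smul_mul_assoc, mul_smul_comm, map_smul]
    apply hsmul
    apply hsmul
    by_cases h : s.tgt = p.src
    · have h1 := of_mul_of_eq k h
      rw [h1]
      by_cases h' : q.tgt = s.src
      · have h2 := of_mul_of_eq k (p := p.comp s h) h'
        rw [h2]
        apply key
        rw [← h2, ← h1]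
        exact I.mul_mem_right _ _ (I.mul_mem_left _ _ (hI s hs))
      · rw [of_mul_of_ne k (p := p.comp s h) h', map_zero]
        exact I.zero_mem
    · rw [of_mul_of_ne k h, zero_mul, map_zero]
      exact I.zero_mem

/-- The projection of `kQ/I` onto its component of degree `n`. -/
noncomputable def projDegree [IsMonomial I] (n : ℤ) : QuotAlgebra I →+ QuotAlgebra I :=
  I.ringCon.toAddCon.lift ((mk I).toLinearMap ∘ₗ projLength k n).toAddMonoidHom (by
    intro x y hxy
    have h : x - y ∈ I := (TwoSidedIdeal.rel_iff I x y).1 hxy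
    have h' := mk_eq_zero I (projLength_mem I n h)
    rw [map_sub, map_sub, sub_eq_zero] at h'
    exact h')

lemma projDegree_mk [IsMonomial I] (n : ℤ) (x : PathAlgebra k V) :
    projDegree I n (mk I x) = mk I (projLength k n x) := rfl

lemma isInternal_grading [IsMonomial I] : DirectSum.IsInternal (grading I) := by
  refine GrMod.isInternal_of_proj (fun i => (grading I i).toAddSubgroup)
    (fun n => projDegree I n) ?_ ?_
  · intro i j x hx
    induction hx using Submodule.span_induction with
    | mem x hx =>
      obtain ⟨p, hp, rfl⟩ := hx
      rw [projDegree_mk, projLength_of, hp]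
      split_ifs <;> simp
    | zero => simp
    | add x y _ _ hx hy => rw [map_add, hx, hy]; split_ifs <;> simp
    | smul a x _ hx =>
      obtain ⟨x, rfl⟩ := mk_surjective I x
      rw [← map_smul, projDegree_mk, map_smul, map_smul, ← projDegree_mk, hx]
      split_ifs <;> simp
  · intro x
    obtain ⟨x, rfl⟩ := mk_surjective I x
    induction x using PathAlgebra.induction with
    | zero => rw [map_zero]; exact zero_mem _
    | add x y hx hy => rw [map_add]; exact add_mem hx hy
    | smul_of a p =>
      refine AddSubgroup.mem_iSup_of_mem (p.length : ℤ) ?_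
      rw [map_smul]
      exact (grading I _).smul_mem a (mk_of_mem I p rfl)

noncomputable instance [IsMonomial I] : DirectSum.Decomposition (grading I) :=
  (isInternal_grading I).chooseDecomposition

noncomputable instance [IsMonomial I] : GradedAlgebra (grading I) where

lemma finite_length_eq [∀ a b : V, Finite (a ⟶ b)] (n : ℕ) : {p : QPath V | p.length = n}.Finite := by
  induction n with
  | zero =>
    refine (Set.finite_range (fun v : V => QPath.trivial v)).subset ?_
    rintro ⟨p⟩ hp
    cases p with
    | nil => exact ⟨_, rfl⟩
    | cons p e => simp [QPath.length] at hp
  | succ n ih =>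
    refine (ih.biUnion (t := fun q => ⋃ v : V, Set.range
      (fun e : q.tgt ⟶ v => (⟨q.path.cons e⟩ : QPath V)))
      (fun q _ => Set.finite_iUnion fun v => Set.finite_range _)).subset ?_
    rintro ⟨p⟩ hp
    cases p with
    | nil => simp [QPath.length] at hp
    | cons p e =>
      simp only [Set.mem_iUnion]
      exact ⟨⟨p⟩, by simpa [QPath.length] using hp, _, e, rfl⟩

instance [∀ a b : V, Finite (a ⟶ b)] [h : IsMonomial I] : Module.Finite k (QuotAlgebra I) := by
  obtain ⟨N, hN⟩ := h.isAdmissible.1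
  have hfin : {p : QPath V | p.length < N}.Finite := by
    refine ((Set.finite_lt_nat N).biUnion (fun n _ => finite_length_eq n)).subset ?_
    intro p hp
    simpa using hp
  refine ⟨⟨(hfin.image fun p => mk I (of k p)).toFinset, eq_top_iff.2 ?_⟩⟩
  intro x _
  obtain ⟨x, rfl⟩ := mk_surjective I x
  induction x using PathAlgebra.induction with
  | zero => rw [map_zero]; exact zero_mem _
  | add x y hx hy => rw [map_add]; exact add_mem (hx trivial) (hy trivial)
  | smul_of a p =>
    rw [map_smul]
    apply Submodule.smul_mem
    by_cases hp : p.length < N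
    · exact Submodule.subset_span (by simpa using ⟨p, hp, rfl⟩)
    · rw [mk_eq_zero I (hN p (by lia))]
      exact zero_mem _

instance [∀ a b : V, Finite (a ⟶ b)] [IsMonomial I] : IsNoetherianRing (QuotAlgebra I) :=
  isNoetherian_of_tower k inferInstance

end QuotAlgebra

/-- A ring is (Iwanaga-)Gorenstein if it has finite injective dimension as a left and as a right
module over itself. -/
def IsGorenstein (A : Type u) [Ring A] : Prop :=
  (∃ d : ℕ, HasInjectiveDimensionLE (ModuleCat.of A A) d) ∧
    ∃ d : ℕ, HasInjectiveDimensionLE (ModuleCat.of Aᵐᵒᵖ A) d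

open GrMod in
/-- The graded module `T = ⨁_{0 ≤ i ≤ l} A(i)_{≤ 0}`. -/
noncomputable def tiltingModule [∀ a b : V, Finite (a ⟶ b)]
    (I : TwoSidedIdeal (PathAlgebra k V)) [IsMonomial I] (l : ℕ) :
    GrMod (QuotAlgebra.grading I) :=
  ⨁ fun i : Fin (l + 1) => ((regular (QuotAlgebra.grading I)).shift (i : ℤ)).truncLE 0

end Monomial

/-!
The truncation `A(n)_{≤ 0}` is the quotient of the projective module `A(n)` by the left ideal spanned
by the paths of length greater than `n`, and this ideal is a direct sum of left ideals `A p`, where `p`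
is a path of length `n + 1`, generated in degree one. Since `A` is monomial, the syzygy of `A p` is
again a direct sum of ideals `A r`, over the minimal nonzero paths `r` with `r p = 0`
(`QuotAlgebra.IsMinAnnihilator`). So both halves of the theorem concern the modules `A p`.

If `A` has injective dimension at most `d` as a left module, then `Ext¹(A q, A) = 0` for every `d`-th
syzygy path `q`. Evaluated on maps from the annihilator of `q` to `A`, this says that `q` has at most one
minimal annihilator, and that the minimal annihilators `r` satisfy a double annihilator condition
(`IsMinAnnihilator.eq_of_isSyzygyPath`, `IsMinAnnihilator.exists_eq_comp`). Hence the map that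
sends `r` to its minimal annihilator is a permutation of the finite set of minimal annihilators of
`d`-th syzygy paths, whose orbits are bi-infinite perfect sequences `c` (`QuotAlgebra.exists_isPerfect`). The modules `A (c j)` form a complete sequence of
syzygies, the next one being the syzygy of the previous one, so that morphisms of degree `n` from
`A (c 0)` to a module `Y` in the singularity category vanish as soon as there are no morphisms of graded
modules from `A (c n)` to `Y` (`IsCompleteSyzygySequence.homVanish_stalk`). The latter can be
read off from the degree of the generator `c n`.

For an arbitrary path `p`, the summands of the `d`-th syzygy of `A p` that are not projective are
isomorphic to members of perfect sequences. Going back along the syzygies, a perfect sequence that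
arises in this way has a path `c 0` that overlaps `p`, which bounds the degrees of the generators of
the whole sequence (`Overlaps.prev`, `homVanish_stalk_principal`): if `A p` is generated in degree
one, then those that matter for nonnegative `n` are in degrees `≥ 1`, and those that matter for `n < 0`
in degrees `≤ 0`. Since `A(m)_{≤ 0}` is in degrees `≤ 0` and its syzygy in degrees `≥ 1`, the morphisms
of nonzero degree between the truncations vanish (`homVanish_stalk_truncShift`).

For the generation, let `P` be a thick subcategory that contains the truncations. The truncations,
with the direct summands of their syzygies, give by induction the simple modules in degrees `≤ 0`, hence
all modules in degrees `≤ 0`. A module `A (c 0)` with `c` perfect is an iterated syzygy of modules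
`A (c (-m))`, which are in degrees `≤ 0` for large `m`. So `P` contains these, then every
`A p` with `p` of positive length, by descending induction along its syzygies, then every simple module,
and finally the whole category (`eq_top_of_prop_stalk_truncShift`).
-/

/-! ### Vanishing of all morphisms between two objects -/

section Vanishing

open Pretriangulated

/-- All morphisms from `X` to `Y` are zero. -/
def HomVanish {T : Type*} [Category* T] [HasZeroMorphisms T] (X Y : T) : Prop :=
  ∀ f : X ⟶ Y, f = 0

namespace HomVanish

section

variable {D : Type*} [Category* D] [HasZeroMorphisms D] {X X' Y Y' : D}

lemma of_retract_left (h : HomVanish X Y) (r : Retract X' X) : HomVanish X' Y := fun f => by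
  rw [← Category.id_comp f, ← r.retract, Category.assoc, h (r.r ≫ f), comp_zero]

lemma of_retract_right (h : HomVanish X Y) (r : Retract Y' Y) : HomVanish X Y' := fun f => by
  rw [← Category.comp_id f, ← r.retract, ← Category.assoc, h (f ≫ r.i), zero_comp]

lemma of_iso_left (h : HomVanish X Y) (e : X' ≅ X) : HomVanish X' Y := h.of_retract_left e.retract

lemma of_iso_right (h : HomVanish X Y) (e : Y' ≅ Y) : HomVanish X Y' :=
  h.of_retract_right e.retract

lemma of_isZero_left (h : IsZero X) : HomVanish X Y := fun _ => h.eq_of_src _ _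

lemma of_isZero_right (h : IsZero Y) : HomVanish X Y := fun _ => h.eq_of_tgt _ _

end

variable {T : Type*} [Category* T] [HasShift T ℤ] [Preadditive T]
  [∀ n : ℤ, (shiftFunctor T n).Additive] {X Y : T}

lemma shift (h : HomVanish X Y) (n : ℤ) : HomVanish (X⟦n⟧) (Y⟦n⟧) := fun f => by
  obtain ⟨g, rfl⟩ := (shiftFunctor T n).map_surjective f
  rw [h g, Functor.map_zero]

lemma of_shift (n : ℤ) (h : HomVanish (X⟦n⟧) (Y⟦n⟧)) : HomVanish X Y := fun f =>
  (shiftFunctor T n).map_injective (by rw [h (f⟦n⟧'), Functor.map_zero])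

/-- Morphisms `X⟦a⟧ ⟶ Y⟦b⟧` are morphisms `X ⟶ Y⟦b - a⟧`. -/
lemma shift_shift_iff (a b c : ℤ) (h : c + a = b) :
    HomVanish (X⟦a⟧) (Y⟦b⟧) ↔ HomVanish X (Y⟦c⟧) :=
  ⟨fun H => of_shift a (H.of_iso_right ((shiftFunctorAdd' T c a b h).symm.app Y)),
    fun H => (H.shift a).of_iso_right ((shiftFunctorAdd' T c a b h).app Y)⟩

variable [HasZeroObject T] [Pretriangulated T]

lemma obj₂ {S : Triangle T} (hS : S ∈ distTriang T) (h₁ : HomVanish S.obj₁ Y)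
    (h₃ : HomVanish S.obj₃ Y) : HomVanish S.obj₂ Y := fun f => by
  obtain ⟨g, rfl⟩ := S.yoneda_exact₂ hS f (h₁ _)
  rw [h₃ g, comp_zero]

lemma obj₃ {S : Triangle T} (hS : S ∈ distTriang T) (h₂ : HomVanish S.obj₂ Y)
    (h₁ : HomVanish (S.obj₁⟦(1 : ℤ)⟧) Y) : HomVanish S.obj₃ Y := fun f => by
  obtain ⟨g, rfl⟩ := S.yoneda_exact₃ hS f (h₂ _)
  rw [h₁ g, comp_zero]

lemma to_obj₂ {S : Triangle T} (hS : S ∈ distTriang T) (h₁ : HomVanish X S.obj₁)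
    (h₃ : HomVanish X S.obj₃) : HomVanish X S.obj₂ := fun f => by
  obtain ⟨g, rfl⟩ := S.coyoneda_exact₂ hS f (h₃ _)
  rw [h₁ g, zero_comp]

lemma to_obj₃ {S : Triangle T} (hS : S ∈ distTriang T) (h₂ : HomVanish X S.obj₂)
    (h₁ : HomVanish X (S.obj₁⟦(1 : ℤ)⟧)) : HomVanish X S.obj₃ := fun f => by
  obtain ⟨g, rfl⟩ := S.coyoneda_exact₃ hS f (h₁ _)
  rw [h₂ g, zero_comp]

end HomVanish

end Vanishing

/-! ### Complete sequences of syzygies in a singularity category -/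

namespace SingCat

open DerivedCategory Pretriangulated Triangulated

section

variable {C : Type u} [Category.{v} C] [Abelian C]

/-- Brutal truncation: a complex that vanishes below degree `a` is an extension of its term of
degree `a` by its part above degree `a`. -/
lemma exists_shortExact_single (K : CochainComplex C ℤ) (a : ℤ) (h0 : ∀ i < a, IsZero (K.X i)) :
    ∃ (K' : CochainComplex C ℤ) (ι : K' ⟶ K)
      (φ : K ⟶ (HomologicalComplex.single C (ComplexShape.up ℤ) a).obj (K.X a)) (w : ι ≫ φ = 0),
      (ShortComplex.mk ι φ w).ShortExact ∧ IsZero (K'.X a) ∧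
        ∀ i, i ≠ a → Nonempty (K'.X i ≅ K.X i) := by
  let φ : K ⟶ (HomologicalComplex.single C (ComplexShape.up ℤ) a).obj (K.X a) :=
    HomologicalComplex.mkHomToSingle (𝟙 _) (fun i hi => by
      apply (h0 i (by simp at hi; lia)).eq_of_src)
  have hφ : ∀ i, i ≠ a →
      IsZero (((HomologicalComplex.single C (ComplexShape.up ℤ) a).obj (K.X a)).X i) :=
    fun i hi => HomologicalComplex.isZero_single_obj_X _ _ _ _ hi
  have hφa : IsIso (φ.f a) := by
    dsimp [φ]
    rw [HomologicalComplex.mkHomToSingle_f]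
    infer_instance
  have hepi : ∀ i, Epi (φ.f i) := fun i => by
    by_cases hi : i = a
    · subst hi; infer_instance
    · exact ⟨fun _ _ _ => (hφ i hi).eq_of_src _ _⟩
  have hS : (ShortComplex.mk (kernel.ι φ) φ (kernel.condition φ)).ShortExact :=
    { exact := ShortComplex.exact_of_f_is_kernel _ (kernelIsKernel φ)
      mono_f := by dsimp; infer_instance
      epi_g := HomologicalComplex.epi_of_epi_f φ hepi }
  have hker (i : ℤ) := hS.map_of_exact (HomologicalComplex.eval C _ i)
  refine ⟨_, _, _, _, hS, (hker a).isIso_g_iff.1 hφa, fun i hi => ?_⟩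
  have h := (hker i).isIso_f_iff.2 (hφ i hi)
  exact ⟨@asIso _ _ _ _ _ h⟩

lemma homVanish_obj_biproduct {D : Type*} [Category* D] [Preadditive D] (F : C ⥤ D) [F.Additive]
    {J : Type} [Finite J] (X : J → C) [HasBiproduct X] {Z : D} (h : ∀ j, HomVanish (F.obj (X j)) Z) :
    HomVanish (F.obj (⨁ X)) Z := fun f => by
  have := Fintype.ofFinite J
  rw [← Category.id_comp f, ← F.map_id, ← biproduct.total, F.map_sum, Preadditive.sum_comp]
  refine Finset.sum_eq_zero fun j _ => ?_
  rw [F.map_comp, Category.assoc]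
  exact (congrArg _ (h j _)).trans comp_zero

lemma homVanish_to_obj_biproduct {D : Type*} [Category* D] [Preadditive D] (F : C ⥤ D)
    [F.Additive] {J : Type} [Finite J] (X : J → C) [HasBiproduct X] {Z : D}
    (h : ∀ j, HomVanish Z (F.obj (X j))) : HomVanish Z (F.obj (⨁ X)) := fun f => by
  have := Fintype.ofFinite J
  rw [← Category.comp_id f, ← F.map_id, ← biproduct.total, F.map_sum, Preadditive.comp_sum]
  refine Finset.sum_eq_zero fun j _ => ?_
  rw [F.map_comp, ← Category.assoc]
  exact (congrArg (· ≫ _) (h j _)).trans zero_comp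

end

variable (C : Type u) [Category.{v} C] [Abelian C] [HasDerivedCategory.{w} C]

/-- The functor that sends an object of `C` to the corresponding complex concentrated in
degree zero, in the bounded derived category. -/
noncomputable def boundedSingle : C ⥤ DerivedCategory.Bounded C :=
  ObjectProperty.lift _ (DerivedCategory.singleFunctor C 0)
    (fun _ => ⟨⟨0, inferInstance⟩, ⟨0, inferInstance⟩⟩)

instance : (boundedSingle C).Additive := ⟨by
  intro X Y f g
  apply Bounded.ι.map_injective
  refine Eq.trans ?_ (Bounded.ι.map_add).symm
  exact (DerivedCategory.singleFunctor C 0).map_add⟩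

/-- The functor `SingCat.stalk`. -/
noncomputable abbrev stalkFunctor : C ⥤ SingularityCategory C :=
  boundedSingle C ⋙ quotientFunctor C

instance : (quotientFunctor C).Additive := inferInstance

instance : (stalkFunctor C).Additive := inferInstance

instance : IsTriangulated (SingularityCategory C) := inferInstance

variable {C}

lemma exists_distinguished_of_bounded {X Y Z : DerivedCategory.Bounded C} (f : X ⟶ Y) (g : Y ⟶ Z)
    (δ : Bounded.ι.obj Z ⟶ (Bounded.ι.obj X)⟦(1 : ℤ)⟧)
    (h : Triangle.mk (Bounded.ι.map f) (Bounded.ι.map g) δ ∈ distTriang (DerivedCategory C)) :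
    ∃ δ' : Z ⟶ X⟦(1 : ℤ)⟧, Triangle.mk f g δ' ∈ distTriang (DerivedCategory.Bounded C) := by
  refine ⟨Bounded.ι.preimage (δ ≫ (Bounded.ι.commShiftIso (1 : ℤ)).inv.app X), ?_⟩
  refine isomorphic_distinguished _ h _
    (Triangle.isoMk _ _ (Iso.refl _) (Iso.refl _) (Iso.refl _) ?_ ?_ ?_)
  · exact (Category.comp_id _).trans (Category.id_comp _).symm
  · exact (Category.comp_id _).trans (Category.id_comp _).symm
  · refine Eq.trans ?_ (Category.id_comp _).symm
    refine (congrArg (_ ≫ ·) ((shiftFunctor (DerivedCategory C) (1 : ℤ)).map_id _)).trans ?_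
    refine (Category.comp_id _).trans ?_
    refine (congrArg (· ≫ (Bounded.ι.commShiftIso (1 : ℤ)).hom.app X)
      (Bounded.ι.map_preimage (δ ≫ (Bounded.ι.commShiftIso (1 : ℤ)).inv.app X))).trans ?_
    change (δ ≫ (Bounded.ι.commShiftIso (1 : ℤ)).inv.app X) ≫
      (Bounded.ι.commShiftIso (1 : ℤ)).hom.app X = δ
    rw [Category.assoc, Iso.inv_hom_id_app]
    exact Category.comp_id _

lemma exists_distinguished_boundedSingle {S : ShortComplex C} (hS : S.ShortExact) :
    ∃ δ : (boundedSingle C).obj S.X₃ ⟶ ((boundedSingle C).obj S.X₁)⟦(1 : ℤ)⟧,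
      Triangle.mk ((boundedSingle C).map S.f) ((boundedSingle C).map S.g) δ ∈
        distTriang (DerivedCategory.Bounded C) :=
  exists_distinguished_of_bounded _ _ hS.singleδ hS.singleTriangle_distinguished

lemma exists_distinguished_stalk {S : ShortComplex C} (hS : S.ShortExact) :
    ∃ δ : stalk S.X₃ ⟶ (stalk S.X₁)⟦(1 : ℤ)⟧,
      Triangle.mk ((stalkFunctor C).map S.f) ((stalkFunctor C).map S.g) δ ∈
        distTriang (SingularityCategory C) := by
  obtain ⟨δ, h⟩ := exists_distinguished_boundedSingle hS
  exact ⟨_, (quotientFunctor C).map_distinguished _ h⟩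

lemma perfect_single (P : C) [Projective P] : perfect C ((DerivedCategory.singleFunctor C 0).obj P) := by
  refine ⟨(HomologicalComplex.single C (ComplexShape.up ℤ) 0).obj P, ⟨0, 0, fun i hi => ?_⟩, fun i => ?_,
    ⟨(singleFunctorIsoCompQ C 0).app P⟩⟩
  · exact HomologicalComplex.isZero_single_obj_X _ _ _ _ (by lia)
  · by_cases hi : i = 0
    · subst hi
      exact Projective.of_iso (HomologicalComplex.singleObjXSelf (ComplexShape.up ℤ) 0 P).symm inferInstance
    · exact Projective.of_iso ((isZero_zero C).iso (HomologicalComplex.isZero_single_obj_X _ _ _ _ hi)) inferInstance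

lemma isZero_quotientFunctor_obj {X : DerivedCategory.Bounded C} (hX : boundedPerfect C X) :
    IsZero ((quotientFunctor C).obj X) := by
  have h : (boundedPerfect C).trW (0 : X ⟶ 0) := by
    rw [(boundedPerfect C).trW_iff']
    exact ⟨X, 𝟙 X, 0, contractible_distinguished X, hX⟩
  have := Localization.inverts (quotientFunctor C) (boundedPerfect C).trW _ h
  exact ((quotientFunctor C).map_isZero (isZero_zero _)).of_iso (asIso ((quotientFunctor C).map (0 : X ⟶ 0)))

lemma isZero_stalk (P : C) [Projective P] : IsZero (stalk P) :=
  isZero_quotientFunctor_obj (perfect_single P)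

lemma homVanish_bounded_iff {X Y : DerivedCategory.Bounded C} {n : ℤ} :
    HomVanish X (Y⟦n⟧) ↔ HomVanish (Bounded.ι.obj X) ((Bounded.ι.obj Y)⟦n⟧) := by
  let e := (Bounded.ι.commShiftIso n).app Y
  constructor
  · intro h f
    have : f ≫ e.inv = 0 := by
      obtain ⟨g, hg⟩ := Bounded.ι.map_surjective (f ≫ e.inv)
      rw [← hg, h g, Functor.map_zero]
    rw [← cancel_mono e.inv, this, zero_comp]
  · intro h f
    apply Bounded.ι.map_injective
    rw [Functor.map_zero, ← cancel_mono e.hom, zero_comp]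
    exact h _

lemma homVanish_single_zero {X Y : C} (h : HomVanish X Y) :
    HomVanish ((singleFunctor C 0).obj X) ((singleFunctor C 0).obj Y) := fun f => by
  obtain ⟨g, rfl⟩ := (singleFunctor C 0).map_surjective f
  rw [h g, Functor.map_zero]

lemma homVanish_single_of_neg (X Y : C) {n : ℤ} (hn : n < 0) :
    HomVanish ((singleFunctor C 0).obj X) (((singleFunctor C 0).obj Y)⟦n⟧) := fun f => by
  have : TStructure.t.IsGE (((singleFunctor C 0).obj Y)⟦n⟧) (-n) :=
    TStructure.t.isGE_shift _ 0 n (-n)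
  exact TStructure.t.zero f 0 (-n)

lemma homVanish_single_of_projective (P : C) [Projective P] {X : DerivedCategory C} {n : ℤ}
    (hn : n < 0) [X.IsLE n] : HomVanish ((singleFunctor C 0).obj P) X := by
  obtain ⟨K, hK, ⟨e⟩⟩ := X.exists_iso_Q_obj_of_isLE n
  have : HomVanish (Q.obj ((CochainComplex.singleFunctor C 0).obj P)) (Q.obj K) :=
    fun f => from_singleFunctor_obj_eq_zero_of_projective f n hn
  exact (this.of_iso_left ((singleFunctorIsoCompQ C 0).app P)).of_iso_right e

lemma homVanish_single_of_projective' (P Y : C) [Projective P] {n : ℤ} (hn : 0 < n) :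
    HomVanish ((singleFunctor C 0).obj P) (((singleFunctor C 0).obj Y)⟦n⟧) := by
  have : TStructure.t.IsLE (((singleFunctor C 0).obj Y)⟦n⟧) (-n) :=
    TStructure.t.isLE_shift _ 0 n (-n)
  exact homVanish_single_of_projective P (n := -n) (by lia)

/-- A bounded complex is built from its terms by extensions. -/
lemma prop_Q_obj (W : ObjectProperty (DerivedCategory C)) [W.IsClosedUnderIsomorphisms]
    [W.ContainsZero] [W.IsTriangulatedClosed₂] (K : CochainComplex C ℤ) (r : ℕ) (a : ℤ)
    (h0 : ∀ i : ℤ, (i < a ∨ a + r ≤ i) → IsZero (K.X i))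
    (hK : ∀ i n : ℤ, W (((singleFunctor C 0).obj (K.X i))⟦n⟧)) : W (Q.obj K) := by
  induction r generalizing a K with
  | zero =>
    refine W.prop_of_isZero (Functor.map_isZero _ ?_)
    rw [IsZero.iff_id_eq_zero]
    ext i
    exact (h0 i (by push_cast; lia)).eq_of_src _ _
  | succ r ih =>
    obtain ⟨K', ι, φ, w, hS, hK'a, hK'⟩ := exists_shortExact_single K a (fun i hi => h0 i (Or.inl hi))
    have h1 : W (Q.obj K') := ih K' (a + 1) (fun i hi => by
      by_cases hia : i = a
      · subst hia; exact hK'a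
      · exact (h0 i (by push_cast; lia)).of_iso (hK' i hia).some) (fun i n => by
      by_cases hia : i = a
      · subst hia
        exact W.prop_of_isZero (Functor.map_isZero _ (Functor.map_isZero _ hK'a))
      · exact W.prop_of_iso ((shiftFunctor _ n).mapIso
          ((singleFunctor C 0).mapIso (hK' i hia).some.symm)) (hK i n))
    refine W.ext_of_isTriangulatedClosed₂ _ (triangleOfSES_distinguished hS) h1 ?_
    refine W.prop_of_iso ?_ (hK a (-a))
    exact ((singleFunctors C).shiftIso (-a) a 0 (by lia)).app (K.X a) ≪≫
      (singleFunctorIsoCompQ C a).app (K.X a)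

/-- A sequence of objects `G j` that are the syzygies of an acyclic complex of projective
objects which stays acyclic under `Hom(-, Q)` for `Q` projective: `G (j + 1)` is a syzygy of
`G j`, and morphisms from it to projective objects extend to the projective object in between. -/
def IsCompleteSyzygySequence (G : ℤ → C) : Prop :=
  ∀ j j' : ℤ, j + 1 = j' → ∃ (P : C) (i : G j' ⟶ P) (p : P ⟶ G j) (w : i ≫ p = 0),
    (ShortComplex.mk i p w).ShortExact ∧ Projective P ∧
      ∀ (Q : C) [Projective Q] (f : G j' ⟶ Q), ∃ g : P ⟶ Q, i ≫ g = f

namespace IsCompleteSyzygySequence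

variable {G : ℤ → C} (hG : IsCompleteSyzygySequence G)

include hG

/-- There are no extensions of positive degree of `G j` by projective objects. -/
lemma homVanish_projective (j : ℤ) (k : ℕ) (Q : C) [Projective Q] :
    HomVanish ((singleFunctor C 0).obj (G j)) (((singleFunctor C 0).obj Q)⟦(k + 1 : ℤ)⟧) := by
  induction k generalizing j with
  | zero =>
    obtain ⟨P, i, p, w, hS, hP, hext⟩ := hG j _ rfl
    intro f
    obtain ⟨h, rfl⟩ := Triangle.yoneda_exact₃ _ hS.singleTriangle_distinguished f
      (homVanish_single_of_projective' P Q (by lia) _)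
    obtain ⟨h, rfl⟩ := (shiftFunctor _ _).map_surjective h
    obtain ⟨h, rfl⟩ := (singleFunctor C 0).map_surjective h
    obtain ⟨g, rfl⟩ := hext Q h
    have := comp_distTriang_mor_zero₃₁ _ hS.singleTriangle_distinguished
    refine (congrArg (_ ≫ ·) ((congrArg (shiftFunctor _ (1 : ℤ)).map
      ((singleFunctor C 0).map_comp i g)).trans ((shiftFunctor _ (1 : ℤ)).map_comp _ _))).trans ?_
    exact (Category.assoc _ _ _).symm.trans ((congrArg (· ≫ _) this).trans zero_comp)
  | succ k ih =>
    obtain ⟨P, i, p, w, hS, hP, hext⟩ := hG j _ rfl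
    refine HomVanish.obj₃ hS.singleTriangle_distinguished
      (homVanish_single_of_projective' P Q (by lia)) ?_
    refine (HomVanish.shift_shift_iff _ _ (k + 1) (by push_cast; ring)).2 (ih _)

/-- A perfect complex receives no morphisms from `G (-m)⟦-m⟧` if `m` is large. -/
lemma homVanish_perfect {X : DerivedCategory C} (hX : perfect C X) :
    ∃ N : ℤ, ∀ m ≥ N, HomVanish ((singleFunctor C 0).obj (G (-m))) (X⟦m⟧) := by
  let W : ObjectProperty (DerivedCategory C) := fun X =>
    ∃ N : ℤ, ∀ m ≥ N, HomVanish ((singleFunctor C 0).obj (G (-m))) (X⟦m⟧)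
  have : W.IsClosedUnderIsomorphisms :=
    { of_iso := fun e ⟨N, hN⟩ =>
        ⟨N, fun m hm => (hN m hm).of_iso_right ((shiftFunctor _ m).mapIso e.symm)⟩ }
  have : W.ContainsZero :=
    { exists_zero := ⟨0, isZero_zero _, 0, fun m _ =>
        HomVanish.of_isZero_right (Functor.map_isZero _ (isZero_zero _))⟩ }
  have : W.IsTriangulatedClosed₂ := .mk' fun T hT ⟨N, hN⟩ ⟨N', hN'⟩ =>
    ⟨max N N', fun m hm => HomVanish.to_obj₂ (Triangle.shift_distinguished _ hT m)
      (hN m (le_trans (le_max_left _ _) hm)) (hN' m (le_trans (le_max_right _ _) hm))⟩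
  obtain ⟨K, ⟨a, b, h0⟩, hK, ⟨e⟩⟩ := hX
  refine W.prop_of_iso e.symm (prop_Q_obj W K (b + 1 - a).toNat a (fun i hi => h0 i (by lia)) ?_)
  intro i n
  have := hK i
  refine ⟨1 - n, fun m hm => ?_⟩
  refine (hG.homVanish_projective (-m) (n + m - 1).toNat (K.X i)).of_iso_right ?_
  exact ((shiftFunctorAdd' _ n m _ (by lia)).app _).symm

/-- The shifting of dimensions in the derived category. -/
lemma homVanish_single {Y : C} (j n : ℤ) (h : HomVanish (G (j + n)) Y) :
    HomVanish ((singleFunctor C 0).obj (G j)) (((singleFunctor C 0).obj Y)⟦n⟧) := by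
  obtain hn | hn := lt_or_ge n 0
  · exact homVanish_single_of_neg _ _ hn
  · obtain ⟨k, rfl⟩ := Int.eq_ofNat_of_zero_le hn
    clear hn
    induction k generalizing j with
    | zero =>
      rw [Int.natCast_zero, add_zero] at h
      exact (homVanish_single_zero h).of_iso_right ((shiftFunctorZero _ ℤ).app _)
    | succ k ih =>
      obtain ⟨P, i, p, w, hS, hP, hext⟩ := hG j _ rfl
      refine HomVanish.obj₃ hS.singleTriangle_distinguished
        (homVanish_single_of_projective' P Y (by lia)) ?_
      refine (HomVanish.shift_shift_iff _ _ (k : ℤ) (by push_cast; ring)).2 (ih _ ?_)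
      rwa [add_assoc, add_comm 1, ← Nat.cast_succ]

/-- The connecting morphisms of the sequence compose to a morphism `G (-m)⟦-m⟧ ⟶ G 0` that becomes an
isomorphism in the singularity category. -/
lemma exists_trW (m : ℕ) :
    ∃ u : ((boundedSingle C).obj (G (-m)))⟦(-m : ℤ)⟧ ⟶ (boundedSingle C).obj (G 0),
      (boundedPerfect C).trW u := by
  induction m with
  | zero =>
    exact ⟨((shiftFunctorZero' _ (-(0 : ℕ) : ℤ) (by simp)).app _).hom ≫
      (boundedSingle C).map (eqToHom (by simp)),
      (boundedPerfect C).trW_of_isIso _⟩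
  | succ m ih =>
    obtain ⟨u, hu⟩ := ih
    obtain ⟨P, i, p, w, hS, hP, hext⟩ := hG (-(m + 1 : ℕ)) (-m) (by push_cast; lia)
    obtain ⟨δ, hT⟩ := exists_distinguished_boundedSingle hS
    have hδ : (boundedPerfect C).trW δ :=
      ObjectProperty.trW.mk _ (rot_of_distTriang _ (rot_of_distTriang _ hT))
        ((boundedPerfect C).le_shift _ _ (perfect_single P))
    refine ⟨δ⟦(-(m + 1 : ℕ) : ℤ)⟧' ≫ ((shiftFunctorAdd' _ (1 : ℤ) (-(m + 1 : ℕ) : ℤ) (-m)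
      (by push_cast; lia)).symm.app _).hom ≫ u, ?_⟩
    exact MorphismProperty.comp_mem _ _ _ (hδ.shift _)
      (MorphismProperty.comp_mem _ _ _ ((boundedPerfect C).trW_of_isIso _) hu)

lemma homVanish_quotientFunctor {Y : C} (n : ℤ) (h : HomVanish (G n) Y) :
    HomVanish ((quotientFunctor C).obj ((boundedSingle C).obj (G 0)))
      ((quotientFunctor C).obj (((boundedSingle C).obj Y)⟦n⟧)) := by
  intro f
  obtain ⟨φ, rfl⟩ := Localization.exists_rightFraction (quotientFunctor C)
    (boundedPerfect C).trW f
  obtain ⟨Z, g, h', hT, hZ⟩ := φ.hs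
  obtain ⟨N, hN⟩ := hG.homVanish_perfect hZ
  obtain ⟨u, hu⟩ := hG.exists_trW N.toNat
  have hZ0 : HomVanish (((boundedSingle C).obj (G (-N.toNat)))⟦(-N.toNat : ℤ)⟧) Z := by
    refine HomVanish.of_iso_right ?_ ((shiftFunctorZero _ ℤ).symm.app Z)
    refine (HomVanish.shift_shift_iff _ _ (N.toNat : ℤ) (by lia)).2 ?_
    exact homVanish_bounded_iff.2 (hN _ (by lia))
  -- Since `G (-N)⟦-N⟧` has no morphisms to the cone `Z` of the denominator of the fraction, `u` factors
  -- through the denominator, which makes the fraction a morphism from `G (-N)⟦-N⟧`.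
  obtain ⟨t, ht⟩ : ∃ t : _ ⟶ φ.X', u = t ≫ φ.s := Triangle.coyoneda_exact₂ _ hT u (hZ0 _)
  have hY : HomVanish (((boundedSingle C).obj (G (-N.toNat)))⟦(-N.toNat : ℤ)⟧)
      (((boundedSingle C).obj Y)⟦n⟧) := by
    refine (HomVanish.shift_shift_iff _ _ (n + N.toNat) (by lia)).2 ?_
    refine homVanish_bounded_iff.2 (hG.homVanish_single (-N.toNat : ℤ) (n + N.toNat) ?_)
    rwa [add_comm n, neg_add_cancel_left]
  have := Localization.inverts (quotientFunctor C) (boundedPerfect C).trW _ hu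
  rw [← cancel_epi ((quotientFunctor C).map u), comp_zero, ht, Functor.map_comp, Category.assoc,
    MorphismProperty.RightFraction.map_s_comp_map, ← Functor.map_comp, hY (t ≫ φ.f), Functor.map_zero]

/-- Morphisms of degree `n` in the singularity category from `G 0` vanish if there are no morphisms
in `C` from `G n`, the `n`-th syzygy of `G 0`, or its `-n`-th cosyzygy if `n < 0`. -/
theorem homVanish_stalk {Y : C} (n : ℤ) (h : HomVanish (G n) Y) :
    HomVanish (stalk (G 0)) ((stalk Y)⟦n⟧) := by
  refine HomVanish.of_iso_right ?_
    (((quotientFunctor C).commShiftIso n).symm.app ((boundedSingle C).obj Y))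
  exact hG.homVanish_quotientFunctor n h

end IsCompleteSyzygySequence

/-! ### Morphisms and generators in the singularity category -/

section

variable {S : ShortComplex C} (hS : S.ShortExact)

include hS

lemma homVanish_stalk_X₂ {Z : SingularityCategory C} (h₁ : HomVanish (stalk S.X₁) Z)
    (h₃ : HomVanish (stalk S.X₃) Z) : HomVanish (stalk S.X₂) Z := by
  obtain ⟨δ, hT⟩ := exists_distinguished_stalk hS
  exact HomVanish.obj₂ hT h₁ h₃

lemma homVanish_stalk_X₃ [Projective S.X₂] {Y : SingularityCategory C} {n : ℤ}
    (h : HomVanish (stalk S.X₁) (Y⟦n⟧)) : HomVanish (stalk S.X₃) (Y⟦n + 1⟧) := by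
  obtain ⟨δ, hT⟩ := exists_distinguished_stalk hS
  exact HomVanish.obj₃ hT (HomVanish.of_isZero_left (isZero_stalk S.X₂))
    ((HomVanish.shift_shift_iff _ _ _ rfl).2 h)

lemma homVanish_shift_stalk_X₃ [Projective S.X₂] {X : SingularityCategory C} {n : ℤ}
    (h : HomVanish X ((stalk S.X₁)⟦n + 1⟧)) : HomVanish X ((stalk S.X₃)⟦n⟧) := by
  obtain ⟨δ, hT⟩ := exists_distinguished_stalk hS
  exact HomVanish.to_obj₃ (Triangle.shift_distinguished _ hT n)
    (HomVanish.of_isZero_right (Functor.map_isZero _ (isZero_stalk S.X₂)))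
    (h.of_iso_right ((shiftFunctorAdd' _ n 1 (n + 1) rfl).symm.app _))

end

lemma homVanish_stalk_biproduct {J : Type} [Finite J] (X : J → C) [HasBiproduct X] (n : ℤ)
    (h : ∀ i j, HomVanish (stalk (X i)) ((stalk (X j))⟦n⟧)) :
    HomVanish (stalk (⨁ X)) ((stalk (⨁ X))⟦n⟧) :=
  homVanish_obj_biproduct (stalkFunctor C) X fun i =>
    homVanish_to_obj_biproduct (stalkFunctor C ⋙ shiftFunctor _ n) X fun j => h i j

variable (P : ObjectProperty (SingularityCategory C)) [P.IsTriangulated]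
  [P.IsClosedUnderIsomorphisms]

/-- The singularity category is generated by the objects of `C`. -/
lemma eq_top_of_stalk (h : ∀ M : C, P (stalk M)) : P = ⊤ := by
  let R : ObjectProperty (DerivedCategory.Bounded C) := P.inverseImage (quotientFunctor C)
  have hR : R.IsTriangulated := inferInstance
  let W : ObjectProperty (DerivedCategory C) := R.map Bounded.ι
  rw [eq_top_iff]
  rintro X -
  obtain ⟨B, ⟨e⟩⟩ : ∃ B, Nonempty ((quotientFunctor C).obj B ≅ X) :=
    ⟨_, ⟨(Localization.essSurj (quotientFunctor C) (boundedPerfect C).trW).mem_essImage X |>.getIso⟩⟩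
  refine P.prop_of_iso e ?_
  change R B
  obtain ⟨⟨a, ha⟩, ⟨b, hb⟩⟩ := B.property
  obtain ⟨K, hKa, hKb, ⟨eK⟩⟩ := DerivedCategory.exists_iso_Q_obj_of_isGE_of_isLE B.obj a b
  obtain ⟨Y, hY, ⟨eY⟩⟩ := (R.prop_map_iff _ _).1 <| prop_Q_obj W K (b + 1 - a).toNat a (fun i hi => by
    obtain hi | hi := hi
    · exact K.isZero_of_isStrictlyGE a i hi
    · exact K.isZero_of_isStrictlyLE b i (by lia)) (fun i n =>
    (R.prop_map_iff _ _).2 ⟨((boundedSingle C).obj (K.X i))⟦n⟧, R.le_shift n _ (h _),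
      ⟨(Bounded.ι.commShiftIso n).app ((boundedSingle C).obj (K.X i))⟩⟩)
  exact R.prop_of_iso (Bounded.ι.preimageIso (eY ≪≫ eK.symm)) hY

section

variable {P} {S : ShortComplex C} (hS : S.ShortExact)

include hS

lemma prop_stalk_X₁ (h₂ : P (stalk S.X₂)) (h₃ : P (stalk S.X₃)) : P (stalk S.X₁) := by
  obtain ⟨δ, hT⟩ := exists_distinguished_stalk hS
  exact P.ext_of_isTriangulatedClosed₁ _ hT h₂ h₃

lemma prop_stalk_X₂ (h₁ : P (stalk S.X₁)) (h₃ : P (stalk S.X₃)) : P (stalk S.X₂) := by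
  obtain ⟨δ, hT⟩ := exists_distinguished_stalk hS
  exact P.ext_of_isTriangulatedClosed₂ _ hT h₁ h₃

lemma prop_stalk_X₃ (h₁ : P (stalk S.X₁)) (h₂ : P (stalk S.X₂)) : P (stalk S.X₃) := by
  obtain ⟨δ, hT⟩ := exists_distinguished_stalk hS
  exact P.ext_of_isTriangulatedClosed₃ _ hT h₁ h₂

end

lemma prop_stalk_of_projective (M : C) [Projective M] : P (stalk M) :=
  P.prop_of_isZero (isZero_stalk M)

/-- If a generating class contains some member of a complete sequence of syzygies, it contains
all the later ones. -/
lemma IsCompleteSyzygySequence.prop_stalk {G : ℤ → C} (hG : IsCompleteSyzygySequence G)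
    (m : ℕ) (h : P (stalk (G (-m)))) : P (stalk (G 0)) := by
  induction m with
  | zero => simpa using h
  | succ m ih =>
    obtain ⟨Q, i, p, w, hS, hQ, -⟩ := hG (-(m + 1 : ℕ)) (-m) (by push_cast; lia)
    exact ih (prop_stalk_X₁ hS (prop_stalk_of_projective P Q) h)

end SingCat

/-! ### Factorizations of paths -/

namespace QPath

variable {V : Type u} [Quiver.{u} V]

lemma exists_eq_comp (p : QPath V) {n : ℕ} (hn : n ≤ p.length) :
    ∃ (a b : QPath V) (h : b.tgt = a.src), p = a.comp b h ∧ b.length = n := by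
  obtain ⟨p⟩ := p
  induction p with
  | nil =>
    obtain rfl : n = 0 := by simpa [length] using hn
    rename_i v _
    exact ⟨trivial v, trivial v, rfl, rfl, rfl⟩
  | cons p e ih =>
    obtain hn' | hn' := (show n ≤ p.length + 1 from hn).lt_or_eq
    · obtain ⟨⟨a⟩, ⟨b⟩, h, hp, hb⟩ := ih (show n ≤ p.length by lia)
      dsimp at h
      subst h
      simp only [comp, QPath.mk.injEq] at hp
      obtain ⟨rfl, rfl, hp⟩ := hp
      obtain rfl := eq_of_heq hp
      exact ⟨⟨a.cons e⟩, ⟨b⟩, rfl, by simp [comp], hb⟩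
    · exact ⟨trivial _, ⟨p.cons e⟩, rfl, by simp [comp, trivial], hn'.symm⟩

lemma comp_inj {a b a' b' : QPath V} {h : b.tgt = a.src} {h' : b'.tgt = a'.src}
    (H : a.comp b h = a'.comp b' h') (hb : b.length = b'.length) : a = a' ∧ b = b' := by
  obtain ⟨a⟩ := a
  obtain ⟨b⟩ := b
  obtain ⟨a'⟩ := a'
  obtain ⟨b'⟩ := b'
  dsimp at h h'
  subst h h'
  simp only [comp, QPath.mk.injEq, Quiver.Path.cast_rfl_rfl] at H
  obtain ⟨rfl, rfl, H⟩ := H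
  replace H := eq_of_heq H
  induction a with
  | nil =>
    cases a' with
    | nil => simpa using H
    | cons a' e =>
      have := congrArg Quiver.Path.length H
      simp [length] at this hb
      lia
  | cons a e ih =>
    cases a' with
    | nil =>
      have := congrArg Quiver.Path.length H
      simp [length] at this hb
      lia
    | cons a' e' =>
      simp only [Quiver.Path.comp_cons, Quiver.Path.cons.injEq] at H
      obtain ⟨rfl, H, rfl⟩ := H
      obtain ⟨h1, h2⟩ := ih _ (eq_of_heq H)
      simp only [QPath.mk.injEq, true_and] at h1
      obtain ⟨h1, h3⟩ := h1
      subst h1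
      obtain rfl := eq_of_heq h3
      exact ⟨rfl, h2⟩

lemma eq_trivial (p : QPath V) (hp : p.length = 0) : p = trivial p.src := by
  obtain ⟨p⟩ := p
  cases p with
  | nil => rfl
  | cons p e => simp [length] at hp

lemma comp_eq_right (a b : QPath V) (h : b.tgt = a.src) (ha : a.length = 0) : a.comp b h = b := by
  obtain ⟨a⟩ := a
  cases a with
  | nil => obtain ⟨b⟩ := b; dsimp at h; subst h; simp [comp]
  | cons p e => simp [length] at ha

lemma comp_eq_left (a b : QPath V) (h : b.tgt = a.src) (hb : b.length = 0) : a.comp b h = a := by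
  obtain ⟨b⟩ := b
  cases b with
  | nil => obtain ⟨a⟩ := a; dsimp at h; subst h; simp [comp]
  | cons p e => simp [length] at hb

@[simp] lemma trivial_length (v : V) : (trivial v).length = 0 := rfl

/-- Two factorizations `a p = b q` of the same path, with `p` not longer than `q`, have a common
refinement. -/
lemma exists_of_comp_eq_comp {a p b q : QPath V} {h : p.tgt = a.src} {h' : q.tgt = b.src}
    (H : a.comp p h = b.comp q h') (hpq : p.length ≤ q.length) :
    ∃ (m : QPath V) (h₁ : p.tgt = m.src) (h₂ : m.tgt = b.src),
      q = m.comp p h₁ ∧ a = b.comp m h₂ := by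
  obtain ⟨m, p', hm, rfl, hp'⟩ := q.exists_eq_comp hpq
  rw [← comp_assoc b m p' h' hm] at H
  obtain ⟨rfl, rfl⟩ := comp_inj H hp'.symm
  exact ⟨m, hm, h', rfl, rfl⟩

end QPath

/-! ### The basis of paths of a monomial algebra -/

namespace QuotAlgebra

open PathAlgebra

variable {k V : Type u} [Field k] [Quiver.{u} V]
  (I : TwoSidedIdeal (PathAlgebra k V))

/-- The path `p` is nonzero in `kQ/I`. -/
def IsNonzero (p : QPath V) : Prop := of k p ∉ I

variable {I} in
lemma IsNonzero.left {a b : QPath V} {h : b.tgt = a.src} (H : IsNonzero I (a.comp b h)) :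
    IsNonzero I a := fun ha => H <| by
  rw [← of_mul_of_eq k h]
  exact I.mul_mem_right _ _ ha

variable {I} in
lemma IsNonzero.right {a b : QPath V} {h : b.tgt = a.src} (H : IsNonzero I (a.comp b h)) :
    IsNonzero I b := fun hb => H <| by
  rw [← of_mul_of_eq k h]
  exact I.mul_mem_left _ _ hb

variable [Fintype V]

/-- The class of a path in `kQ/I`. -/
noncomputable def path (p : QPath V) : QuotAlgebra I := mk I (of k p)

variable {I}

lemma path_eq_zero {p : QPath V} (h : ¬ IsNonzero I p) : path I p = 0 :=
  mk_eq_zero I (not_not.1 h)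

lemma path_mul_path {a b : QPath V} (h : b.tgt = a.src) :
    path I a * path I b = path I (a.comp b h) := by
  rw [path, path, path, ← map_mul, of_mul_of_eq k h]

lemma path_mul_path_of_ne {a b : QPath V} (h : b.tgt ≠ a.src) : path I a * path I b = 0 := by
  rw [path, path, ← map_mul, of_mul_of_ne k h, map_zero]

lemma path_trivial_mul {v : V} {p : QPath V} (h : p.tgt = v) :
    path I (QPath.trivial v) * path I p = path I p := by
  subst h
  rw [path_mul_path (a := QPath.trivial p.tgt) rfl, QPath.trivial_comp]

lemma path_mul_trivial {v : V} {p : QPath V} (h : p.src = v) :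
    path I p * path I (QPath.trivial v) = path I p := by
  subst h
  rw [path_mul_path (b := QPath.trivial p.src) rfl, QPath.comp_trivial]

lemma path_mem_grading (p : QPath V) {n : ℤ} (h : (p.length : ℤ) = n) :
    path I p ∈ grading I n := mk_of_mem I p h

lemma induction {P : QuotAlgebra I → Prop} (x : QuotAlgebra I) (zero : P 0)
    (add : ∀ x y, P x → P y → P (x + y)) (smul_path : ∀ (c : k) (p : QPath V), P (c • path I p)) :
    P x := by
  obtain ⟨x, rfl⟩ := mk_surjective I x
  induction x using PathAlgebra.induction with
  | zero => simpa using zero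
  | add x y hx hy => rw [map_add]; exact add _ _ hx hy
  | smul_of c p => rw [map_smul]; exact smul_path c p

variable (I) in
/-- A monomial ideal is spanned by the paths in it. -/
lemma of_mem_of_repr_ne_zero [h : IsMonomial I] {x : PathAlgebra k V} (hx : x ∈ I) {p : QPath V}
    (hp : (basis k).repr x p ≠ 0) : of k p ∈ I := by
  obtain ⟨S, -, hS⟩ := h.exists_paths
  have hI : ∀ p ∈ S, of k p ∈ I := fun p hp => by
    rw [hS]; exact TwoSidedIdeal.subset_span ⟨p, hp, rfl⟩
  let N : Submodule k (PathAlgebra k V) :=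
    { carrier := {x | ∀ p, (basis k).repr x p ≠ 0 → of k p ∈ I}
      zero_mem' := by simp
      add_mem' := fun {a b} ha hb p hp => by
        rw [map_add, Finsupp.add_apply] at hp
        by_cases h : (basis k).repr a p = 0
        · rw [h, zero_add] at hp
          exact hb p hp
        · exact ha p h
      smul_mem' := fun c x hx p hp => hx p (by
        rw [map_smul, Finsupp.smul_apply] at hp
        exact right_ne_zero_of_smul hp) }
  suffices x ∈ N from this p hp
  have hof : ∀ q : QPath V, of k q ∈ I → of k q ∈ N := fun q hq p hp => by
    classical
    rw [of, Module.Basis.repr_self, Finsupp.single_apply] at hp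
    split_ifs at hp with hqp
    · exact hqp ▸ hq
    · exact absurd rfl hp
  clear hp p
  rw [hS, TwoSidedIdeal.mem_span_iff_mem_addSubgroup_closure] at hx
  induction hx using AddSubgroup.closure_induction with
  | zero => exact N.zero_mem
  | add x y _ _ hx hy => exact N.add_mem hx hy
  | neg x _ hx => exact N.neg_mem hx
  | mem x hx =>
    obtain ⟨y, ⟨a, -, _, ⟨s, hs, rfl⟩, rfl⟩, b, -, rfl⟩ := hx
    dsimp only
    induction a using PathAlgebra.induction with
    | zero => simp
    | add a a' ha ha' => simpa [add_mul] using N.add_mem ha ha'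
    | smul_of c p =>
    induction b using PathAlgebra.induction with
    | zero => simp
    | add a a' ha ha' => simpa [mul_add] using N.add_mem ha ha'
    | smul_of d q =>
    simp only [smul_mul_assoc, mul_smul_comm]
    apply N.smul_mem
    apply N.smul_mem
    have hmem : of k p * of k s * of k q ∈ I := I.mul_mem_right _ _ (I.mul_mem_left _ _ (hI s hs))
    by_cases h : s.tgt = p.src
    · rw [of_mul_of_eq k h] at hmem ⊢
      by_cases h' : q.tgt = s.src
      · rw [of_mul_of_eq k (p := p.comp s h) h'] at hmem ⊢
        exact hof _ hmem
      · rw [of_mul_of_ne k (p := p.comp s h) h']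
        exact N.zero_mem
    · rw [of_mul_of_ne k h, zero_mul]
      exact N.zero_mem

section Coefficients

variable (I) in
open Classical in
/-- The coefficients of an element of `kQ` at the paths outside `I`. -/
noncomputable def nonzeroCoeff : PathAlgebra k V →ₗ[k] (QPath V →₀ k) :=
  (basis k).constr k fun p => if IsNonzero I p then Finsupp.single p 1 else 0

open Classical in
lemma nonzeroCoeff_apply (x : PathAlgebra k V) (p : QPath V) :
    nonzeroCoeff I x p = if IsNonzero I p then (basis k).repr x p else 0 := by
  induction x using PathAlgebra.induction with
  | zero => simp
  | add x y hx hy => rw [map_add, map_add, Finsupp.add_apply, Finsupp.add_apply, hx, hy]; split_ifs <;> simp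
  | smul_of c q =>
    rw [map_smul, map_smul, Finsupp.smul_apply, Finsupp.smul_apply, of, Module.Basis.repr_self,
      nonzeroCoeff, Module.Basis.constr_basis]
    by_cases hq : q = p
    · subst hq
      split_ifs <;> simp
    · split_ifs <;> simp [hq]

variable [IsMonomial I]

variable (I) in
/-- The coefficients of an element of `kQ/I` in the basis of the paths outside `I`. -/
noncomputable def coeff : QuotAlgebra I →ₗ[k] (QPath V →₀ k) :=
  let f : QuotAlgebra I →+ (QPath V →₀ k) :=
    I.ringCon.toAddCon.lift (nonzeroCoeff I).toAddMonoidHom (by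
      intro x y hxy
      have h : x - y ∈ I := (TwoSidedIdeal.rel_iff I x y).1 hxy
      have : nonzeroCoeff I (x - y) = 0 := by
        ext p
        rw [nonzeroCoeff_apply]
        split_ifs with hp
        · by_contra hne
          exact hp (of_mem_of_repr_ne_zero I h hne)
        · rfl
      rw [map_sub, sub_eq_zero] at this
      exact this)
  { f with
    map_smul' := by
      intro c x
      obtain ⟨x, rfl⟩ := mk_surjective I x
      rw [← map_smul]
      exact (nonzeroCoeff I).map_smul c x }

lemma coeff_mk (x : PathAlgebra k V) : coeff I (mk I x) = nonzeroCoeff I x := rfl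

lemma coeff_path {p : QPath V} (hp : IsNonzero I p) : coeff I (path I p) = Finsupp.single p 1 := by
  rw [path, coeff_mk, of, nonzeroCoeff, Module.Basis.constr_basis, if_pos hp]

lemma isNonzero_of_coeff_ne_zero {x : QuotAlgebra I} {p : QPath V} (h : coeff I x p ≠ 0) :
    IsNonzero I p := by
  obtain ⟨x, rfl⟩ := mk_surjective I x
  rw [coeff_mk, nonzeroCoeff_apply] at h
  by_contra hp
  simp [hp] at h

lemma path_ne_zero {p : QPath V} (hp : IsNonzero I p) : path I p ≠ 0 := fun h => by
  have := coeff_path hp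
  rw [h, map_zero] at this
  simpa using this.symm

lemma sum_coeff (x : QuotAlgebra I) : (coeff I x).sum (fun p c => c • path I p) = x := by
  induction x using QuotAlgebra.induction with
  | zero => simp
  | add x y hx hy =>
    rw [map_add, Finsupp.sum_add_index' (h := fun p (c : k) => c • path I p)
      (fun p => zero_smul k (path I p)) (fun p c d => add_smul c d (path I p)), hx, hy]
  | smul_path c p =>
    by_cases hp : IsNonzero I p
    · rw [map_smul, coeff_path hp, Finsupp.smul_single, smul_eq_mul, mul_one]
      exact Finsupp.sum_single_index (h := fun p (c : k) => c • path I p) (zero_smul k (path I p))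
    · rw [path_eq_zero hp, smul_zero, map_zero, Finsupp.sum_zero_index]

lemma coeff_mul_path (x : QuotAlgebra I) (a y : QPath V) (h : y.tgt = a.src)
    (hay : IsNonzero I (a.comp y h)) :
    coeff I (x * path I y) (a.comp y h) = coeff I x a := by
  induction x using QuotAlgebra.induction with
  | zero => simp
  | add x x' hx hx' => rw [add_mul, map_add, map_add, Finsupp.add_apply, Finsupp.add_apply, hx, hx']
  | smul_path c b =>
    rw [smul_mul_assoc, map_smul, map_smul, Finsupp.smul_apply, Finsupp.smul_apply]
    congr 1
    by_cases hb : b = a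
    · subst hb
      rw [path_mul_path h, coeff_path hay, coeff_path hay.left, Finsupp.single_eq_same,
        Finsupp.single_eq_same]
    · have : coeff I (path I b) a = 0 := by
        by_cases hb' : IsNonzero I b
        · rw [coeff_path hb', Finsupp.single_eq_of_ne (Ne.symm hb)]
        · rw [path_eq_zero hb']; simp
      rw [this]
      by_cases hby : y.tgt = b.src
      · rw [path_mul_path hby]
        by_cases hby' : IsNonzero I (b.comp y hby)
        · rw [coeff_path hby', Finsupp.single_eq_of_ne]
          intro h'
          exact hb (QPath.comp_inj h' rfl).1.symm
        · rw [path_eq_zero hby']; simp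
      · rw [path_mul_path_of_ne hby]; simp

lemma coeff_path_mul (x : QuotAlgebra I) (a y : QPath V) (h : y.tgt = a.src)
    (hay : IsNonzero I (a.comp y h)) :
    coeff I (path I a * x) (a.comp y h) = coeff I x y := by
  induction x using QuotAlgebra.induction with
  | zero => simp
  | add x x' hx hx' => rw [mul_add, map_add, map_add, Finsupp.add_apply, Finsupp.add_apply, hx, hx']
  | smul_path c b =>
    rw [mul_smul_comm, map_smul, map_smul, Finsupp.smul_apply, Finsupp.smul_apply]
    congr 1
    by_cases hb : b = y
    · subst hb
      rw [path_mul_path h, coeff_path hay, coeff_path hay.right, Finsupp.single_eq_same,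
        Finsupp.single_eq_same]
    · have : coeff I (path I b) y = 0 := by
        by_cases hb' : IsNonzero I b
        · rw [coeff_path hb', Finsupp.single_eq_of_ne (Ne.symm hb)]
        · rw [path_eq_zero hb']; simp
      rw [this]
      by_cases hby : b.tgt = a.src
      · rw [path_mul_path hby]
        by_cases hby' : IsNonzero I (a.comp b hby)
        · rw [coeff_path hby', Finsupp.single_eq_of_ne]
          intro h'
          have hl := congrArg QPath.length h'
          rw [QPath.length_comp, QPath.length_comp] at hl
          exact hb (QPath.comp_inj h' (by lia)).2.symm
        · rw [path_eq_zero hby']; simp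
      · rw [path_mul_path_of_ne hby]; simp

/-- If `a` occurs in `path p * x`, then `a = p b` for a path `b` that occurs in `x`. -/
lemma exists_of_coeff_path_mul_ne_zero {x : QuotAlgebra I} {p a : QPath V}
    (h : coeff I (path I p * x) a ≠ 0) :
    ∃ (b : QPath V) (hb : b.tgt = p.src), a = p.comp b hb := by
  by_contra! H
  apply h
  clear h
  induction x using QuotAlgebra.induction with
  | zero => simp
  | add x x' hx hx' => rw [mul_add, map_add, Finsupp.add_apply, hx, hx', add_zero]
  | smul_path c b =>
    rw [mul_smul_comm, map_smul, Finsupp.smul_apply]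
    by_cases hb : b.tgt = p.src
    · rw [path_mul_path hb]
      by_cases hpb : IsNonzero I (p.comp b hb)
      · rw [coeff_path hpb, Finsupp.single_eq_of_ne (H b hb), smul_zero]
      · rw [path_eq_zero hpb]; simp
    · rw [path_mul_path_of_ne hb]; simp

end Coefficients

end QuotAlgebra

/-! ### Exactness and projectivity of graded modules -/

namespace GrMod

variable {k A : Type u} [CommRing k] [Ring A] [Algebra k A] {𝒜 : ℤ → Submodule k A}

lemma mono_of_injective {X Y : GrMod 𝒜} (f : X ⟶ Y) (hf : Function.Injective f.lin) : Mono f :=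
  ⟨fun _ _ H => hom_ext fun x => hf (congrArg (fun l => Hom.lin l x) H)⟩

lemma epi_of_surjective {X Y : GrMod 𝒜} (f : X ⟶ Y) (hf : Function.Surjective f.lin) : Epi f :=
  ⟨fun _ _ H => hom_ext fun y => by
    obtain ⟨x, rfl⟩ := hf y
    exact congrArg (fun l => Hom.lin l x) H⟩

lemma mem_of_map_mem {X Y : GrMod 𝒜} (f : X ⟶ Y) (hf : Function.Injective f.lin) {i : ℤ}
    {x : X.carrier} (hx : f.lin x ∈ Y.grading i) : x ∈ X.grading i := by
  have : X.proj i x = x := hf (by rw [map_proj, Y.proj_of_mem hx])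
  rw [← this]
  exact X.proj_mem i x

lemma exists_mem_of_surjective {X Y : GrMod 𝒜} (f : X ⟶ Y) (hf : Function.Surjective f.lin)
    {i : ℤ} {y : Y.carrier} (hy : y ∈ Y.grading i) : ∃ x ∈ X.grading i, f.lin x = y := by
  obtain ⟨x, rfl⟩ := hf y
  exact ⟨X.proj i x, X.proj_mem i x, by rw [map_proj, Y.proj_of_mem hy]⟩

section ShortExact

variable [IsNoetherianRing A]

lemma shortExact_mk {X Y Z : GrMod 𝒜} (f : X ⟶ Y) (g : Y ⟶ Z) (w : f ≫ g = 0)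
    (hf : Function.Injective f.lin) (hg : Function.Surjective g.lin)
    (h : ∀ y, g.lin y = 0 → ∃ x, f.lin x = y) : (ShortComplex.mk f g w).ShortExact := by
  have hm := mono_of_injective f hf
  have he := epi_of_surjective g hg
  refine ShortComplex.ShortExact.mk' ?_ hm he
  refine ShortComplex.exact_of_f_is_kernel _ (KernelFork.IsLimit.ofι' f w fun {T} t ht => ?_)
  have hr : ∀ x, t.lin x ∈ LinearMap.range f.lin := fun x =>
    h _ (congrArg (fun l => Hom.lin l x) ht)
  let e := LinearEquiv.ofInjective f.lin hf
  have hfe : ∀ y : LinearMap.range f.lin, f.lin (e.symm y) = y := fun y =>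
    congrArg Subtype.val (e.apply_symm_apply y)
  refine ⟨⟨e.symm.toLinearMap ∘ₗ t.lin.codRestrict _ hr, fun {i x} hx => ?_⟩, hom_ext fun x => ?_⟩
  · refine mem_of_map_mem f hf ?_
    have := hfe (t.lin.codRestrict _ hr x)
    change f.lin (e.symm (t.lin.codRestrict _ hr x)) ∈ _
    rw [this]
    exact t.map_mem hx
  · exact hfe (t.lin.codRestrict _ hr x)

lemma shortExact_sub_quot (X : GrMod 𝒜) (N : Submodule A X.carrier) (hN : X.IsGradedSub N) :
    ∃ w, (ShortComplex.mk (X.subIncl N hN) (X.quotMk N hN) w).ShortExact := by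
  have w : X.subIncl N hN ≫ X.quotMk N hN = 0 := by
    apply hom_ext
    intro x
    exact (Submodule.Quotient.mk_eq_zero _).2 x.2
  refine ⟨w, shortExact_mk _ _ w Subtype.val_injective (Submodule.mkQ_surjective _) fun y hy => ?_⟩
  exact ⟨⟨y, (Submodule.Quotient.mk_eq_zero _).1 hy⟩, rfl⟩

end ShortExact

/-- A graded module generated by a homogeneous element `e`, from which the elements `x` are
recovered as `φ x • e` for a homogeneous linear map `φ` to the ring, is projective. -/
lemma projective_of_smul_eq {X : GrMod 𝒜} {d : ℤ} (e : X.carrier) (he : e ∈ X.grading d)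
    (φ : X.carrier →ₗ[A] A) (hφ : ∀ i, ∀ x ∈ X.grading i, φ x ∈ 𝒜 (i - d))
    (h : ∀ x, φ x • e = x) : Projective X where
  factors {Y Z} f g _ := by
    obtain ⟨y, hy, hgy⟩ := exists_mem_of_surjective g (surjective_of_epi g) (f.map_mem he)
    refine ⟨⟨(LinearMap.toSpanSingleton A _ y) ∘ₗ φ, fun {i x} hx => ?_⟩, hom_ext fun x => ?_⟩
    · have := Y.smul_mem (hφ i x hx) hy
      rwa [sub_add_cancel] at this
    · change g.lin (φ x • y) = f.lin x
      rw [map_smul, hgy, ← map_smul, h]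

lemma projective_regular_shift [GradedAlgebra 𝒜] (n : ℤ) : Projective ((regular 𝒜).shift n) := by
  refine projective_of_smul_eq (d := -n) (1 : A) ?_ LinearMap.id ?_ fun x => mul_one (M := A) x
  · change (1 : A) ∈ 𝒜 (n + -n)
    rw [add_neg_cancel]
    exact SetLike.GradedOne.one_mem
  · intro i x hx
    change x ∈ 𝒜 (n + i) at hx
    change x ∈ 𝒜 (i - -n)
    rwa [sub_neg_eq_add, add_comm]

/-- Every graded module is a quotient of one in any class that contains the shifts of the regular
module and is closed under finite direct sums. -/
lemma exists_surjective [GradedAlgebra 𝒜] (P : GrMod 𝒜 → Prop)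
    (h0 : P zero) (hreg : ∀ n, P ((regular 𝒜).shift n)) (hprod : ∀ X Y, P X → P Y → P (X.prod Y))
    (X : GrMod 𝒜) : ∃ (F : GrMod 𝒜) (f : F ⟶ X), P F ∧ Function.Surjective f.lin := by
  classical
  have key : ∀ s : Finset X.carrier, ∃ (F : GrMod 𝒜) (f : F ⟶ X), P F ∧
      ∀ x ∈ s, x ∈ LinearMap.range f.lin := by
    suffices H : ∀ s : Finset (ℤ × X.carrier), ∃ (F : GrMod 𝒜) (f : F ⟶ X), P F ∧
        ∀ x ∈ s, X.proj x.1 x.2 ∈ LinearMap.range f.lin by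
      intro s
      have hsupp : ∀ x : X.carrier, ∃ t : Finset ℤ, x = ∑ i ∈ t, X.proj i x := fun x => by
        induction x using X.induction_on with
        | hom i x hx => exact ⟨{i}, by rw [Finset.sum_singleton, X.proj_of_mem hx]⟩
        | add x y hx hy =>
          obtain ⟨a, ha⟩ := X.isInternal.2 (x + y)
          refine ⟨a.support, ?_⟩
          simp only [← ha, proj_coe]
          rw [DirectSum.coeAddMonoidHom_eq_dfinsuppSum]
          rfl
      choose t ht using hsupp
      obtain ⟨F, f, hF, hf⟩ := H (s.biUnion fun x => (t x).image fun i => (i, x))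
      refine ⟨F, f, hF, fun x hx => ?_⟩
      rw [ht x]
      refine sum_mem fun i hi => hf (i, x) ?_
      exact Finset.mem_biUnion.2 ⟨x, hx, Finset.mem_image_of_mem _ hi⟩
    intro s
    induction s using Finset.induction_on with
    | empty => exact ⟨zero, 0, h0, by simp⟩
    | insert x s _ ih =>
      obtain ⟨F, f, hF, hf⟩ := ih
      obtain ⟨i, x⟩ := x
      refine ⟨F.prod ((regular 𝒜).shift (-i)),
        ⟨f.lin.coprod (LinearMap.toSpanSingleton A _ (X.proj i x)), ?_⟩,
        hprod _ _ hF (hreg _), ?_⟩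
      · rintro j ⟨y, a⟩ ⟨hy, ha⟩
        refine add_mem (f.map_mem hy) ?_
        have := X.smul_mem (show a ∈ 𝒜 (-i + j) from ha) (X.proj_mem i x)
        rwa [neg_add_cancel_comm] at this
      · intro y hy
        obtain rfl | hy := Finset.mem_insert.1 hy
        · refine ⟨((0 : F.carrier), (1 : A)), ?_⟩
          change f.lin 0 + (1 : A) • X.proj i x = _
          rw [map_zero, one_smul, zero_add]
        · obtain ⟨z, hz⟩ := hf y hy
          refine ⟨(z, (0 : A)), ?_⟩
          change f.lin z + (0 : A) • X.proj i x = _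
          rw [zero_smul, add_zero, hz]
  obtain ⟨s, hs⟩ := X.finite.fg_top
  obtain ⟨F, f, hF, hf⟩ := key s
  refine ⟨F, f, hF, LinearMap.range_eq_top.1 (top_le_iff.1 ?_)⟩
  rw [← hs, Submodule.span_le]
  exact hf

/-- If `z` annihilates only multiples of `y` in the image of `e`, in the regular module, then also
in every projective graded module. -/
lemma exists_smul_eq_of_projective [GradedAlgebra 𝒜] {e y z : A}
    (h : ∀ a : A, e * a = a → z * a = 0 → ∃ b, y * b = a) (X : GrMod 𝒜) [Projective X]
    (x : X.carrier) (hx : e • x = x) (hzx : z • x = 0) : ∃ x', y • x' = x := by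
  obtain ⟨F, f, hF, hf⟩ := exists_surjective
    (fun X : GrMod 𝒜 => ∀ x : X.carrier, e • x = x → z • x = 0 → ∃ x', y • x' = x)
    (fun x _ _ => ⟨0, Subsingleton.elim (α := PUnit) _ _⟩)
    (fun n x hx hzx => h x hx hzx)
    (fun X Y hX hY x hx hzx => by
      obtain ⟨a, ha⟩ := hX x.1 (congrArg Prod.fst hx) (congrArg Prod.fst hzx)
      obtain ⟨b, hb⟩ := hY x.2 (congrArg Prod.snd hx) (congrArg Prod.snd hzx)
      exact ⟨(a, b), Prod.ext ha hb⟩) X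
  have := epi_of_surjective f hf
  obtain ⟨s, hs⟩ := Projective.factors (𝟙 X) f
  obtain ⟨x', hx'⟩ := hF (s.lin x) (by rw [← map_smul, hx]) (by rw [← map_smul, hzx, map_zero])
  refine ⟨f.lin x', ?_⟩
  rw [← map_smul, hx']
  exact congrArg (fun l => Hom.lin l x) hs

end GrMod

/-! ### Left ideals spanned by paths -/

/-- A set of paths of a quiver that is closed under composition with paths on the left. -/
structure PathSet (V : Type u) [Quiver.{u} V] where
  carrier : Set (QPath V)
  comp_mem' : ∀ {p : QPath V}, p ∈ carrier → ∀ (a : QPath V) (h : p.tgt = a.src),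
    a.comp p h ∈ carrier

namespace PathSet

variable {V : Type u} [Quiver.{u} V]

instance : Membership (QPath V) (PathSet V) := ⟨fun W p => p ∈ W.carrier⟩

lemma comp_mem (W : PathSet V) {p : QPath V} (hp : p ∈ W) (a : QPath V) (h : p.tgt = a.src) :
    a.comp p h ∈ W := W.comp_mem' hp a h

/-- The paths that end, on the right, in a path of `F`. -/
def generated (F : Set (QPath V)) : PathSet V where
  carrier := {p | ∃ r ∈ F, ∃ (b : QPath V) (h : r.tgt = b.src), p = b.comp r h}
  comp_mem' := by
    rintro _ ⟨r, hr, b, h, rfl⟩ a h'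
    exact ⟨r, hr, a.comp b h', h, (QPath.comp_assoc a b r h' h).symm⟩

/-- The paths of the form `b p`. -/
def principal (p : QPath V) : PathSet V := generated {p}

/-- The paths of length at least `n` that start at `v`. -/
def startAt (v : V) (n : ℕ) : PathSet V where
  carrier := {p | p.src = v ∧ n ≤ p.length}
  comp_mem' hp a h := ⟨hp.1, hp.2.trans (by rw [QPath.length_comp]; lia)⟩

/-- The paths of length at least `n`. -/
def lengthGE (V : Type u) [Quiver.{u} V] (n : ℕ) : PathSet V where
  carrier := {p | n ≤ p.length}
  comp_mem' {p} hp a h := by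
    have : n ≤ p.length := hp
    change n ≤ _
    rw [QPath.length_comp]
    lia

/-- The paths `a`, composable with `p`, such that `a p` lies in the ideal `I`. -/
def annihilator {k : Type u} [Field k] (I : TwoSidedIdeal (PathAlgebra k V)) (p : QPath V) :
    PathSet V where
  carrier := {a | ∃ h : p.tgt = a.src, ¬ QuotAlgebra.IsNonzero I (a.comp p h)}
  comp_mem' := by
    rintro a ⟨h, ha⟩ b hb
    refine ⟨h, fun H => ha ?_⟩
    rw [QPath.comp_assoc b a p hb h] at H
    exact H.right

lemma mem_principal {p q : QPath V} :
    q ∈ principal p ↔ ∃ (b : QPath V) (h : p.tgt = b.src), q = b.comp p h :=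
  ⟨by rintro ⟨_, rfl, h⟩; exact h, fun h => ⟨p, rfl, h⟩⟩

lemma self_mem_principal (p : QPath V) : p ∈ principal p :=
  mem_principal.2 ⟨_, rfl, (QPath.trivial_comp p).symm⟩

lemma mem_startAt {v : V} {n : ℕ} {p : QPath V} : p ∈ startAt v n ↔ p.src = v ∧ n ≤ p.length :=
  Iff.rfl

lemma mem_lengthGE {n : ℕ} {p : QPath V} : p ∈ lengthGE V n ↔ n ≤ p.length := Iff.rfl

end PathSet

namespace QuotAlgebra

open PathAlgebra

variable {k V : Type u} [Field k] [Quiver.{u} V] [Fintype V]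
  (I : TwoSidedIdeal (PathAlgebra k V)) [IsMonomial I]

/-- The left ideal of `kQ/I` spanned by the paths in `W`. -/
noncomputable def pathIdeal (W : PathSet V) : Submodule (QuotAlgebra I) (QuotAlgebra I) where
  carrier := {x | ∀ p, coeff I x p ≠ 0 → p ∈ W}
  zero_mem' := by simp
  add_mem' {x y} hx hy p hp := by
    rw [map_add, Finsupp.add_apply] at hp
    by_cases h : coeff I x p = 0
    · rw [h, zero_add] at hp
      exact hy p hp
    · exact hx p h
  smul_mem' a x hx := by
    rw [smul_eq_mul]
    induction a using QuotAlgebra.induction with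
    | zero => simp
    | add a b ha hb =>
      intro p hp
      rw [add_mul, map_add, Finsupp.add_apply] at hp
      by_cases h : coeff I (a * x) p = 0
      · rw [h, zero_add] at hp
        exact hb p hp
      · exact ha p h
    | smul_path c q =>
      intro p hp
      rw [smul_mul_assoc, map_smul, Finsupp.smul_apply] at hp
      have hp := right_ne_zero_of_smul hp
      obtain ⟨b, h, rfl⟩ := exists_of_coeff_path_mul_ne_zero hp
      rw [coeff_path_mul x q b h (isNonzero_of_coeff_ne_zero hp)] at hp
      exact W.comp_mem (hx b hp) q h

variable {I} {W W' W₁ W₂ : PathSet V}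

lemma smul_mem_pathIdeal (c : k) {x : QuotAlgebra I} (hx : x ∈ pathIdeal I W) :
    c • x ∈ pathIdeal I W := fun p hp => hx p <| by
  rw [map_smul, Finsupp.smul_apply] at hp
  exact right_ne_zero_of_smul hp

lemma path_mem_pathIdeal {p : QPath V} (hp : IsNonzero I p → p ∈ W) : path I p ∈ pathIdeal I W := by
  by_cases h : IsNonzero I p
  · intro q hq
    rw [coeff_path h] at hq
    obtain rfl : p = q := by
      by_contra hne
      exact hq (Finsupp.single_eq_of_ne (Ne.symm hne))
    exact hp h
  · rw [path_eq_zero h]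
    exact zero_mem _

/-- An additive property of the elements of a path ideal may be checked on the nonzero paths. -/
lemma pathIdeal_induction {P : QuotAlgebra I → Prop} {x : QuotAlgebra I} (hx : x ∈ pathIdeal I W)
    (zero : P 0) (add : ∀ x y, P x → P y → P (x + y))
    (smul_path : ∀ (c : k) (p : QPath V), p ∈ W → IsNonzero I p → P (c • path I p)) : P x := by
  rw [← sum_coeff x]
  refine Finset.sum_induction _ P add zero fun p hp => smul_path _ p ?_ ?_
  · exact hx p (Finsupp.mem_support_iff.1 hp)
  · exact isNonzero_of_coeff_ne_zero (Finsupp.mem_support_iff.1 hp)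

lemma pathIdeal_mono (h : ∀ p, IsNonzero I p → p ∈ W → p ∈ W') : pathIdeal I W ≤ pathIdeal I W' :=
  fun _ hx p hp => h p (isNonzero_of_coeff_ne_zero hp) (hx p hp)

lemma pathIdeal_congr (h : ∀ p, IsNonzero I p → (p ∈ W ↔ p ∈ W')) :
    pathIdeal I W = pathIdeal I W' :=
  le_antisymm (pathIdeal_mono fun p hp => (h p hp).1) (pathIdeal_mono fun p hp => (h p hp).2)

/-- The homogeneous component of degree `i` of an element of `kQ/I`. -/
noncomputable def component (i : ℤ) : QuotAlgebra I →+ QuotAlgebra I :=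
  (GrMod.regular (grading I)).proj i

lemma component_of_mem (i : ℤ) {j : ℤ} {x : QuotAlgebra I} (hx : x ∈ grading I j) :
    component i x = if j = i then x else 0 :=
  (GrMod.regular (grading I)).proj_mem_of_homogeneous hx

lemma coeff_path_of_ne {p q : QPath V} (h : p ≠ q) : coeff I (path I p) q = 0 := by
  by_cases hp : IsNonzero I p
  · rw [coeff_path hp, Finsupp.single_eq_of_ne (Ne.symm h)]
  · rw [path_eq_zero hp, map_zero, Finsupp.zero_apply]

lemma coeff_component (i : ℤ) (x : QuotAlgebra I) (p : QPath V) :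
    coeff I (component i x) p = if (p.length : ℤ) = i then coeff I x p else 0 := by
  induction x using QuotAlgebra.induction with
  | zero => simp
  | add x y hx hy =>
    rw [map_add, map_add, Finsupp.add_apply, hx, hy, map_add, Finsupp.add_apply]
    split_ifs <;> simp
  | smul_path c q =>
    rw [component_of_mem i ((grading I _).smul_mem c (path_mem_grading q rfl))]
    by_cases hqp : q = p
    · subst hqp
      split_ifs <;> simp
    · have : coeff I (c • path I q) p = 0 := by
        rw [map_smul, Finsupp.smul_apply, coeff_path_of_ne hqp, smul_zero]
      rw [this, ite_self]
      split_ifs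
      · exact this
      · rw [map_zero, Finsupp.zero_apply]

variable (I) in
lemma isGradedSub_pathIdeal (W : PathSet V) :
    (GrMod.regular (grading I)).IsGradedSub (pathIdeal I W) := by
  suffices ∀ i, ∀ x ∈ pathIdeal I W, component i x ∈ pathIdeal I W from this
  intro i x hx p hp
  rw [coeff_component] at hp
  split_ifs at hp with h
  · exact hx p hp
  · exact absurd rfl hp

/-- The coefficients of a homogeneous element of degree `i` vanish outside the paths of length
`i`. -/
lemma length_of_coeff_ne_zero {x : QuotAlgebra I} {i : ℤ} (hx : x ∈ grading I i) {p : QPath V}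
    (hp : coeff I x p ≠ 0) : (p.length : ℤ) = i := by
  by_contra h
  have := coeff_component i x p
  rw [component_of_mem i hx, if_pos rfl, if_neg h] at this
  exact hp this

/-- The linear map that keeps the terms of an element along the paths in `W`. -/
noncomputable def restrict (W : PathSet V) : QuotAlgebra I →ₗ[k] QuotAlgebra I :=
  open Classical in
  Finsupp.linearCombination k (fun p => if p ∈ W then path I p else 0) ∘ₗ coeff I

lemma restrict_path_of_mem {p : QPath V} (hp : p ∈ W) : restrict W (path I p) = path I p := by
  by_cases h : IsNonzero I p
  · rw [restrict, LinearMap.comp_apply, coeff_path h, Finsupp.linearCombination_single, one_smul,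
      if_pos hp]
  · rw [path_eq_zero h, map_zero]

lemma restrict_path_of_notMem {p : QPath V} (hp : p ∉ W) : restrict W (path I p) = 0 := by
  by_cases h : IsNonzero I p
  · rw [restrict, LinearMap.comp_apply, coeff_path h, Finsupp.linearCombination_single, one_smul,
      if_neg hp]
  · rw [path_eq_zero h, map_zero]

lemma coeff_restrict_of_mem (x : QuotAlgebra I) {p : QPath V} (hp : p ∈ W) :
    coeff I (restrict W x) p = coeff I x p := by
  induction x using QuotAlgebra.induction with
  | zero => simp
  | add x y hx hy => simp only [map_add, Finsupp.add_apply, hx, hy]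
  | smul_path c q =>
    rw [map_smul, map_smul, map_smul, Finsupp.smul_apply, Finsupp.smul_apply]
    congr 1
    by_cases hq : q ∈ W
    · rw [restrict_path_of_mem hq]
    · rw [restrict_path_of_notMem hq]
      by_cases h : IsNonzero I q
      · rw [coeff_path h, Finsupp.single_eq_of_ne (by rintro rfl; exact hq hp)]
        simp
      · rw [path_eq_zero h]

lemma coeff_restrict_of_notMem (x : QuotAlgebra I) {p : QPath V} (hp : p ∉ W) :
    coeff I (restrict W x) p = 0 := by
  induction x using QuotAlgebra.induction with
  | zero => simp
  | add x y hx hy => simp only [map_add, Finsupp.add_apply, hx, hy, add_zero]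
  | smul_path c q =>
    rw [map_smul, map_smul, Finsupp.smul_apply]
    by_cases hq : q ∈ W
    · rw [restrict_path_of_mem hq]
      by_cases h : IsNonzero I q
      · rw [coeff_path h, Finsupp.single_eq_of_ne (by rintro rfl; exact hp hq), smul_zero]
      · rw [path_eq_zero h]; simp
    · rw [restrict_path_of_notMem hq]; simp

lemma restrict_mem (x : QuotAlgebra I) : restrict W x ∈ pathIdeal I W := fun p hp => by
  by_contra h
  exact hp (coeff_restrict_of_notMem x h)

lemma coeff_ext {x y : QuotAlgebra I} (h : ∀ p, coeff I x p = coeff I y p) : x = y := by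
  rw [← sum_coeff x, ← sum_coeff y, Finsupp.ext h]

lemma restrict_eq_self {x : QuotAlgebra I} (hx : x ∈ pathIdeal I W) : restrict W x = x :=
  coeff_ext fun p => by
    by_cases hp : p ∈ W
    · exact coeff_restrict_of_mem x hp
    · rw [coeff_restrict_of_notMem x hp]
      by_contra h
      exact hp (hx p (Ne.symm h))

lemma restrict_mem_grading {x : QuotAlgebra I} {i : ℤ} (hx : x ∈ grading I i) :
    restrict W x ∈ grading I i := by
  rw [← sum_coeff (restrict W x)]
  refine sum_mem fun p hp => (grading I i).smul_mem _ (path_mem_grading p ?_)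
  refine length_of_coeff_ne_zero hx (p := p) fun h => ?_
  rw [Finsupp.mem_support_iff] at hp
  by_cases hpW : p ∈ W
  · exact hp ((coeff_restrict_of_mem x hpW).trans h)
  · exact hp (coeff_restrict_of_notMem x hpW)

/-- If the nonzero paths of `W` outside `W₂` are closed under composition on the left, then the
restriction to `W₂` is linear on the left ideal spanned by `W`. -/
lemma restrict_mul (h : ∀ p ∈ W, ∀ (a : QPath V) (hap : p.tgt = a.src),
    IsNonzero I (a.comp p hap) → a.comp p hap ∈ W₂ → p ∈ W₂)
    (a : QuotAlgebra I) {x : QuotAlgebra I} (hx : x ∈ pathIdeal I W) :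
    restrict W₂ (a * x) = a * restrict W₂ x := by
  induction a using QuotAlgebra.induction with
  | zero => simp
  | add a b ha hb => rw [add_mul, map_add, ha, hb, add_mul]
  | smul_path c a =>
  rw [smul_mul_assoc, map_smul, smul_mul_assoc]
  congr 1
  refine pathIdeal_induction (P := fun x => restrict W₂ (path I a * x) = path I a * restrict W₂ x)
    hx (by simp) (fun x y hx hy => ?_) fun d p hp _ => ?_
  · rw [mul_add, map_add, map_add, mul_add, hx, hy]
  rw [mul_smul_comm, map_smul, map_smul, mul_smul_comm]
  congr 1
  by_cases hap : p.tgt = a.src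
  · by_cases hp₂ : p ∈ W₂
    · rw [restrict_path_of_mem hp₂, path_mul_path hap, restrict_path_of_mem (W₂.comp_mem hp₂ a hap)]
    · rw [restrict_path_of_notMem hp₂, path_mul_path hap, mul_zero]
      by_cases hn : IsNonzero I (a.comp p hap)
      · exact restrict_path_of_notMem fun h' => hp₂ (h p hp a hap hn h')
      · rw [path_eq_zero hn, map_zero]
  · rw [path_mul_path_of_ne hap, map_zero]
    by_cases hp₂ : p ∈ W₂
    · rw [restrict_path_of_mem hp₂, path_mul_path_of_ne hap]
    · rw [restrict_path_of_notMem hp₂, mul_zero]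


lemma mul_path_mem_pathIdeal {x : QPath V}
    (h : ∀ a ∈ W, ∀ hax : x.tgt = a.src, IsNonzero I (a.comp x hax) → a.comp x hax ∈ W')
    {z : QuotAlgebra I} (hz : z ∈ pathIdeal I W) : z * path I x ∈ pathIdeal I W' := by
  refine pathIdeal_induction (P := fun z => z * path I x ∈ pathIdeal I W') hz (by simp)
    (fun a b ha hb => ?_) fun c p hp _ => ?_
  · rw [add_mul]
    exact add_mem ha hb
  · rw [smul_mul_assoc]
    refine smul_mem_pathIdeal c ?_
    by_cases hxp : x.tgt = p.src
    · rw [path_mul_path hxp]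
      exact path_mem_pathIdeal fun hn => h p hp hxp hn
    · rw [path_mul_path_of_ne hxp]
      exact zero_mem _

lemma mul_trivial_of_mem {v : V} {n : ℕ} {x : QuotAlgebra I}
    (hx : x ∈ pathIdeal I (PathSet.startAt v n)) : x * path I (QPath.trivial v) = x :=
  pathIdeal_induction (P := fun x => x * path I (QPath.trivial v) = x) hx (zero_mul _)
    (fun x y hx hy => by rw [add_mul, hx, hy])
    fun c p hp _ => by rw [smul_mul_assoc, path_mul_trivial hp.1]

section GradedModule

variable [∀ a b : V, Finite (a ⟶ b)]

variable (I) in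
/-- The left ideal spanned by the paths in `W`, shifted by `s`, as a graded module. -/
noncomputable def idealMod (W : PathSet V) (s : ℤ) : GrMod (grading I) :=
  have : Module.Finite (QuotAlgebra I) (pathIdeal I W) := inferInstance
  (@GrMod.sub _ _ _ _ _ _ (GrMod.regular (grading I)) (pathIdeal I W) (isGradedSub_pathIdeal I W)
    this).shift s

lemma mem_idealMod_grading {s i : ℤ} {x : (idealMod I W s).carrier} :
    x ∈ (idealMod I W s).grading i ↔ (x : pathIdeal I W).1 ∈ grading I (s + i) := Iff.rfl

lemma idealMod_congr (h : ∀ p, IsNonzero I p → (p ∈ W ↔ p ∈ W')) (s : ℤ) :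
    idealMod I W s = idealMod I W' s := by
  have key : ∀ (N N' : Submodule (QuotAlgebra I) (QuotAlgebra I))
      (hN : (GrMod.regular (grading I)).IsGradedSub N)
      (hN' : (GrMod.regular (grading I)).IsGradedSub N') (h : Module.Finite (QuotAlgebra I) N)
      (h' : Module.Finite (QuotAlgebra I) N'), N = N' →
      (@GrMod.sub _ _ _ _ _ _ (GrMod.regular (grading I)) N hN h).shift s =
        (@GrMod.sub _ _ _ _ _ _ (GrMod.regular (grading I)) N' hN' h').shift s := by
    rintro N _ hN hN' h h' rfl
    rfl
  exact key _ _ _ _ _ _ (pathIdeal_congr h)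

/-- A linear map between path ideals that is homogeneous of degree `s' - s`, as a morphism of graded
modules. -/
noncomputable def idealModHom {s s' : ℤ} (f : pathIdeal I W →ₗ[QuotAlgebra I] pathIdeal I W')
    (hf : ∀ i, ∀ x : pathIdeal I W, x.1 ∈ grading I (s + i) → (f x).1 ∈ grading I (s' + i)) :
    idealMod I W s ⟶ idealMod I W' s' :=
  ⟨f, fun {i x} hx => hf i x hx⟩

/-- The inclusion between path ideals. -/
noncomputable def inclusion (h : ∀ p, IsNonzero I p → p ∈ W → p ∈ W') (s : ℤ) :
    idealMod I W s ⟶ idealMod I W' s :=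
  idealModHom (Submodule.inclusion (pathIdeal_mono h)) fun _ _ hx => hx

/-- The multiplication on the right by a path. -/
noncomputable def mulRight (x : QPath V)
    (h : ∀ a ∈ W, ∀ hax : x.tgt = a.src, IsNonzero I (a.comp x hax) → a.comp x hax ∈ W')
    (s s' : ℤ) (hs : s + x.length = s') : idealMod I W s ⟶ idealMod I W' s' :=
  idealModHom
    (LinearMap.codRestrict _ (LinearMap.toSpanSingleton _ _ (path I x) ∘ₗ (pathIdeal I W).subtype)
      fun z => mul_path_mem_pathIdeal h z.2) fun i z hz => by
    have := SetLike.mul_mem_graded hz (path_mem_grading (I := I) x rfl)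
    rwa [show s + i + (x.length : ℤ) = s' + i by lia] at this

/-- The restriction to the terms along the paths in `W₂`. -/
noncomputable def restrictHom (h : ∀ p ∈ W, ∀ (a : QPath V) (hap : p.tgt = a.src),
    IsNonzero I (a.comp p hap) → a.comp p hap ∈ W₂ → p ∈ W₂) (s : ℤ) :
    idealMod I W s ⟶ idealMod I W₂ s :=
  idealModHom
    { toFun x := ⟨restrict W₂ x.1, restrict_mem _⟩
      map_add' x y := Subtype.ext (map_add (restrict W₂) x.1 y.1)
      map_smul' a x := Subtype.ext (restrict_mul h a x.2) } fun _ _ hx => restrict_mem_grading hx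

/-- If the nonzero paths of `W` are the disjoint union of those of `W₁` and `W₂`, then so is the
left ideal. -/
lemma shortExact_restrict (h₁ : ∀ p, IsNonzero I p → p ∈ W₁ → p ∈ W)
    (h₂ : ∀ p, IsNonzero I p → p ∈ W₂ → p ∈ W)
    (h : ∀ p, IsNonzero I p → p ∈ W → (p ∈ W₂ ↔ p ∉ W₁)) (s : ℤ) :
    ∃ f g w, (ShortComplex.mk (f : idealMod I W₁ s ⟶ idealMod I W s)
      (g : idealMod I W s ⟶ idealMod I W₂ s) w).ShortExact := by
  have h₃ : ∀ p ∈ W, ∀ (a : QPath V) (hap : p.tgt = a.src),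
      IsNonzero I (a.comp p hap) → a.comp p hap ∈ W₂ → p ∈ W₂ := by
    intro p hp a hap hn hW₂
    refine (h p hn.right hp).2 fun hW₁ => ?_
    exact (h _ hn (W.comp_mem hp a hap)).1 hW₂ (W₁.comp_mem hW₁ a hap)
  have w : inclusion h₁ s ≫ restrictHom h₃ s = 0 := by
    apply GrMod.hom_ext
    rintro ⟨x, hx⟩
    refine Subtype.ext (coeff_ext fun p => ?_)
    change coeff I (restrict W₂ x) p = coeff I 0 p
    rw [map_zero, Finsupp.zero_apply]
    by_contra hp
    have hp₂ : p ∈ W₂ := by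
      by_contra hp'
      exact hp (coeff_restrict_of_notMem x hp')
    rw [coeff_restrict_of_mem x hp₂] at hp
    have hn := isNonzero_of_coeff_ne_zero hp
    exact (h p hn (h₂ p hn hp₂)).1 hp₂ (hx p hp)
  refine ⟨inclusion h₁ s, restrictHom h₃ s, w, GrMod.shortExact_mk _ _ w ?_ ?_ ?_⟩
  · exact Submodule.inclusion_injective (pathIdeal_mono h₁)
  · rintro ⟨x, hx⟩
    exact ⟨⟨x, pathIdeal_mono h₂ hx⟩, Subtype.ext (restrict_eq_self hx)⟩
  · rintro ⟨x, hx⟩ hx0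
    have hx0 : restrict W₂ x = 0 := congrArg Subtype.val hx0
    refine ⟨⟨x, fun p hp => ?_⟩, rfl⟩
    by_contra hp₁
    have := coeff_restrict_of_mem x ((h p (isNonzero_of_coeff_ne_zero hp) (hx p hp)).2 hp₁)
    rw [hx0, map_zero, Finsupp.zero_apply] at this
    exact hp this.symm

/-- The multiplication on the right by a path `x`, between the left ideals spanned by `W` and by
`W x`, is surjective with kernel spanned by the paths of `W` that annihilate `x`. -/
lemma shortExact_mulRight (x : QPath V)
    (h : ∀ a, IsNonzero I a → (a ∈ W₁ ↔ a ∈ W ∧ ∀ hax, ¬ IsNonzero I (a.comp x hax)))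
    (h' : ∀ a ∈ W, ∀ hax : x.tgt = a.src, IsNonzero I (a.comp x hax) → a.comp x hax ∈ W')
    (hsurj : ∀ b ∈ W', IsNonzero I b → ∃ a ∈ W, ∃ hax, b = a.comp x hax)
    {s s' : ℤ} (hs : s + x.length = s') :
    ∃ h₁ w, (ShortComplex.mk (inclusion h₁ s : idealMod I W₁ s ⟶ idealMod I W s)
      (mulRight x h' s s' hs) w).ShortExact := by
  have h₁ : ∀ p, IsNonzero I p → p ∈ W₁ → p ∈ W := fun p hp hp₁ => ((h p hp).1 hp₁).1
  have hzero : ∀ z ∈ pathIdeal I W₁, z * path I x = 0 := by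
    intro z hz
    refine pathIdeal_induction (P := fun z => z * path I x = 0) hz (zero_mul _)
      (fun a b ha hb => by rw [add_mul, ha, hb, add_zero]) fun c p hp hn => ?_
    rw [smul_mul_assoc]
    by_cases hpx : x.tgt = p.src
    · rw [path_mul_path hpx, path_eq_zero (((h p hn).1 hp).2 hpx), smul_zero]
    · rw [path_mul_path_of_ne hpx, smul_zero]
  have w : inclusion h₁ s ≫ mulRight x h' s s' hs = 0 := by
    apply GrMod.hom_ext
    rintro ⟨z, hz⟩
    exact Subtype.ext (hzero z hz)
  refine ⟨h₁, w, GrMod.shortExact_mk _ _ w ?_ ?_ ?_⟩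
  · exact Submodule.inclusion_injective (pathIdeal_mono h₁)
  · suffices ∀ z ∈ pathIdeal I W', ∃ y ∈ pathIdeal I W, y * path I x = z by
      rintro ⟨z, hz⟩
      obtain ⟨y, hy, hyz⟩ := this z hz
      exact ⟨⟨y, hy⟩, Subtype.ext hyz⟩
    intro z hz
    refine pathIdeal_induction (P := fun z => ∃ y ∈ pathIdeal I W, y * path I x = z) hz
      ⟨0, zero_mem _, zero_mul _⟩ ?_ fun c p hp hn => ?_
    · rintro _ _ ⟨a, ha, rfl⟩ ⟨b, hb, rfl⟩
      exact ⟨a + b, add_mem ha hb, add_mul _ _ _⟩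
    · obtain ⟨a, ha, hax, rfl⟩ := hsurj p hp hn
      exact ⟨c • path I a, smul_mem_pathIdeal c (path_mem_pathIdeal fun _ => ha), by
        rw [smul_mul_assoc, path_mul_path hax]⟩
  · rintro ⟨z, hz⟩ hz0
    replace hz0 : (show QuotAlgebra I from z) * path I x = 0 := congrArg Subtype.val hz0
    refine ⟨⟨z, fun p hp => (h p (isNonzero_of_coeff_ne_zero hp)).2 ⟨hz p hp, fun hpx hn => ?_⟩⟩, rfl⟩
    have := coeff_mul_path z p x hpx hn
    rw [hz0, map_zero, Finsupp.zero_apply] at this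
    exact hp this.symm

lemma isZero_idealMod (h : ∀ p ∈ W, ¬ IsNonzero I p) (s : ℤ) : IsZero (idealMod I W s) := by
  rw [IsZero.iff_id_eq_zero]
  apply GrMod.hom_ext
  rintro ⟨x, hx⟩
  refine Subtype.ext (coeff_ext fun p => ?_)
  change coeff I x p = coeff I 0 p
  rw [map_zero, Finsupp.zero_apply]
  by_contra hp
  exact h p (hx p hp) (isNonzero_of_coeff_ne_zero hp)

/-- The multiplication on the right by a path is an isomorphism if no path is annihilated. -/
lemma nonempty_iso_mulRight (x : QPath V)
    (h : ∀ a ∈ W, IsNonzero I a → ∃ hax, IsNonzero I (a.comp x hax) ∧ a.comp x hax ∈ W')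
    (hsurj : ∀ b ∈ W', IsNonzero I b → ∃ a ∈ W, ∃ hax, b = a.comp x hax)
    {s s' : ℤ} (hs : s + x.length = s') : Nonempty (idealMod I W s ≅ idealMod I W' s') := by
  obtain ⟨f, w, hS⟩ := shortExact_mulRight (W₁ := PathSet.generated ∅) x
    (fun a ha => ⟨by rintro ⟨_, h, -⟩; exact h.elim, fun ⟨ha', H⟩ => by
      obtain ⟨hax, hn, -⟩ := h a ha' ha
      exact absurd hn (H hax)⟩)
    (fun a ha hax hn => by
      obtain ⟨_, -, h'⟩ := h a ha hn.left
      exact h') hsurj hs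
  have h' := fun a (ha : a ∈ W) hax (hn : IsNonzero I (a.comp x hax)) => (h a ha hn.left).2.2
  have := hS.isIso_g_iff.2 (isZero_idealMod (by rintro p ⟨_, h, -⟩; exact h.elim) s)
  exact ⟨asIso (mulRight x h' s s' hs)⟩

/-- The left ideal spanned by the paths that start at `v` is projective. -/
lemma projective_startAt (v : V) (s : ℤ) : Projective (idealMod I (PathSet.startAt v 0) s) := by
  refine GrMod.projective_of_smul_eq (X := idealMod I (PathSet.startAt v 0) s) (d := -s)
    (⟨path I (QPath.trivial v), path_mem_pathIdeal fun _ => ⟨rfl, Nat.zero_le _⟩⟩ :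
      pathIdeal I (PathSet.startAt v 0)) ?_ (pathIdeal I (PathSet.startAt v 0)).subtype ?_ ?_
  · exact mem_idealMod_grading.2 (path_mem_grading _ (by rw [QPath.trivial_length]; lia))
  · intro i x hx
    rw [sub_neg_eq_add, add_comm]
    exact hx
  · rintro ⟨x, hx⟩
    exact Subtype.ext (mul_trivial_of_mem hx)

/-- The projective resolution of the left ideal generated by a path starts with the left ideal of
the paths that annihilate it. -/
lemma shortExact_annihilator (p : QPath V) {s s' : ℤ} (hs : s + p.length = s') :
    ∃ h g w, (ShortComplex.mk (inclusion h s : idealMod I (PathSet.annihilator I p) s ⟶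
      idealMod I (PathSet.startAt p.tgt 0) s)
      (g : _ ⟶ idealMod I (PathSet.principal p) s') w).ShortExact := by
  obtain ⟨f, w, h⟩ := shortExact_mulRight (I := I) (W := PathSet.startAt p.tgt 0)
    (W₁ := PathSet.annihilator I p) (W' := PathSet.principal p) p
    (fun a _ => ⟨fun ⟨h, hn⟩ => ⟨⟨h.symm, Nat.zero_le _⟩, fun _ => hn⟩,
      fun ⟨⟨h, _⟩, hn⟩ => ⟨h.symm, hn _⟩⟩)
    (fun a _ hap _ => PathSet.mem_principal.2 ⟨a, hap, rfl⟩)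
    (fun b hb _ => by
      obtain ⟨a, hap, rfl⟩ := PathSet.mem_principal.1 hb
      exact ⟨a, ⟨hap.symm, Nat.zero_le _⟩, hap, rfl⟩) hs
  exact ⟨f, _, w, h⟩

/-- Induction along the decomposition of a path ideal into the left ideals generated by pairwise
incomparable paths. -/
lemma idealMod_of_generated (P : GrMod (grading I) → Prop) (h0 : ∀ X, IsZero X → P X)
    (h2 : ∀ S : ShortComplex (GrMod (grading I)), S.ShortExact → P S.X₁ → P S.X₃ → P S.X₂)
    {F : Set (QPath V)} (hF : F.Finite)
    (hanti : ∀ r ∈ F, ∀ r' ∈ F, ∀ (a : QPath V) (h : r'.tgt = a.src),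
      IsNonzero I (a.comp r' h) → r = a.comp r' h → r = r')
    (s : ℤ) (h : ∀ r ∈ F, P (idealMod I (PathSet.principal r) s)) :
    P (idealMod I (PathSet.generated F) s) := by
  induction F, hF using Set.Finite.induction_on with
  | empty => exact h0 _ (isZero_idealMod (by rintro p ⟨_, h, -⟩; exact h.elim) s)
  | @insert r F hr _ ih =>
    obtain ⟨f, g, w, hS⟩ := shortExact_restrict (I := I) (W := PathSet.generated (insert r F))
      (W₁ := PathSet.generated F) (W₂ := PathSet.principal r)
      (by
        rintro p - ⟨r', hr', H⟩
        exact ⟨r', Or.inr hr', H⟩)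
      (by
        rintro p - ⟨r', rfl, H⟩
        exact ⟨r', Or.inl rfl, H⟩)
      (by
        rintro p hp ⟨r', hr', hpr'⟩
        constructor
        · rintro ⟨r₁, rfl : r₁ = r, b, hb, rfl⟩ ⟨r₂, hr₂, c, hc, H⟩
          obtain hle | hle := le_total r₁.length r₂.length
          · obtain ⟨m, h₁, h₂, rfl, rfl⟩ := QPath.exists_of_comp_eq_comp H hle
            have hn : IsNonzero I (m.comp r₁ h₁) := by
              rw [H] at hp
              exact hp.right
            exact hr (hanti _ (Or.inr hr₂) r₁ (Or.inl rfl) m h₁ hn rfl ▸ hr₂)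
          · obtain ⟨m, h₁, h₂, rfl, rfl⟩ := QPath.exists_of_comp_eq_comp H.symm hle
            exact hr ((hanti _ (Or.inl rfl) r₂ (Or.inr hr₂) m h₁ hp.right rfl).symm ▸ hr₂)
        · intro hpF
          obtain rfl | hr' := hr'
          · exact ⟨r', rfl, hpr'⟩
          · exact absurd ⟨r', hr', hpr'⟩ hpF) s
    exact h2 _ hS (ih (fun r hr r' hr' => hanti r (Or.inr hr) r' (Or.inr hr'))
      fun r hr => h r (Or.inr hr)) (h r (Or.inl rfl))

end GradedModule

end QuotAlgebra

/-! ### Syzygies of the ideals generated by paths -/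

namespace QuotAlgebra

open PathAlgebra Abelian

section Combinatorics

variable {k V : Type u} [Field k] [Quiver.{u} V]

/-- The nonzero path `r` annihilates `p`, and is minimal with this property: no proper right factor
of `r` annihilates `p`. -/
structure IsMinAnnihilator (I : TwoSidedIdeal (PathAlgebra k V)) (p r : QPath V) : Prop where
  isNonzero : IsNonzero I r
  mem : r ∈ PathSet.annihilator I p
  eq_of_comp : ∀ r' ∈ PathSet.annihilator I p, ∀ (a : QPath V) (h : r'.tgt = a.src),
    r = a.comp r' h → r = r'

/-- The paths `r` for which `A r` is a summand of an `n`-th syzygy of some `A p`, where `p` is a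
nonzero path of positive length. -/
def IsSyzygyPath (I : TwoSidedIdeal (PathAlgebra k V)) : ℕ → QPath V → Prop
  | 0, p => IsNonzero I p ∧ 1 ≤ p.length
  | n + 1, r => ∃ p, IsSyzygyPath I n p ∧ IsMinAnnihilator I p r

variable {I : TwoSidedIdeal (PathAlgebra k V)}

lemma IsMinAnnihilator.src_eq {p r : QPath V} (h : IsMinAnnihilator I p r) : p.tgt = r.src :=
  h.mem.1

lemma IsMinAnnihilator.one_le_length {p r : QPath V} (h : IsMinAnnihilator I p r)
    (hp : IsNonzero I p) : 1 ≤ r.length := by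
  by_contra hr
  obtain ⟨hpr, hn⟩ := h.mem
  rw [QPath.comp_eq_right r p hpr (by lia)] at hn
  exact hn hp

lemma exists_isMinAnnihilator {p a : QPath V} (ha : IsNonzero I a)
    (h : a ∈ PathSet.annihilator I p) : ∃ r, IsMinAnnihilator I p r ∧ a ∈ PathSet.principal r := by
  induction hn : a.length using Nat.strong_induction_on generalizing a with
  | _ n ih =>
    by_cases H : ∀ r' ∈ PathSet.annihilator I p, ∀ (b : QPath V) (h : r'.tgt = b.src),
        a = b.comp r' h → a = r'
    · exact ⟨a, ⟨ha, h, H⟩, PathSet.self_mem_principal a⟩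
    · push Not at H
      obtain ⟨r', hr', b, hb, rfl, hne⟩ := H
      have hlt : r'.length < n := by
        rw [← hn, QPath.length_comp]
        by_contra hlt
        exact hne (QPath.comp_eq_right b r' hb (by lia))
      obtain ⟨r, hr, hc⟩ := ih _ hlt ha.right hr' rfl
      exact ⟨r, hr, PathSet.comp_mem _ hc b hb⟩

lemma mem_annihilator_iff {p a : QPath V} (ha : IsNonzero I a) :
    a ∈ PathSet.annihilator I p ↔ a ∈ PathSet.generated {r | IsMinAnnihilator I p r} := by
  constructor
  · intro h
    obtain ⟨r, hr, _, rfl, H⟩ := exists_isMinAnnihilator ha h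
    exact ⟨_, hr, H⟩
  · rintro ⟨r, hr, b, h, rfl⟩
    exact PathSet.comp_mem _ hr.mem b h

lemma IsMinAnnihilator.notMem_principal {p r r' : QPath V} (hr : IsMinAnnihilator I p r)
    (hr' : IsMinAnnihilator I p r') (hne : r ≠ r') : r' ∉ PathSet.principal r := by
  intro h
  obtain ⟨b, hb, rfl⟩ := PathSet.mem_principal.1 h
  exact hne (hr'.eq_of_comp r hr.mem b hb rfl).symm

lemma IsMinAnnihilator.mem_principal_of_comp_mem {p r : QPath V} (h : IsMinAnnihilator I p r) :
    ∀ a ∈ PathSet.annihilator I p, ∀ (b : QPath V) (hab : a.tgt = b.src),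
      IsNonzero I (b.comp a hab) → b.comp a hab ∈ PathSet.principal r →
        a ∈ PathSet.principal r := by
  intro a ha b hab hn hmem
  obtain ⟨c, hc, H⟩ := PathSet.mem_principal.1 hmem
  obtain hle | hle := le_total r.length a.length
  · obtain ⟨m, hm, -, rfl, -⟩ := QPath.exists_of_comp_eq_comp H.symm hle
    exact PathSet.comp_mem _ (PathSet.self_mem_principal r) m hm
  · obtain ⟨m, hm, -, hr, -⟩ := QPath.exists_of_comp_eq_comp H hle
    rw [← h.eq_of_comp a ha m hm hr]
    exact PathSet.self_mem_principal r

lemma IsSyzygyPath.of_succ {n : ℕ} {p : QPath V} (h : IsSyzygyPath I (n + 1) p) :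
    IsSyzygyPath I n p := by
  induction n generalizing p with
  | zero =>
    obtain ⟨q, hq, hqp⟩ := h
    exact ⟨hqp.isNonzero, hqp.one_le_length hq.1⟩
  | succ n ih =>
    obtain ⟨q, hq, hqp⟩ := h
    exact ⟨q, ih hq, hqp⟩

lemma IsSyzygyPath.isNonzero_and_one_le {n : ℕ} {p : QPath V} (h : IsSyzygyPath I n p) :
    IsNonzero I p ∧ 1 ≤ p.length := by
  induction n with
  | zero => exact h
  | succ n ih => exact ih h.of_succ

end Combinatorics

variable {k V : Type u} [Field k] [Quiver.{u} V] [Fintype V]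
  {I : TwoSidedIdeal (PathAlgebra k V)} [IsMonomial I]

variable (I) in
lemma finite_setOf_isNonzero [∀ a b : V, Finite (a ⟶ b)] : {p : QPath V | IsNonzero I p}.Finite := by
  obtain ⟨N, hN⟩ := (‹IsMonomial I› : IsMonomial I).isAdmissible.1
  refine ((Set.finite_lt_nat N).biUnion (fun n _ => finite_length_eq n)).subset fun p hp => ?_
  simp only [Set.mem_iUnion]
  refine ⟨p.length, ?_, rfl⟩
  by_contra h
  exact hp (hN p (not_lt.1 h))

variable [∀ a b : V, Finite (a ⟶ b)]

/-- The left ideal of the paths that annihilate `p` decomposes into the left ideals generated by the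
minimal ones. -/
lemma idealMod_annihilator_of (P : GrMod (grading I) → Prop) (h0 : ∀ X, IsZero X → P X)
    (h2 : ∀ S : ShortComplex (GrMod (grading I)), S.ShortExact → P S.X₁ → P S.X₃ → P S.X₂)
    (p : QPath V) (s : ℤ)
    (h : ∀ r, IsMinAnnihilator I p r → P (idealMod I (PathSet.principal r) s)) :
    P (idealMod I (PathSet.annihilator I p) s) := by
  rw [idealMod_congr (fun a => mem_annihilator_iff)]
  exact idealMod_of_generated P h0 h2
    ((finite_setOf_isNonzero I).subset fun r hr => hr.isNonzero)
    (fun r hr r' hr' a ha _ => hr.eq_of_comp r' hr'.mem a ha) s h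

end QuotAlgebra

namespace GrMod

variable {k A : Type u} [CommRing k] [Ring A] [Algebra k A] {𝒜 : ℤ → Submodule k A}
  [IsNoetherianRing A]

/-- The functor that forgets the grading. -/
def forgetGrading : GrMod 𝒜 ⥤ ModuleCat.{u} A where
  obj X := ModuleCat.of A X.carrier
  map f := ModuleCat.ofHom f.lin

instance : (forgetGrading (𝒜 := 𝒜)).PreservesZeroMorphisms where
  map_zero _ _ := rfl

lemma exists_of_exact {S : ShortComplex (GrMod 𝒜)} (hS : S.Exact) [Mono S.f] (y : S.X₂.carrier)
    (hy : S.g.lin y = 0) : ∃ x, S.f.lin x = y :=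
  ⟨(hS.lift _ (subIncl_ker_comp S.g)).lin ⟨y, hy⟩,
    congrArg (fun l => Hom.lin l (⟨y, hy⟩ : LinearMap.ker S.g.lin))
      (hS.lift_f _ (subIncl_ker_comp S.g))⟩

lemma shortExact_map_forgetGrading {S : ShortComplex (GrMod 𝒜)} (hS : S.ShortExact) :
    (S.map forgetGrading).ShortExact := by
  have := hS.mono_f
  have := hS.epi_g
  refine ModuleCat.shortComplex_shortExact _ (fun y => ⟨exists_of_exact hS.exact y, ?_⟩)
    (injective_of_mono S.f) (surjective_of_epi S.g)
  rintro ⟨x, rfl⟩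
  exact congrArg (fun l => Hom.lin l x) S.zero

end GrMod

namespace QuotAlgebra

open PathAlgebra Abelian

variable {k V : Type u} [Field k] [Quiver.{u} V] [Fintype V]
  {I : TwoSidedIdeal (PathAlgebra k V)} [IsMonomial I] [∀ a b : V, Finite (a ⟶ b)]

section Ext

lemma ext_eq_zero_of_shortExact {C : Type*} [Category C] [Abelian C] [HasExt.{w} C]
    {S : ShortComplex C} (hS : S.ShortExact) [Projective S.X₂] {Y : C} {n : ℕ}
    (h : ∀ e : Ext S.X₃ Y (n + 2), e = 0) (e : Ext S.X₁ Y (n + 1)) : e = 0 := by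
  obtain ⟨e', rfl⟩ := Ext.contravariant_sequence_exact₁ hS Y e (n₁ := n + 2) (by lia) (h _)
  rw [Ext.eq_zero_of_projective e', Ext.comp_zero]

lemma ext_eq_zero_of_retract {C : Type*} [Category C] [Abelian C] [HasExt.{w} C]
    {X X' Y : C} (r : Retract X X') {n : ℕ}
    (h : ∀ e : Ext X' Y n, e = 0) (e : Ext X Y n) : e = 0 := by
  have := h ((Ext.mk₀ r.r).comp e (zero_add n))
  rw [← Ext.mk₀_id_comp e, ← r.retract, ← Ext.mk₀_comp_mk₀_assoc, this, Ext.comp_zero]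

open GrMod in
lemma projective_forgetGrading_startAt (v : V) (s : ℤ) :
    Projective (forgetGrading.obj (idealMod I (PathSet.startAt v 0) s)) := by
  suffices Projective (ModuleCat.of (QuotAlgebra I) (pathIdeal I (PathSet.startAt v 0))) from this
  rw [← IsProjective.iff_projective]
  exact Module.Projective.of_split (M := QuotAlgebra I)
    (pathIdeal I (PathSet.startAt v 0)).subtype
    (LinearMap.toSpanSingleton _ _ (⟨path I (QPath.trivial v), path_mem_pathIdeal
      fun _ => PathSet.mem_startAt.2 ⟨rfl, Nat.zero_le _⟩⟩ : pathIdeal I (PathSet.startAt v 0)))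
    (LinearMap.ext fun x => Subtype.ext (mul_trivial_of_mem x.2))

/-- The left ideal generated by a minimal annihilator of `p` is a direct summand of the left ideal
of all the paths that annihilate `p`. -/
lemma nonempty_retract_of_isMinAnnihilator {p r : QPath V} (h : IsMinAnnihilator I p r) (s : ℤ) :
    Nonempty (Retract (idealMod I (PathSet.principal r) s)
      (idealMod I (PathSet.annihilator I p) s)) := by
  have h₁ : ∀ a, IsNonzero I a → a ∈ PathSet.principal r → a ∈ PathSet.annihilator I p := by
    rintro _ - ⟨_, rfl, b, hb, rfl⟩
    exact PathSet.comp_mem _ h.mem b hb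
  refine ⟨⟨inclusion h₁ s, restrictHom h.mem_principal_of_comp_mem s, GrMod.hom_ext ?_⟩⟩
  rintro ⟨x, hx⟩
  exact Subtype.ext (restrict_eq_self hx)

open GrMod in
/-- The shifting of dimensions along the syzygies `A r` of the left ideals `A p`. -/
lemma ext_idealMod_eq_zero [HasExt.{w} (ModuleCat.{u} (QuotAlgebra I))]
    {Y : ModuleCat.{u} (QuotAlgebra I)} {d : ℕ} [HasInjectiveDimensionLE Y d] {n m : ℕ}
    (hnm : n + m = d) {p : QPath V} (hp : IsSyzygyPath I n p) (s : ℤ)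
    (e : Ext (forgetGrading.obj (idealMod I (PathSet.principal p) s)) Y (m + 1)) : e = 0 := by
  induction n generalizing m p s with
  | zero => exact e.eq_zero_of_hasInjectiveDimensionLT (d + 1) (by lia)
  | succ n ih =>
    obtain ⟨q, hq, hqp⟩ := hp
    obtain ⟨h, g, w, hS⟩ := shortExact_annihilator (I := I) q (s := s) rfl
    obtain ⟨R⟩ := nonempty_retract_of_isMinAnnihilator hqp s
    refine ext_eq_zero_of_retract (R.map forgetGrading) ?_ e
    have : Projective ((ShortComplex.mk _ _ w).map forgetGrading).X₂ :=
      projective_forgetGrading_startAt _ s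
    exact ext_eq_zero_of_shortExact (shortExact_map_forgetGrading hS)
      (ih (by lia) hq (s + q.length))

end Ext

open GrMod in
/-- The linear maps from the annihilator of a `d`-th syzygy path to a ring of injective dimension
`d` are the multiplications on the right. -/
lemma exists_forall_eq_mul {d : ℕ}
    [HasInjectiveDimensionLE (ModuleCat.of (QuotAlgebra I) (QuotAlgebra I)) d] {p : QPath V}
    (hp : IsSyzygyPath I d p)
    (f : pathIdeal I (PathSet.annihilator I p) →ₗ[QuotAlgebra I] QuotAlgebra I) :
    ∃ z, ∀ x, f x = x.1 * z := by
  let := HasExt.standard (ModuleCat.{u} (QuotAlgebra I))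
  obtain ⟨h, g, w, hS⟩ := shortExact_annihilator (I := I) p (s := 0) rfl
  obtain ⟨e, he⟩ := Ext.contravariant_sequence_exact₁ (shortExact_map_forgetGrading hS)
    (ModuleCat.of (QuotAlgebra I) (QuotAlgebra I)) (Ext.mk₀ (ModuleCat.ofHom f)) (n₁ := 1) rfl
    (ext_idealMod_eq_zero (d := d) (m := 0) (by lia) hp _ _)
  obtain ⟨g', rfl⟩ := (Ext.mk₀_bijective _ _).2 e
  rw [Ext.mk₀_comp_mk₀] at he
  have he := (Ext.mk₀_bijective _ _).1 he
  let G : pathIdeal I (PathSet.startAt p.tgt 0) →ₗ[QuotAlgebra I] QuotAlgebra I := g'.hom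
  have hG : ∀ x : pathIdeal I (PathSet.annihilator I p),
      f x = G ⟨x.1, pathIdeal_mono h x.2⟩ := fun x =>
    congrArg (fun l => l.hom x) he.symm
  refine ⟨G ⟨path I (QPath.trivial p.tgt), path_mem_pathIdeal
    fun _ => PathSet.mem_startAt.2 ⟨rfl, Nat.zero_le _⟩⟩, fun x => ?_⟩
  rw [hG, ← smul_eq_mul, ← map_smul]
  congr 1
  exact Subtype.ext (mul_trivial_of_mem (pathIdeal_mono h x.2)).symm

section Gorenstein

variable {d : ℕ} [HasInjectiveDimensionLE (ModuleCat.of (QuotAlgebra I) (QuotAlgebra I)) d]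

/-- A `d`-th syzygy path has at most one minimal annihilator. -/
lemma IsMinAnnihilator.eq_of_isSyzygyPath {p r r' : QPath V} (hp : IsSyzygyPath I d p)
    (hr : IsMinAnnihilator I p r) (hr' : IsMinAnnihilator I p r') : r = r' := by
  by_contra hne
  let f : pathIdeal I (PathSet.annihilator I p) →ₗ[QuotAlgebra I] QuotAlgebra I :=
    { toFun x := restrict (PathSet.principal r) x.1
      map_add' x y := map_add (restrict (PathSet.principal r)) x.1 y.1
      map_smul' a x := restrict_mul hr.mem_principal_of_comp_mem a x.2 }
  obtain ⟨z, hz⟩ := exists_forall_eq_mul hp f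
  have hcoeff : ∀ {q : QPath V}, IsNonzero I q →
      coeff I (path I q * z) q = coeff I z (QPath.trivial q.src) := fun {q} hq => by
    have := coeff_path_mul z q (QPath.trivial q.src) rfl (by rwa [QPath.comp_trivial])
    rwa [QPath.comp_trivial] at this
  have h₁ : path I r = path I r * z := (restrict_path_of_mem (PathSet.self_mem_principal r)).symm.trans
    (hz ⟨path I r, path_mem_pathIdeal fun _ => hr.mem⟩)
  have h₂ : 0 = path I r' * z := (restrict_path_of_notMem (hr.notMem_principal hr' hne)).symm.trans
    (hz ⟨path I r', path_mem_pathIdeal fun _ => hr'.mem⟩)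
  replace h₁ : coeff I (path I r) r = coeff I (path I r * z) r := congrArg (fun a => coeff I a r) h₁
  replace h₂ : coeff I 0 r' = coeff I (path I r' * z) r' := congrArg (fun a => coeff I a r') h₂
  rw [hcoeff hr.isNonzero, coeff_path hr.isNonzero, Finsupp.single_eq_same] at h₁
  rw [hcoeff hr'.isNonzero, map_zero, Finsupp.zero_apply, ← hr'.src_eq, hr.src_eq, ← h₁] at h₂
  exact zero_ne_one h₂

/-- If `r` is the minimal annihilator of a `d`-th syzygy path, then every path that is annihilated
by the annihilator of `r` is a multiple of `r`. -/
lemma IsMinAnnihilator.exists_eq_comp {p r y : QPath V} (hp : IsSyzygyPath I d p)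
    (hr : IsMinAnnihilator I p r) (hy : IsNonzero I y) (hry : r.tgt = y.tgt)
    (h : ∀ a ∈ PathSet.annihilator I r, IsNonzero I a → a ∈ PathSet.annihilator I y) :
    ∃ (b : QPath V) (hb : b.tgt = r.src), y = r.comp b hb := by
  let g : QuotAlgebra I →ₗ[QuotAlgebra I] QuotAlgebra I := LinearMap.toSpanSingleton _ _ (path I r)
  let ψ : QuotAlgebra I →ₗ[QuotAlgebra I] QuotAlgebra I := LinearMap.toSpanSingleton _ _ (path I y)
  have hker : LinearMap.ker g ≤ LinearMap.ker ψ := by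
    intro x hx
    have hx : x * path I r = 0 := hx
    change x * path I y = 0
    rw [← sum_coeff x, Finsupp.sum, Finset.sum_mul]
    refine Finset.sum_eq_zero fun a ha => ?_
    rw [Finsupp.mem_support_iff] at ha
    rw [smul_mul_assoc]
    by_cases hay : y.tgt = a.src
    · have har : r.tgt = a.src := hry.trans hay
      rw [path_mul_path hay, path_eq_zero, smul_zero]
      refine (h a ⟨har, fun hn => ?_⟩ (isNonzero_of_coeff_ne_zero ha)).2
      rw [← coeff_mul_path x a r har hn, hx, map_zero, Finsupp.zero_apply] at ha
      exact ha rfl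
    · rw [path_mul_path_of_ne hay, smul_zero]
  have hrange : pathIdeal I (PathSet.annihilator I p) ≤ LinearMap.range g := by
    intro x hx
    refine pathIdeal_induction (P := fun x => x ∈ LinearMap.range g) hx (zero_mem _)
      (fun _ _ => add_mem) fun c a ha hn => ?_
    obtain ⟨r', hr', ha'⟩ := exists_isMinAnnihilator hn ha
    obtain rfl := hr.eq_of_isSyzygyPath hp hr'
    obtain ⟨b, hb, rfl⟩ := PathSet.mem_principal.1 ha'
    refine ⟨c • path I b, ?_⟩
    change (c • path I b) * path I r = _
    rw [smul_mul_assoc, path_mul_path hb]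
  obtain ⟨z, hz⟩ := exists_forall_eq_mul hp
    ((LinearMap.ker g).liftQ ψ hker ∘ₗ g.quotKerEquivRange.symm.toLinearMap ∘ₗ
      Submodule.inclusion hrange)
  have hz := hz ⟨path I r, path_mem_pathIdeal fun _ => hr.mem⟩
  have hg : Submodule.inclusion hrange ⟨path I r, path_mem_pathIdeal fun _ => hr.mem⟩ =
      g.quotKerEquivRange (Submodule.Quotient.mk 1) := Subtype.ext (one_mul _).symm
  rw [LinearMap.comp_apply, LinearMap.comp_apply, hg, LinearEquiv.coe_coe,
    LinearEquiv.symm_apply_apply, Submodule.liftQ_apply] at hz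
  have hz : 1 * path I y = path I r * z := hz
  rw [one_mul] at hz
  refine exists_of_coeff_path_mul_ne_zero (x := z) ?_
  rw [← hz, coeff_path hy, Finsupp.single_eq_same]
  exact one_ne_zero

end Gorenstein

end QuotAlgebra

/-! ### Perfect sequences of paths -/

namespace QuotAlgebra

open PathAlgebra

section

variable {k V : Type u} [Field k] [Quiver.{u} V]

/-- A bi-infinite sequence of paths, each of which generates both the left annihilator of the
preceding one and the right annihilator of the following one. -/
structure IsPerfect (I : TwoSidedIdeal (PathAlgebra k V)) (c : ℤ → QPath V) : Prop where
  isNonzero : ∀ j, IsNonzero I (c j)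
  one_le_length : ∀ j, 1 ≤ (c j).length
  mem_annihilator : ∀ j, c (j + 1) ∈ PathSet.annihilator I (c j)
  mem_principal : ∀ j a, IsNonzero I a → a ∈ PathSet.annihilator I (c j) →
    a ∈ PathSet.principal (c (j + 1))
  exists_eq_comp : ∀ j b (h : b.tgt = (c (j + 1)).src), IsNonzero I b →
    ¬ IsNonzero I ((c (j + 1)).comp b h) → ∃ (y : QPath V) (hy : y.tgt = (c j).src),
      b = (c j).comp y hy

/-- The path `p` and the path `c 0` of a perfect sequence overlap: `c 0 = x v` and `p = v y`, where
`v` is not trivial, `x` has length `i` and `x p` is nonzero. -/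
def Overlaps (I : TwoSidedIdeal (PathAlgebra k V)) (c : ℤ → QPath V) (p : QPath V) (i : ℕ) : Prop :=
  ∃ (x v y : QPath V) (h : v.tgt = x.src) (h' : y.tgt = v.src), x.length = i ∧ 1 ≤ v.length ∧
    c 0 = x.comp v h ∧ p = v.comp y h' ∧ IsNonzero I (x.comp (v.comp y h') h)

variable {I : TwoSidedIdeal (PathAlgebra k V)} {c : ℤ → QPath V}

lemma IsPerfect.prev (hc : IsPerfect I c) : IsPerfect I fun j => c (j - 1) := by
  have e : ∀ j : ℤ, j + 1 - 1 = j - 1 + 1 := fun j => by ring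
  constructor
  · exact fun j => hc.isNonzero _
  · exact fun j => hc.one_le_length _
  · intro j
    simpa only [e] using hc.mem_annihilator (j - 1)
  · intro j
    simpa only [e] using hc.mem_principal (j - 1)
  · intro j
    simpa only [e] using hc.exists_eq_comp (j - 1)

lemma Overlaps.length_lt {p : QPath V} {i : ℕ} (h : Overlaps I c p i) : i < (c 0).length := by
  obtain ⟨x, v, y, h, h', hx, hv, hc, -, -⟩ := h
  rw [hc, QPath.length_comp]
  lia

/-- An overlap of `c 0` with a minimal annihilator of `p` yields an overlap of `c (-1)` with `p`. -/
lemma Overlaps.prev (hc : IsPerfect I c) {p r : QPath V} (hp : IsNonzero I p)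
    (hr : IsMinAnnihilator I p r) {i' : ℕ} (H : Overlaps I c r i') :
    ∃ i, Overlaps I (fun j => c (j - 1)) p i ∧ i + (c 0).length = r.length + i' := by
  obtain ⟨x, v, y, h, h', hx, hv, hc0, rfl, hn⟩ := H
  obtain ⟨hpr, hrp⟩ := hr.mem
  have hpy : p.tgt = y.src := hpr
  -- The proper right factor `y` of `r = v y` does not annihilate `p`.
  have hyp : IsNonzero I (y.comp p hpy) := by
    by_contra hyp
    have := congrArg QPath.length (hr.eq_of_comp y ⟨hpy, hyp⟩ v h' rfl)
    rw [QPath.length_comp] at this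
    lia
  have hc0' : c (-1 + 1) = x.comp v h := hc0
  have hz : ¬ IsNonzero I ((c (-1 + 1)).comp (y.comp p hpy) (by rw [hc0']; exact h')) := by
    intro hn'
    simp only [hc0'] at hn'
    rw [QPath.comp_assoc x v (y.comp p hpy) h h'] at hn'
    have := hn'.right
    rw [← QPath.comp_assoc v y p h' hpy] at this
    exact hrp this
  obtain ⟨t, ht, e⟩ := hc.exists_eq_comp (-1) (y.comp p hpy) (by rw [hc0']; exact h') hyp hz
  have hlt : t.length < p.length := by
    by_contra hle
    obtain ⟨m, h₁, h₂, rfl, rfl⟩ := QPath.exists_of_comp_eq_comp e (not_lt.1 hle)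
    obtain ⟨h₃, hn'⟩ := hc.mem_annihilator (-1)
    refine hn' ?_
    simp only [hc0'] at h₃ ⊢
    rw [← QPath.comp_assoc x v _ h h', ← QPath.comp_assoc _ _ _ h₃ h₂] at hn
    exact hn.left
  obtain ⟨m, h₁, h₂, rfl, e'⟩ := QPath.exists_of_comp_eq_comp e.symm hlt.le
  refine ⟨y.length, ⟨y, m, t, h₂, h₁, rfl, ?_, e', rfl, hyp⟩, ?_⟩
  · rw [QPath.length_comp] at hlt
    lia
  · rw [hc0, QPath.length_comp, QPath.length_comp]
    lia

variable (I) in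
lemma exists_length_lt [IsMonomial I] : ∃ N : ℕ, ∀ p : QPath V, IsNonzero I p → p.length < N := by
  obtain ⟨N, hN⟩ := (‹IsMonomial I› : IsMonomial I).isAdmissible.1
  exact ⟨N, fun p hp => not_le.1 fun h => hp (hN p h)⟩

variable (I) in
lemma isNonzero_trivial [IsMonomial I] (v : V) : IsNonzero I (QPath.trivial v) := by
  intro h
  have := (‹IsMonomial I› : IsMonomial I).isAdmissible.2 _ h (QPath.trivial v) (by
    rw [of, Module.Basis.repr_self, Finsupp.single_eq_same]
    exact one_ne_zero)
  rw [QPath.trivial_length] at this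
  lia

end

variable {k V : Type u} [Field k] [Quiver.{u} V] [Fintype V]
  {I : TwoSidedIdeal (PathAlgebra k V)} [IsMonomial I]

variable [∀ a b : V, Finite (a ⟶ b)] {d : ℕ}
  [HasInjectiveDimensionLE (ModuleCat.of (QuotAlgebra I) (QuotAlgebra I)) d]

variable (d) in
/-- The minimal annihilator of a `d`-th syzygy path is a term of a perfect sequence: its successor
is its minimal annihilator, and taking minimal annihilators is injective on the finite set of the
`(d + 1)`-st syzygy paths. -/
lemma exists_isPerfect {r : QPath V} (hr : IsSyzygyPath I (d + 1) r) :
    ∃ c, IsPerfect I c ∧ c 1 = r := by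
  let E := {r : QPath V // IsSyzygyPath I (d + 1) r}
  have hnext : ∀ e : E, ∃ q : E, IsMinAnnihilator I e.1 q.1 := by
    rintro ⟨e, p, hp, he⟩
    suffices ∃ a ∈ PathSet.annihilator I e, IsNonzero I a by
      obtain ⟨a, ha, hn⟩ := this
      obtain ⟨q, hq, -⟩ := exists_isMinAnnihilator hn ha
      exact ⟨⟨q, e, IsSyzygyPath.of_succ ⟨p, hp, he⟩, hq⟩, hq⟩
    by_contra! H
    obtain ⟨b, hb, hb'⟩ := he.exists_eq_comp hp (isNonzero_trivial I e.tgt) rfl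
      fun a ha hn => absurd hn (H a ha)
    have h₁ := congrArg QPath.length hb'
    have h₂ := (IsSyzygyPath.isNonzero_and_one_le (n := d + 1) ⟨p, hp, he⟩).2
    rw [QPath.length_comp, QPath.trivial_length] at h₁
    lia
  choose next hmin using hnext
  have hprincipal : ∀ (e : E) (a : QPath V), IsNonzero I a → a ∈ PathSet.annihilator I e.1 →
      a ∈ PathSet.principal (next e).1 := by
    intro e a hn ha
    obtain ⟨q, hq, h⟩ := exists_isMinAnnihilator hn ha
    rwa [(hmin e).eq_of_isSyzygyPath e.2.of_succ hq]
  have hexists : ∀ (e : E) (b : QPath V) (h : b.tgt = (next e).1.src), IsNonzero I b →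
      ¬ IsNonzero I ((next e).1.comp b h) → ∃ (y : QPath V) (hy : y.tgt = e.1.src),
        b = e.1.comp y hy := by
    intro e b h hb hn
    obtain ⟨p, hp, he⟩ := e.2
    refine he.exists_eq_comp hp hb ((hmin e).src_eq.trans h.symm) fun a ha hna => ?_
    obtain ⟨a', h', rfl⟩ := PathSet.mem_principal.1 (hprincipal e a hna ha)
    have hb : (next e).1 ∈ PathSet.annihilator I b := ⟨h, hn⟩
    exact PathSet.comp_mem _ hb a' h'
  have hinj : Function.Injective next := by
    have key : ∀ e e' : E, next e = next e' → ∃ (y : QPath V) (hy : y.tgt = e.1.src),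
        e'.1 = e.1.comp y hy := by
      intro e e' h
      obtain ⟨h', hn⟩ := (hmin e').mem
      refine hexists e e'.1 (by rw [h]; exact h') e'.2.isNonzero_and_one_le.1 ?_
      simpa only [h] using hn
    intro e e' h
    obtain ⟨y, hy, h₁⟩ := key e e' h
    obtain ⟨y', hy', h₂⟩ := key e' e h.symm
    have h₃ := congrArg QPath.length h₁
    have h₄ := congrArg QPath.length h₂
    rw [QPath.length_comp] at h₃ h₄
    exact Subtype.ext (h₁.trans (QPath.comp_eq_left _ _ hy (by lia))).symm
  have : Finite E := Set.Finite.subset (finite_setOf_isNonzero I)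
    fun r (hr : IsSyzygyPath I (d + 1) r) => hr.isNonzero_and_one_le.1
  let σ : Equiv.Perm E := Equiv.ofBijective next (Finite.injective_iff_bijective.1 hinj)
  let c : ℤ → E := fun j => (σ ^ (j - 1)) ⟨r, hr⟩
  have hc : ∀ j, c (j + 1) = next (c j) := fun j => by
    change (σ ^ (j + 1 - 1)) ⟨r, hr⟩ = σ ((σ ^ (j - 1)) ⟨r, hr⟩)
    rw [← Equiv.Perm.mul_apply, ← zpow_one_add]
    congr 2
    ring
  refine ⟨fun j => (c j).1, ⟨fun j => (c j).2.isNonzero_and_one_le.1,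
    fun j => (c j).2.isNonzero_and_one_le.2, fun j => ?_, fun j => ?_, fun j => ?_⟩, rfl⟩
  · rw [hc]
    exact (hmin _).mem
  · rw [hc]
    exact hprincipal _
  · simp only [hc]
    exact hexists _

end QuotAlgebra

/-! ### Vanishing of morphisms in the singularity category -/

namespace QuotAlgebra

open PathAlgebra SingCat

variable {k V : Type u} [Field k] [Quiver.{u} V] [Fintype V]
  {I : TwoSidedIdeal (PathAlgebra k V)} [IsMonomial I] [∀ a b : V, Finite (a ⟶ b)]

/-- The path `p`, as a generator of the left ideal that it generates. -/
noncomputable def generator (p : QPath V) (s : ℤ) : (idealMod I (PathSet.principal p) s).carrier :=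
  (⟨path I p, path_mem_pathIdeal fun _ => PathSet.self_mem_principal p⟩ :
    pathIdeal I (PathSet.principal p))

lemma generator_mem (p : QPath V) {s i : ℤ} (h : s + i = p.length) :
    generator (I := I) p s ∈ (idealMod I (PathSet.principal p) s).grading i :=
  mem_idealMod_grading.2 (path_mem_grading p h.symm)

lemma exists_smul_generator (p : QPath V) {s : ℤ} (x : (idealMod I (PathSet.principal p) s).carrier) :
    ∃ z : QuotAlgebra I, z • generator p s = x := by
  suffices ∀ x ∈ pathIdeal I (PathSet.principal p), ∃ z, z * path I p = x by
    obtain ⟨x, hx⟩ := (show pathIdeal I (PathSet.principal p) from x)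
    obtain ⟨z, hz⟩ := this x hx
    exact ⟨z, Subtype.ext hz⟩
  intro x hx
  refine pathIdeal_induction (P := fun x => ∃ z, z * path I p = x) hx ⟨0, zero_mul _⟩ ?_ ?_
  · rintro _ _ ⟨a, rfl⟩ ⟨b, rfl⟩
    exact ⟨a + b, add_mul _ _ _⟩
  · intro c q hq _
    obtain ⟨b, hb, rfl⟩ := PathSet.mem_principal.1 hq
    exact ⟨c • path I b, by rw [smul_mul_assoc, path_mul_path hb]⟩

/-- There are no morphisms from the graded left ideal generated by `p` to a graded module that
vanishes in the degree of the generator. -/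
lemma homVanish_idealMod_principal {p : QPath V} {s i : ℤ} {Y : GrMod (grading I)}
    (hi : s + i = p.length) (h : Y.grading i = ⊥) :
    HomVanish (idealMod I (PathSet.principal p) s) Y := by
  intro f
  have hg : f.lin (generator p s) = 0 := by
    have := f.map_mem (generator_mem p hi)
    rwa [h, AddSubgroup.mem_bot] at this
  refine GrMod.hom_ext fun x => ?_
  obtain ⟨z, rfl⟩ := exists_smul_generator p x
  rw [map_smul, hg, smul_zero, GrMod.zero_lin]

/-- The left ideals generated by the paths of a perfect sequence form a complete sequence of
syzygies. -/
lemma IsPerfect.isCompleteSyzygySequence {c : ℤ → QPath V} (hc : IsPerfect I c) {τ : ℤ → ℤ}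
    (hτ : ∀ j, τ (j + 1) = τ j + (c j).length) :
    IsCompleteSyzygySequence fun j => idealMod I (PathSet.principal (c j)) (-τ j) := by
  rintro j _ rfl
  obtain ⟨hsrc, -⟩ := hc.mem_annihilator j
  obtain ⟨h, w, hS⟩ := shortExact_mulRight (I := I) (W := PathSet.startAt (c j).tgt 0)
    (W₁ := PathSet.principal (c (j + 1))) (W' := PathSet.principal (c j)) (c j)
    (fun a ha => ⟨fun h => by
        obtain ⟨b, hb, rfl⟩ := PathSet.mem_principal.1 h
        obtain ⟨h', hn⟩ := PathSet.comp_mem _ (hc.mem_annihilator j) b hb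
        exact ⟨PathSet.mem_startAt.2 ⟨h'.symm, Nat.zero_le _⟩, fun _ => hn⟩,
      fun ⟨h, hn⟩ => hc.mem_principal j a ha ⟨h.1.symm, hn _⟩⟩)
    (fun a _ hap _ => PathSet.mem_principal.2 ⟨a, hap, rfl⟩)
    (fun b hb _ => by
      obtain ⟨a, hap, rfl⟩ := PathSet.mem_principal.1 hb
      exact ⟨a, PathSet.mem_startAt.2 ⟨hap.symm, Nat.zero_le _⟩, hap, rfl⟩)
    (s := -τ (j + 1)) (s' := -τ j) (by rw [hτ]; lia)
  refine ⟨_, _, _, w, hS, projective_startAt _ _, fun Q _ f => ?_⟩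
  have hA : ∀ a : QuotAlgebra I, path I (QPath.trivial (c (j + 1)).tgt) * a = a →
      path I (c (j + 1 + 1)) * a = 0 → ∃ b, path I (c (j + 1)) * b = a := by
    intro a ha hza
    suffices ∀ b, coeff I a b ≠ 0 → ∃ z, path I (c (j + 1)) * z = path I b by
      rw [← sum_coeff a]
      refine Finset.sum_induction _ (fun a => ∃ b, path I (c (j + 1)) * b = a) ?_
        ⟨0, mul_zero _⟩ fun b hb => ?_
      · rintro _ _ ⟨a, rfl⟩ ⟨b, rfl⟩
        exact ⟨a + b, mul_add _ _ _⟩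
      · obtain ⟨z, hz⟩ := this b (Finsupp.mem_support_iff.1 hb)
        exact ⟨coeff I a b • z, by rw [mul_smul_comm, hz]⟩
    intro b hb
    have hbt : b.tgt = (c (j + 1)).tgt := by
      rw [← ha] at hb
      obtain ⟨b', hb', rfl⟩ := exists_of_coeff_path_mul_ne_zero hb
      rfl
    obtain ⟨h', -⟩ := hc.mem_annihilator (j + 1)
    obtain ⟨y, hy, rfl⟩ := hc.exists_eq_comp (j + 1) b (hbt.trans h')
      (isNonzero_of_coeff_ne_zero hb) fun hn => by
        rw [← coeff_path_mul a _ b (hbt.trans h') hn, hza, map_zero, Finsupp.zero_apply] at hb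
        exact hb rfl
    exact ⟨path I y, path_mul_path hy⟩
  obtain ⟨x, hx⟩ := GrMod.exists_smul_eq_of_projective hA Q (f.lin (generator (c (j + 1)) _))
    (by
      rw [← map_smul]
      exact congrArg f.lin (Subtype.ext (path_trivial_mul rfl)))
    (by
      rw [← map_smul]
      obtain ⟨h', hn⟩ := hc.mem_annihilator (j + 1)
      refine (congrArg f.lin (Subtype.ext ?_)).trans (map_zero f.lin)
      exact (path_mul_path h').trans (path_eq_zero hn))
  have hx' : path I (c (j + 1)) • Q.proj (τ (j + 1)) x = f.lin (generator (c (j + 1)) _) := by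
    rw [← Q.proj_smul (path_mem_grading (c (j + 1)) rfl), hx]
    exact Q.proj_of_mem (f.map_mem (generator_mem _ (by lia)))
  refine ⟨⟨LinearMap.toSpanSingleton _ _ (Q.proj (τ (j + 1)) x) ∘ₗ
    (pathIdeal I (PathSet.startAt (c j).tgt 0)).subtype, fun {i y} hy => ?_⟩, ?_⟩
  · have := Q.smul_mem (mem_idealMod_grading.1 hy) (Q.proj_mem (τ (j + 1)) x)
    rwa [show -τ (j + 1) + i + τ (j + 1) = i by lia] at this
  · refine GrMod.hom_ext fun y => ?_
    obtain ⟨z, rfl⟩ := exists_smul_generator _ y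
    rw [map_smul, map_smul, ← hx']
    rfl

/-- Every sequence of integers indexed by `ℤ` is the sequence of differences of another one. -/
lemma exists_int_sum (f : ℤ → ℤ) (j₀ g : ℤ) :
    ∃ τ : ℤ → ℤ, (∀ j, τ (j + 1) = τ j + f j) ∧ τ j₀ = g := by
  let τ : ℤ → ℤ := fun
    | .ofNat n => ∑ i ∈ Finset.range n, f i
    | .negSucc n => -∑ i ∈ Finset.range (n + 1), f (.negSucc i)
  have hτ : ∀ j, τ (j + 1) = τ j + f j := by
    rintro (n | _ | n)
    · exact Finset.sum_range_succ _ n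
    · change ∑ i ∈ Finset.range 0, f i = -∑ i ∈ Finset.range (0 + 1), f (.negSucc i) + f (.negSucc 0)
      simp
    · change -∑ i ∈ Finset.range (n + 1), f (.negSucc i) =
        -∑ i ∈ Finset.range (n + 1 + 1), f (.negSucc i) + f (.negSucc (n + 1))
      rw [Finset.sum_range_succ _ (n + 1)]
      ring
  refine ⟨fun j => τ j + (g - τ j₀), fun j => ?_, by ring⟩
  change τ (j + 1) + _ = τ j + _ + f j
  rw [hτ]
  ring

section Gorenstein

variable {d : ℕ} [HasInjectiveDimensionLE (ModuleCat.of (QuotAlgebra I) (QuotAlgebra I)) d]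

/-- The left ideal generated by a `d`-th syzygy path is projective, or it is isomorphic to the one
generated by a path of a perfect sequence. -/
lemma projective_or_exists_isPerfect {p : QPath V} (hp : IsSyzygyPath I d p) :
    (∀ s, Projective (idealMod I (PathSet.principal p) s)) ∨
      ∃ (c : ℤ → QPath V) (x : QPath V) (hx : x.tgt = (c 0).src), IsPerfect I c ∧
        p = (c 0).comp x hx ∧ ∀ s s' : ℤ, s + x.length = s' →
          Nonempty (idealMod I (PathSet.principal (c 0)) s ≅
            idealMod I (PathSet.principal p) s') := by
  by_cases H : ∃ r, IsMinAnnihilator I p r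
  · right
    obtain ⟨r, hr⟩ := H
    obtain ⟨c, hc, rfl⟩ := exists_isPerfect d ⟨p, hp, hr⟩
    obtain ⟨hsrc, hn⟩ := hr.mem
    obtain ⟨x, hx, rfl⟩ := hc.exists_eq_comp 0 p hsrc hp.isNonzero_and_one_le.1 hn
    have hK : ∀ a, IsNonzero I a → a ∈ PathSet.annihilator I ((c 0).comp x hx) →
        a ∈ PathSet.principal (c 1) := fun a ha hap => by
      obtain ⟨r, hr', har⟩ := exists_isMinAnnihilator ha hap
      rwa [hr.eq_of_isSyzygyPath hp hr']
    refine ⟨c, x, hx, hc, rfl, fun s s' hs => nonempty_iso_mulRight x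
      (fun a ha hna => ?_) (fun a ha _ => ?_) hs⟩
    · obtain ⟨b, hb, rfl⟩ := PathSet.mem_principal.1 ha
      refine ⟨hx, ?_, PathSet.mem_principal.2 ⟨b, hb, QPath.comp_assoc b (c 0) x hb hx⟩⟩
      by_contra hn'
      rw [QPath.comp_assoc b (c 0) x hb hx] at hn'
      obtain ⟨b', hb', rfl⟩ := PathSet.mem_principal.1 (hK b hna.left ⟨hb, hn'⟩)
      exact (PathSet.comp_mem _ (hc.mem_annihilator 0) b' hb').2 hna
    · obtain ⟨b, hb, rfl⟩ := PathSet.mem_principal.1 ha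
      exact ⟨b.comp (c 0) hb, PathSet.mem_principal.2 ⟨b, hb, rfl⟩, hx,
        (QPath.comp_assoc b (c 0) x hb hx).symm⟩
  · left
    intro s
    obtain ⟨h₁, f, w, hS⟩ := shortExact_annihilator (I := I) p (s := s - p.length) (s' := s)
      (by lia)
    have : IsIso f := hS.isIso_g_iff.2 (isZero_idealMod (fun a ha hna => H (by
      obtain ⟨r, hr, -⟩ := exists_isMinAnnihilator hna ha
      exact ⟨r, hr⟩)) _)
    exact Projective.of_iso (asIso f) (projective_startAt p.tgt (s - p.length))

variable [HasDerivedCategory.{w} (GrMod (grading I))]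

variable (d) in
/-- The morphisms in the singularity category from the left ideal generated by `p`, with the
generator in degree `g`, are controlled by the perfect sequences whose path `c 0` overlaps `p`: the
position of `c 0` relative to `p` determines the degrees `τ (a + 1)` of the generators of the
syzygies. -/
lemma homVanish_stalk_principal {m n : ℕ} (hmn : n + m = d) {p : QPath V} (hp : IsSyzygyPath I n p)
    {Y : GrMod (grading I)} (a g : ℤ)
    (h : ∀ (c : ℤ → QPath V) (τ : ℤ → ℤ) (i : ℕ), IsPerfect I c →
      (∀ j, τ (j + 1) = τ j + (c j).length) → Overlaps I c p i → τ 1 = g + i →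
        Y.grading (τ (a + 1)) = ⊥) :
    HomVanish (stalk (idealMod I (PathSet.principal p) (p.length - g))) ((stalk Y)⟦a⟧) := by
  induction m generalizing n p a g with
  | zero =>
    obtain rfl : n = d := by lia
    obtain hproj | ⟨c, x, hx, hc, rfl, hiso⟩ := projective_or_exists_isPerfect hp
    · have := hproj (p.length - g)
      exact HomVanish.of_isZero_left (isZero_stalk _)
    · obtain ⟨τ, hτ, hτ1⟩ := exists_int_sum (fun j => (c j).length) 1 g
      have hτ0 : τ 1 = τ 0 + (c 0).length := hτ 0
      obtain ⟨e⟩ := hiso (-τ 0) (((c 0).comp x hx).length - g)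
        (by rw [QPath.length_comp]; push_cast; lia)
      refine HomVanish.of_iso_left ?_ ((stalkFunctor _).mapIso e.symm)
      refine (hc.isCompleteSyzygySequence (I := I) hτ).homVanish_stalk a
        (homVanish_idealMod_principal (i := τ (a + 1)) (by rw [hτ]; lia) ?_)
      exact h c τ 0 hc hτ ⟨QPath.trivial (c 0).tgt, c 0, x, rfl, hx, rfl, hc.one_le_length 0,
        (QPath.trivial_comp _).symm, rfl,
        (congrArg (IsNonzero I) (QPath.trivial_comp ((c 0).comp x hx))).mpr
          hp.isNonzero_and_one_le.1⟩ (by rw [hτ1]; simp)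
  | succ m ih =>
    obtain ⟨h₁, f, w, hS⟩ := shortExact_annihilator (I := I) p (s := -g) (s' := p.length - g)
      (by lia)
    have : Projective (ShortComplex.mk _ _ w).X₂ := projective_startAt _ _
    have key := homVanish_stalk_X₃ hS (Y := stalk Y) (n := a - 1) ?_
    · rwa [sub_add_cancel] at key
    refine idealMod_annihilator_of (I := I) (fun X => HomVanish (stalk X) ((stalk Y)⟦a - 1⟧))
      (fun X hX => HomVanish.of_isZero_left (Functor.map_isZero (stalkFunctor _) hX))
      (fun S hS => homVanish_stalk_X₂ hS) p (-g) fun r hr => ?_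
    rw [show -g = (r.length : ℤ) - (g + r.length) by lia]
    refine ih (n := n + 1) (by lia) ⟨p, hp, hr⟩ (a - 1) _ fun c τ i' hc hτ hov hτ1 => ?_
    obtain ⟨i, hi, hlen⟩ := hov.prev hc hp.isNonzero_and_one_le.1 hr
    have := h (fun j => c (j - 1)) (fun j => τ (j - 1)) i hc.prev
      (fun j => by rw [show j + 1 - 1 = j - 1 + 1 by ring]; exact hτ _) hi
      (by have := hτ 0; simp only [zero_add, sub_self] at this ⊢; lia)
    rwa [sub_add_cancel, ← show a + 1 - 1 = a by ring]

/-- The left ideal generated by `p`, with the generator in degree one, has no morphisms of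
nonnegative degree to modules in degrees `≤ 0`. -/
lemma homVanish_stalk_principal_of_nonneg (d : ℕ)
    [HasInjectiveDimensionLE (ModuleCat.of (QuotAlgebra I) (QuotAlgebra I)) d] {p : QPath V}
    (hp : IsNonzero I p) (hp' : 1 ≤ p.length)
    {Y : GrMod (grading I)} (hY : ∀ i > 0, Y.grading i = ⊥) {a : ℤ} (ha : 0 ≤ a) :
    HomVanish (stalk (idealMod I (PathSet.principal p) (p.length - 1))) ((stalk Y)⟦a⟧) := by
  refine homVanish_stalk_principal d (zero_add d) (show IsSyzygyPath I 0 p from ⟨hp, hp'⟩) a 1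
    fun c τ i hc hτ _ hτ1 => hY _ ?_
  have hmono : Monotone τ := monotone_int_of_le_succ fun j => by rw [hτ]; lia
  have := hmono (show 1 ≤ a + 1 by lia)
  lia

/-- The left ideal generated by `p`, with the generator in degree one, has no morphisms of
negative degree to modules in degrees `≥ 1`. -/
lemma homVanish_stalk_principal_of_neg (d : ℕ)
    [HasInjectiveDimensionLE (ModuleCat.of (QuotAlgebra I) (QuotAlgebra I)) d] {p : QPath V}
    (hp : IsNonzero I p) (hp' : 1 ≤ p.length)
    {Y : GrMod (grading I)} (hY : ∀ i < 1, Y.grading i = ⊥) {a : ℤ} (ha : a < 0) :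
    HomVanish (stalk (idealMod I (PathSet.principal p) (p.length - 1))) ((stalk Y)⟦a⟧) := by
  refine homVanish_stalk_principal d (zero_add d) (show IsSyzygyPath I 0 p from ⟨hp, hp'⟩) a 1
    fun c τ i hc hτ hov hτ1 => hY _ ?_
  have hmono : Monotone τ := monotone_int_of_le_succ fun j => by rw [hτ]; lia
  have := hmono (show a + 1 ≤ 0 by lia)
  have h0 : τ 1 = τ 0 + (c 0).length := hτ 0
  have := hov.length_lt
  lia

end Gorenstein

end QuotAlgebra

/-! ### Truncations of the shifts of the regular module -/

namespace GrMod

variable {k A : Type u} [CommRing k] [Ring A] [Algebra k A] {𝒜 : ℤ → Submodule k A}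

lemma shift_proj (X : GrMod 𝒜) (n i : ℤ) (x : X.carrier) :
    (X.shift n).proj i x = X.proj (n + i) x := by
  induction x using X.induction_on with
  | hom j x hx =>
    have hx' : x ∈ (X.shift n).grading (j - n) := by
      change x ∈ X.grading (n + (j - n))
      rwa [add_sub_cancel]
    by_cases h : j = n + i
    · subst h
      exact ((X.shift n).proj_of_mem hx).trans (X.proj_of_mem hx).symm
    · exact ((X.shift n).proj_of_mem_ne hx' (by lia)).trans (X.proj_of_mem_ne hx h).symm
  | add x y hx hy =>
    rw [map_add, ← hx, ← hy]
    exact map_add _ _ _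

end GrMod

namespace QuotAlgebra

open PathAlgebra SingCat

variable {k V : Type u} [Field k] [Quiver.{u} V] [Fintype V]
  {I : TwoSidedIdeal (PathAlgebra k V)} [IsMonomial I]

variable (I) in
/-- The truncation `A(n)_{≤ 0}`. -/
noncomputable abbrev truncShift (n : ℕ) : GrMod (grading I) :=
  ((GrMod.regular (grading I)).shift n).truncLE 0

lemma geSubmodule_shift_eq (n : ℕ) :
    ((GrMod.regular (grading I)).shift n).geSubmodule (0 + 1) =
      pathIdeal I (PathSet.lengthGE V (n + 1)) := by
  suffices ∀ x : QuotAlgebra I, (∀ j : ℤ, j < 0 + 1 → component (n + j) x = 0) ↔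
      x ∈ pathIdeal I (PathSet.lengthGE V (n + 1)) by
    ext x
    refine Iff.trans (forall_congr' fun j => forall_congr' fun _ => ?_) (this x)
    exact iff_of_eq (congrArg (· = 0) (GrMod.shift_proj _ _ _ _))
  intro x
  constructor
  · intro h p hp
    by_contra hlt
    rw [PathSet.mem_lengthGE] at hlt
    have h := h (p.length - n) (by lia)
    have := coeff_component (n + (p.length - n)) x p
    rw [h, if_pos (by lia), map_zero, Finsupp.zero_apply] at this
    exact hp this.symm
  · intro h j hj
    refine coeff_ext fun p => ?_
    rw [coeff_component, map_zero, Finsupp.zero_apply]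
    split_ifs with hpj
    · by_contra hp
      have := h p hp
      rw [PathSet.mem_lengthGE] at this
      lia
    · rfl

lemma truncShift_grading_eq_bot (n : ℕ) {i : ℤ} (hi : 0 < i) : (truncShift I n).grading i = ⊥ := by
  rw [eq_bot_iff]
  rintro _ ⟨x, hx, rfl⟩
  refine (Submodule.Quotient.mk_eq_zero _).2 fun j hj => ?_
  exact GrMod.proj_of_mem_ne _ hx (by lia)

variable [∀ a b : V, Finite (a ⟶ b)]

/-- The truncation `A(n)_{≤ 0}` is the quotient of `A(n)` by the left ideal of the paths of length
greater than `n`. -/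
lemma shortExact_truncShift (n : ℕ) :
    ∃ f g w, (ShortComplex.mk (f : idealMod I (PathSet.lengthGE V (n + 1)) n ⟶
      (GrMod.regular (grading I)).shift n) (g : _ ⟶ truncShift I n) w).ShortExact := by
  let f : idealMod I (PathSet.lengthGE V (n + 1)) n ⟶ (GrMod.regular (grading I)).shift n :=
    ⟨(pathIdeal I (PathSet.lengthGE V (n + 1))).subtype, fun hx => hx⟩
  have hmem : ∀ x : QuotAlgebra I, x ∈ pathIdeal I (PathSet.lengthGE V (n + 1)) ↔
      x ∈ ((GrMod.regular (grading I)).shift n).geSubmodule (0 + 1) := fun x => by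
    rw [geSubmodule_shift_eq]
    exact Iff.rfl
  let g : (GrMod.regular (grading I)).shift n ⟶ truncShift I n :=
    GrMod.quotMk _ _ (GrMod.isGradedSub_geSubmodule _ _)
  have w : f ≫ g = 0 := by
    apply GrMod.hom_ext
    rintro ⟨x, hx⟩
    exact (Submodule.Quotient.mk_eq_zero _).2 ((hmem x).1 hx)
  refine ⟨f, g, w, GrMod.shortExact_mk _ _ w Subtype.val_injective (Submodule.mkQ_surjective _)
    fun y hy => ?_⟩
  exact ⟨⟨y, (hmem y).2 ((Submodule.Quotient.mk_eq_zero _).1 hy)⟩, rfl⟩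

lemma idealMod_lengthGE_grading_eq_bot (n : ℕ) {i : ℤ} (hi : i < 1) :
    (idealMod I (PathSet.lengthGE V (n + 1)) n).grading i = ⊥ := by
  rw [eq_bot_iff]
  rintro ⟨x, hx⟩ hxi
  refine Subtype.ext (coeff_ext fun p => ?_)
  change coeff I x p = coeff I 0 p
  rw [map_zero, Finsupp.zero_apply]
  by_contra hp
  have h₁ := PathSet.mem_lengthGE.1 (hx p hp)
  have h₂ := length_of_coeff_ne_zero (mem_idealMod_grading.1 hxi) hp
  lia

/-- A left ideal generated by paths of the same length `n` decomposes into the left ideals generated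
by these paths. -/
lemma idealMod_of_length_eq (P : GrMod (grading I) → Prop) (h0 : ∀ X, IsZero X → P X)
    (h2 : ∀ S : ShortComplex (GrMod (grading I)), S.ShortExact → P S.X₁ → P S.X₃ → P S.X₂)
    {W : PathSet V} {n : ℕ} (hle : ∀ p ∈ W, n ≤ p.length)
    (hW : ∀ (a b : QPath V) (h : b.tgt = a.src), a.comp b h ∈ W → b.length = n → b ∈ W)
    (s : ℤ) (h : ∀ r ∈ W, IsNonzero I r → r.length = n → P (idealMod I (PathSet.principal r) s)) :
    P (idealMod I W s) := by
  have key : ∀ p, IsNonzero I p →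
      (p ∈ W ↔ p ∈ PathSet.generated {r | r ∈ W ∧ IsNonzero I r ∧ r.length = n}) := by
    refine fun p hp => ⟨fun hpW => ?_, ?_⟩
    · obtain ⟨a, b, hab, rfl, hb⟩ := p.exists_eq_comp (hle p hpW)
      exact ⟨b, ⟨hW a b hab hpW hb, hp.right, hb⟩, a, hab, rfl⟩
    · rintro ⟨r, hr, b, hb, rfl⟩
      exact W.comp_mem hr.1 b hb
  rw [idealMod_congr key]
  refine idealMod_of_generated P h0 h2 ((finite_setOf_isNonzero I).subset fun r hr => hr.2.1)
    (fun r hr r' hr' a ha _ e => ?_) s fun r hr => h r hr.1 hr.2.1 hr.2.2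
  have := congrArg QPath.length e
  rw [QPath.length_comp, hr.2.2, hr'.2.2] at this
  rw [e, QPath.comp_eq_right a r' ha (by lia)]

section Gorenstein

variable [HasDerivedCategory.{w} (GrMod (grading I))]

lemma homVanish_stalk_lengthGE {n : ℕ} {Z : SingularityCategory (GrMod (grading I))}
    (h : ∀ p, IsNonzero I p → 1 ≤ p.length →
      HomVanish (stalk (idealMod I (PathSet.principal p) (p.length - 1))) Z) :
    HomVanish (stalk (idealMod I (PathSet.lengthGE V (n + 1)) n)) Z := by
  refine idealMod_of_length_eq (n := n + 1) (fun X => HomVanish (stalk X) Z)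
    (fun X hX => HomVanish.of_isZero_left (Functor.map_isZero (stalkFunctor _) hX))
    (fun S hS => homVanish_stalk_X₂ hS) (fun p hp => hp)
    (fun a b _ _ hb => PathSet.mem_lengthGE.2 hb.ge) n fun r _ hr hrn => ?_
  rw [show (n : ℤ) = r.length - 1 by lia]
  exact h r hr (by lia)

/-- The truncations `A(n)_{≤ 0}` have no morphisms of nonzero degree in the singularity category. -/
lemma homVanish_stalk_truncShift (d : ℕ)
    [HasInjectiveDimensionLE (ModuleCat.of (QuotAlgebra I) (QuotAlgebra I)) d] (n m : ℕ) {a : ℤ}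
    (ha : a ≠ 0) : HomVanish (stalk (truncShift I n)) ((stalk (truncShift I m))⟦a⟧) := by
  obtain ⟨f, g, w, hS⟩ := shortExact_truncShift (I := I) n
  have : Projective (ShortComplex.mk f g w).X₂ := GrMod.projective_regular_shift _
  obtain ha | ha := ha.lt_or_gt
  · obtain ⟨f', g', w', hS'⟩ := shortExact_truncShift (I := I) m
    have : Projective (ShortComplex.mk f' g' w').X₂ := GrMod.projective_regular_shift _
    refine homVanish_shift_stalk_X₃ hS' (homVanish_stalk_X₃ hS ?_)
    exact homVanish_stalk_lengthGE fun p hp hp' => homVanish_stalk_principal_of_neg d hp hp'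
      (fun i hi => idealMod_lengthGE_grading_eq_bot m hi) ha
  · obtain ⟨b, rfl⟩ : ∃ b, a = b + 1 := ⟨a - 1, by ring⟩
    refine homVanish_stalk_X₃ hS ?_
    exact homVanish_stalk_lengthGE fun p hp hp' => homVanish_stalk_principal_of_nonneg d hp hp'
      (fun i hi => truncShift_grading_eq_bot m hi) (by lia)

end Gorenstein

end QuotAlgebra

/-! ### Dévissage of graded modules -/

namespace GrMod

variable {k A : Type u} [CommRing k] [Ring A] [Algebra k A] {𝒜 : ℤ → Submodule k A}

lemma isZero_of_subsingleton (X : GrMod 𝒜) [Subsingleton X.carrier] : IsZero X := by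
  rw [IsZero.iff_id_eq_zero]
  exact hom_ext fun x => Subsingleton.elim _ _

lemma shortExact_quot_range [IsNoetherianRing A] {X Y : GrMod 𝒜} (f : X ⟶ Y) (hf : Function.Injective f.lin) :
    ∃ w, (ShortComplex.mk f (Y.quotMk _ (isGradedSub_range f)) w).ShortExact :=
  ⟨comp_quotMk_range f, shortExact_mk _ _ _ hf (Submodule.mkQ_surjective _)
    fun _ hy => (Submodule.Quotient.mk_eq_zero _).1 hy⟩

end GrMod

namespace QuotAlgebra

open PathAlgebra SingCat

variable {k V : Type u} [Field k] [Quiver.{u} V] [Fintype V]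
  {I : TwoSidedIdeal (PathAlgebra k V)} [IsMonomial I]

/-- The graded module `X` is a simple module at the vertex `v`, in degree `i`. -/
def IsSimpleAt (X : GrMod (grading I)) (v : V) (i : ℤ) : Prop :=
  ∃ y ∈ X.grading i, y ≠ 0 ∧ path I (QPath.trivial v) • y = y ∧
    (∀ q : QPath V, 1 ≤ q.length → path I q • y = 0) ∧ ∀ x, ∃ a : QuotAlgebra I, a • y = x

variable [∀ a b : V, Finite (a ⟶ b)]

instance : IsArtinianRing (QuotAlgebra I) := isArtinian_of_tower k inferInstance

/-- A nonzero graded module has a simple graded submodule: a longest path that does not annihilate a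
given homogeneous element sends it to the socle. -/
lemma exists_socle (X : GrMod (grading I)) [Nontrivial X.carrier] :
    ∃ (v : V) (i : ℤ), ∃ y ∈ X.grading i, y ≠ 0 ∧ path I (QPath.trivial v) • y = y ∧
      ∀ q : QPath V, 1 ≤ q.length → path I q • y = 0 := by
  obtain ⟨j, x, hx, hx0⟩ : ∃ j, ∃ x ∈ X.grading j, x ≠ 0 := by
    by_contra! H
    obtain ⟨x, hx⟩ := exists_ne (0 : X.carrier)
    exact hx (X.induction_on (p := fun x => x = 0) x (fun i x hxi => H i x hxi)
      fun a b ha hb => by rw [ha, hb, add_zero])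
  let S : Set (QPath V) := {p | path I p • x ≠ 0}
  have hS : S.Finite := (finite_setOf_isNonzero I).subset fun p hp => by
    by_contra h
    exact hp (by rw [path_eq_zero h]; exact zero_smul (QuotAlgebra I) x)
  have hne : S.Nonempty := by
    by_contra! H
    have h1 : (1 : QuotAlgebra I) = ∑ v : V, path I (QPath.trivial v) := by
      rw [← map_one (mk I), one_def, map_sum]
      rfl
    refine hx0 ?_
    rw [← one_smul (QuotAlgebra I) x, h1, Finset.sum_smul]
    refine Finset.sum_eq_zero fun v _ => ?_
    by_contra h
    exact (H ▸ (show QPath.trivial v ∈ S from h) : QPath.trivial v ∈ (∅ : Set (QPath V)))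
  obtain ⟨p, hp, hmax⟩ := Set.exists_max_image S QPath.length hS hne
  refine ⟨p.tgt, _, path I p • x, X.smul_mem (path_mem_grading p rfl) hx, hp, ?_, fun q hq => ?_⟩
  · rw [smul_smul, path_trivial_mul rfl]
  · rw [smul_smul]
    by_cases hqp : p.tgt = q.src
    · rw [path_mul_path hqp]
      by_contra h
      have := hmax _ h
      rw [QPath.length_comp] at this
      lia
    · rw [path_mul_path_of_ne hqp]
      exact zero_smul (QuotAlgebra I) x

/-- A class of graded modules that is closed under extensions contains all the modules in the
degrees in which it contains the simple modules. -/
lemma devissage (P : GrMod (grading I) → Prop) (h0 : ∀ X, IsZero X → P X)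
    (h2 : ∀ S : ShortComplex (GrMod (grading I)), S.ShortExact → P S.X₁ → P S.X₃ → P S.X₂)
    (D : Set ℤ) (hP : ∀ X v, ∀ i ∈ D, IsSimpleAt X v i → P X) (X : GrMod (grading I))
    (hX : ∀ i ∉ D, X.grading i = ⊥) : P X := by
  induction h : Module.length (QuotAlgebra I) X.carrier using WellFoundedLT.induction
    generalizing X with
  | _ n ih =>
  obtain hsub | hnt := subsingleton_or_nontrivial X.carrier
  · exact h0 X (GrMod.isZero_of_subsingleton X)
  obtain ⟨v, i, y, hy, hy0, hvy, hqy⟩ := exists_socle X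
  let f : (GrMod.regular (grading I)).shift (-i) ⟶ X :=
    ⟨LinearMap.toSpanSingleton (QuotAlgebra I) _ y, fun {j x} hx => by
      have := X.smul_mem (show x ∈ grading I (-i + j) from hx) hy
      rwa [show -i + j + i = j by lia] at this⟩
  obtain ⟨w, hS⟩ := GrMod.shortExact_sub_quot X _ (GrMod.isGradedSub_range f)
  have hyf : y ∈ LinearMap.range f.lin := ⟨(1 : QuotAlgebra I), one_smul _ _⟩
  refine h2 _ hS (hP _ v i ?_ ?_) (ih _ ?_ _ ?_ rfl)
  · by_contra hi
    have := hX i hi ▸ hy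
    exact hy0 this
  · refine ⟨⟨y, hyf⟩, hy, fun h => hy0 (congrArg Subtype.val h), Subtype.ext hvy,
      fun q hq => Subtype.ext (hqy q hq), ?_⟩
    rintro ⟨_, a, rfl⟩
    exact ⟨a, rfl⟩
  · rw [← h]
    refine Submodule.length_quotient_lt _ fun hbot => hy0 ?_
    rw [hbot] at hyf
    exact hyf
  · intro j hj
    rw [eq_bot_iff]
    rintro _ ⟨x, hx, rfl⟩
    have hx0 : x = 0 := by
      have := hX j hj ▸ hx
      exact this
    rw [hx0]
    exact map_zero _

/-- The projective cover of a simple module and its kernel. -/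
lemma IsSimpleAt.shortExact {X : GrMod (grading I)} {v : V} {i : ℤ} (h : IsSimpleAt X v i) :
    ∃ f g w, (ShortComplex.mk (f : idealMod I (PathSet.startAt v 1) (-i) ⟶
      idealMod I (PathSet.startAt v 0) (-i)) (g : _ ⟶ X) w).ShortExact := by
  obtain ⟨y, hy, hy0, hvy, hqy, hgen⟩ := h
  have h₁ : ∀ p, IsNonzero I p → p ∈ PathSet.startAt v 1 → p ∈ PathSet.startAt v 0 :=
    fun p _ hp => ⟨hp.1, Nat.zero_le _⟩
  let g : idealMod I (PathSet.startAt v 0) (-i) ⟶ X :=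
    ⟨LinearMap.toSpanSingleton (QuotAlgebra I) _ y ∘ₗ (pathIdeal I (PathSet.startAt v 0)).subtype,
      fun {j x} hx => by
        have := X.smul_mem (mem_idealMod_grading.1 hx) hy
        rwa [show -i + j + i = j by lia] at this⟩
  have hker : ∀ z ∈ pathIdeal I (PathSet.startAt v 1), z • y = 0 := by
    intro z hz
    refine pathIdeal_induction (P := fun z => z • y = 0) hz (zero_smul _ _)
      (fun a b ha hb => by rw [add_smul, ha, hb, add_zero]) fun c q hq _ => ?_
    rw [← one_mul (path I q), ← smul_mul_assoc, mul_smul, hqy q hq.2, smul_zero]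
  have w : inclusion h₁ (-i) ≫ g = 0 := by
    apply GrMod.hom_ext
    rintro ⟨z, hz⟩
    exact hker z hz
  refine ⟨inclusion h₁ (-i), g, w, GrMod.shortExact_mk _ _ w ?_ ?_ ?_⟩
  · exact Submodule.inclusion_injective (pathIdeal_mono h₁)
  · intro x
    obtain ⟨a, rfl⟩ := hgen x
    refine ⟨(⟨a * path I (QPath.trivial v), (pathIdeal I _).smul_mem a
      (path_mem_pathIdeal fun _ => PathSet.mem_startAt.2 ⟨rfl, Nat.zero_le _⟩)⟩ :
        pathIdeal I (PathSet.startAt v 0)), ?_⟩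
    change (a * path I (QPath.trivial v)) • y = a • y
    rw [mul_smul, hvy]
  · suffices ∀ x ∈ pathIdeal I (PathSet.startAt v 0), x • y = 0 →
        x ∈ pathIdeal I (PathSet.startAt v 1) by
      rintro ⟨x, hx⟩ hx0
      exact ⟨⟨x, this x hx hx0⟩, rfl⟩
    intro x hx hx0
    set c := coeff I x (QPath.trivial v) with hc
    have hp : ∀ p, coeff I x p ≠ 0 → p ≠ QPath.trivial v → p ∈ PathSet.startAt v 1 := by
      intro p hp hne
      refine PathSet.mem_startAt.2 ⟨(hx p hp).1, ?_⟩
      by_contra hlt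
      have := p.eq_trivial (by lia)
      rw [(hx p hp).1] at this
      exact hne this
    have hx' : x - c • path I (QPath.trivial v) ∈ pathIdeal I (PathSet.startAt v 1) := by
      intro p hpx
      rw [map_sub, map_smul, Finsupp.sub_apply, Finsupp.smul_apply] at hpx
      by_cases hpv : p = QPath.trivial v
      · subst hpv
        rw [coeff_path (isNonzero_trivial I v), Finsupp.single_eq_same, smul_eq_mul, mul_one, hc,
          sub_self] at hpx
        exact absurd rfl hpx
      · rw [coeff_path_of_ne (Ne.symm hpv), smul_zero, sub_zero] at hpx
        exact hp p hpx hpv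
    have hc0 : c = 0 := by
      by_contra hc0
      have h3 := hker _ hx'
      rw [sub_smul, hx0, zero_sub, neg_eq_zero] at h3
      refine hy0 ?_
      have h4 : path I (QPath.trivial v) = (c⁻¹ • (1 : QuotAlgebra I)) *
          (c • path I (QPath.trivial v)) := by
        rw [smul_mul_assoc, one_mul]
        exact (inv_smul_smul₀ hc0 _).symm
      rw [← hvy, h4, mul_smul, h3, smul_zero]
    exact fun p hpx => hp p hpx fun h => hpx (by rw [h, ← hc, hc0])

/-! ### Generation of the singularity category -/

section Generation

variable [HasDerivedCategory.{w} (GrMod (grading I))]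
  (P : ObjectProperty (SingularityCategory (GrMod (grading I)))) [P.IsTriangulated]
  [P.IsClosedUnderIsomorphisms] [P.IsStableUnderRetracts]

omit [P.IsStableUnderRetracts] in
lemma prop_stalk_of_isZero (X : GrMod (grading I)) (hX : IsZero X) : P (stalk X) :=
  P.prop_of_isZero (Functor.map_isZero (stalkFunctor _) hX)

lemma prop_stalk_of_isSimpleAt_of_nonpos (hT : ∀ n, P (stalk (truncShift I n))) (j : ℕ)
    {X : GrMod (grading I)} {v : V} (hX : IsSimpleAt X v (-j)) : P (stalk X) := by
  induction j using Nat.strong_induction_on generalizing X v with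
  | _ j ih =>
  -- `A(j)_{≥ 1}` is the kernel of `A(j) → A(j)_{≤ 0}`, and contains the part of `A e_v (j)` in
  -- degrees `≥ 1` as a direct summand.
  have h₁ : P (stalk (idealMod I (PathSet.startAt v (j + 1)) j)) := by
    obtain ⟨f, g, w, hS⟩ := shortExact_truncShift (I := I) j
    have : Projective (ShortComplex.mk f g w).X₂ := GrMod.projective_regular_shift _
    have h := prop_stalk_X₁ hS (prop_stalk_of_projective P _) (hT j)
    have hi : ∀ p, IsNonzero I p → p ∈ PathSet.startAt v (j + 1) → p ∈ PathSet.lengthGE V (j + 1) :=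
      fun p _ hp => hp.2
    have hr : ∀ p ∈ PathSet.lengthGE V (j + 1), ∀ (a : QPath V) (hap : p.tgt = a.src),
        IsNonzero I (a.comp p hap) → a.comp p hap ∈ PathSet.startAt v (j + 1) →
          p ∈ PathSet.startAt v (j + 1) := fun p hp a hap _ h => ⟨h.1, hp⟩
    let R : Retract (idealMod I (PathSet.startAt v (j + 1)) j)
        (idealMod I (PathSet.lengthGE V (j + 1)) j) :=
      ⟨inclusion hi j, restrictHom hr j, GrMod.hom_ext fun x => Subtype.ext (restrict_eq_self x.2)⟩
    exact P.prop_of_retract (R.map (stalkFunctor _)) h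
  have h₂ : P (stalk (idealMod I (PathSet.startAt v 1) j)) := by
    have hi : ∀ p, IsNonzero I p → p ∈ PathSet.startAt v (j + 1) → p ∈ PathSet.startAt v 1 :=
      fun p _ hp => ⟨hp.1, (Nat.le_add_left 1 j).trans hp.2⟩
    obtain ⟨w, hS⟩ := GrMod.shortExact_quot_range (inclusion (I := I) hi j)
      (Submodule.inclusion_injective (pathIdeal_mono hi))
    refine prop_stalk_X₂ hS h₁ (devissage (fun X => P (stalk X)) (prop_stalk_of_isZero P)
      (fun S hS => prop_stalk_X₂ hS) (Set.Ioc (-j : ℤ) 0) (fun Y u i hi hY => ?_) _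
      fun i hi => ?_)
    · obtain ⟨m, rfl⟩ : ∃ m : ℕ, i = -m := ⟨i.natAbs, by have := hi.2; lia⟩
      exact ih m (by have := hi.1; lia) hY
    · rw [eq_bot_iff]
      rintro _ ⟨⟨x, hx⟩, hxi, rfl⟩
      refine (Submodule.Quotient.mk_eq_zero _).2 ?_
      suffices x ∈ pathIdeal I (PathSet.startAt v (j + 1)) from ⟨⟨x, this⟩, rfl⟩
      intro p hp
      have h₃ := length_of_coeff_ne_zero (mem_idealMod_grading.1 hxi) hp
      have h₄ := hx p hp
      refine ⟨h₄.1, ?_⟩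
      have h₅ := h₄.2
      by_contra hlt
      exact hi ⟨by lia, by lia⟩
  obtain ⟨f, g, w, hS⟩ := hX.shortExact
  have : Projective (ShortComplex.mk f g w).X₂ := projective_startAt _ _
  have h₃ : P (stalk (idealMod I (PathSet.startAt v 1) (- -(j : ℤ)))) := by rwa [neg_neg]
  exact prop_stalk_X₃ hS h₃ (prop_stalk_of_projective P _)

lemma prop_stalk_of_nonpos (hT : ∀ n, P (stalk (truncShift I n))) {X : GrMod (grading I)}
    (hX : ∀ i > 0, X.grading i = ⊥) : P (stalk X) := by
  refine devissage (fun X => P (stalk X)) (prop_stalk_of_isZero P)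
    (fun S hS => prop_stalk_X₂ hS) (Set.Iic 0) (fun Y v i hi hY => ?_) X
    fun i hi => hX i (not_le.1 hi)
  obtain ⟨m, rfl⟩ : ∃ m : ℕ, i = -m := ⟨i.natAbs, by have : i ≤ 0 := hi; lia⟩
  exact prop_stalk_of_isSimpleAt_of_nonpos P hT m hY

/-- Going to the left in a perfect sequence, each step raises the shift, so that the ideals generated
by the paths of the sequence end up in degrees `≤ 0`. -/
lemma IsPerfect.prop_stalk (hT : ∀ n, P (stalk (truncShift I n))) {c : ℤ → QPath V}
    (hc : IsPerfect I c) (s : ℤ) : P (stalk (idealMod I (PathSet.principal (c 0)) s)) := by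
  obtain ⟨τ, hτ, hτ0⟩ := exists_int_sum (fun j => (c j).length) 0 (-s)
  obtain ⟨N, hN⟩ := exists_length_lt I
  have hle : ∀ m : ℕ, τ (-m) ≤ τ 0 - m := fun m => by
    induction m with
    | zero => simp
    | succ m ih =>
      have h₁ := hτ (-(m + 1 : ℕ))
      have h₂ := hc.one_le_length (-(m + 1 : ℕ))
      rw [show -((m + 1 : ℕ) : ℤ) + 1 = -m by push_cast; lia] at h₁
      push_cast at h₁ h₂ ⊢
      lia
  have h := (hc.isCompleteSyzygySequence (I := I) hτ).prop_stalk P (N + (τ 0).toNat)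
    (prop_stalk_of_nonpos P hT fun i hi => ?_)
  · rwa [hτ0, neg_neg] at h
  · rw [eq_bot_iff]
    rintro ⟨x, hx⟩ hxi
    refine Subtype.ext (coeff_ext fun p => ?_)
    change coeff I x p = coeff I 0 p
    rw [map_zero, Finsupp.zero_apply]
    by_contra hp
    have h₁ := length_of_coeff_ne_zero (mem_idealMod_grading.1 hxi) hp
    have h₂ := hN p (isNonzero_of_coeff_ne_zero hp)
    have h₃ := hle (N + (τ 0).toNat)
    have h₄ := Int.self_le_toNat (τ 0)
    push_cast at h₁ h₃
    lia

lemma IsSyzygyPath.prop_stalk (hT : ∀ n, P (stalk (truncShift I n))) {d : ℕ}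
    [HasInjectiveDimensionLE (ModuleCat.of (QuotAlgebra I) (QuotAlgebra I)) d] {n m : ℕ}
    (hnm : n + m = d) {p : QPath V} (hp : IsSyzygyPath I n p) (s : ℤ) :
    P (stalk (idealMod I (PathSet.principal p) s)) := by
  induction m generalizing n p s with
  | zero =>
    obtain rfl : n = d := by lia
    obtain hproj | ⟨c, x, hx, hc, rfl, hiso⟩ := projective_or_exists_isPerfect hp
    · have := hproj s
      exact prop_stalk_of_projective P _
    · obtain ⟨e⟩ := hiso (s - x.length) s (by lia)
      exact P.prop_of_iso ((stalkFunctor _).mapIso e) (hc.prop_stalk P hT _)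
  | succ m ih =>
    obtain ⟨h₁, f, w, hS⟩ := shortExact_annihilator (I := I) p (s := s - p.length) (s' := s)
      (by lia)
    have : Projective (ShortComplex.mk _ _ w).X₂ := projective_startAt _ _
    refine prop_stalk_X₃ hS (idealMod_annihilator_of (fun X => P (stalk X))
      (prop_stalk_of_isZero P) (fun S hS => prop_stalk_X₂ hS) p _ fun r hr => ?_)
      (prop_stalk_of_projective P _)
    exact ih (n := n + 1) (by lia) ⟨p, hp, hr⟩ _

/-- A thick subcategory of the singularity category that contains the truncations `A(n)_{≤ 0}` is
the whole category. -/
theorem eq_top_of_prop_stalk_truncShift (d : ℕ)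
    [HasInjectiveDimensionLE (ModuleCat.of (QuotAlgebra I) (QuotAlgebra I)) d]
    (hT : ∀ n, P (stalk (truncShift I n))) : P = ⊤ := by
  refine eq_top_of_stalk P fun X => devissage (fun X => P (stalk X)) (prop_stalk_of_isZero P)
    (fun S hS => prop_stalk_X₂ hS) Set.univ (fun Y v i _ hY => ?_) X
    fun i hi => absurd (Set.mem_univ i) hi
  obtain ⟨f, g, w, hS⟩ := hY.shortExact
  have : Projective (ShortComplex.mk f g w).X₂ := projective_startAt _ _
  refine prop_stalk_X₃ hS ?_ (prop_stalk_of_projective P _)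
  refine idealMod_of_length_eq (W := PathSet.startAt v 1) (n := 1) (fun X => P (stalk X)) (prop_stalk_of_isZero P)
    (fun S hS => prop_stalk_X₂ hS) (fun p hp => hp.2)
    (fun a b h hab hb => ⟨hab.1, hb.ge⟩) (-i) fun r _ hr hr' => ?_
  exact IsSyzygyPath.prop_stalk P hT (d := d) (n := 0) (zero_add d)
    (show IsSyzygyPath I 0 r from ⟨hr, hr'.ge⟩) _

end Generation

end QuotAlgebra

theorem theorem4p5 {k V : Type u} [Field k] [IsAlgClosed k] [Fintype V] [Quiver.{u} V]
    [∀ a b : V, Finite (a ⟶ b)] (I : TwoSidedIdeal (PathAlgebra k V)) [IsMonomial I]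
    (hA : IsGorenstein (QuotAlgebra I))
    [HasDerivedCategory.{w} (GrMod (QuotAlgebra.grading I))] :
    (∃ X : SingCat.SingularityCategory (GrMod (QuotAlgebra.grading I)), SingCat.IsTilting X) ∧
      ∀ l : ℕ, (∀ n : ℤ, (l : ℤ) < n → QuotAlgebra.grading I n = ⊥) →
        SingCat.IsTilting (SingCat.stalk (tiltingModule I l)) := by
  obtain ⟨d, hd⟩ := hA.1
  have key : ∀ l : ℕ, (∀ n : ℤ, (l : ℤ) < n → QuotAlgebra.grading I n = ⊥) →
      SingCat.IsTilting (SingCat.stalk (tiltingModule I l)) := by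
    intro l hl
    let X : Fin (l + 1) → GrMod (QuotAlgebra.grading I) := fun i => QuotAlgebra.truncShift I i
    constructor
    · intro i hi
      exact SingCat.homVanish_stalk_biproduct X i fun n m =>
        QuotAlgebra.homVanish_stalk_truncShift d n m hi
    · let P := (ObjectProperty.singleton (SingCat.stalk (tiltingModule I l))).triangEnvelope
      refine QuotAlgebra.eq_top_of_prop_stalk_truncShift (I := I) P d fun n => ?_
      by_cases hn : n ≤ l
      · let R : Retract (QuotAlgebra.truncShift I n) (tiltingModule I l) :=
          ⟨biproduct.ι X ⟨n, by lia⟩, biproduct.π X ⟨n, by lia⟩, biproduct.ι_π_self X _⟩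
        exact P.prop_of_retract (R.map (SingCat.stalkFunctor _))
          (ObjectProperty.le_triangEnvelope _ _ (ObjectProperty.singleton_iff _ _ |>.2 rfl))
      -- For `n > l` the graded module `A(n)` lives in degrees `≤ 0`.
      · obtain ⟨f, g, w, hS⟩ := QuotAlgebra.shortExact_truncShift (I := I) n
        have : Projective (ShortComplex.mk f g w).X₂ := GrMod.projective_regular_shift _
        refine SingCat.prop_stalk_X₃ hS (QuotAlgebra.prop_stalk_of_isZero P _
          (QuotAlgebra.isZero_idealMod (fun p hp hn' => QuotAlgebra.path_ne_zero hn' ?_) _))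
          (SingCat.prop_stalk_of_projective P _)
        have h := QuotAlgebra.path_mem_grading (I := I) p rfl
        rwa [hl _ (by have := PathSet.mem_lengthGE.1 hp; lia), Submodule.mem_bot] at h
  refine ⟨?_, key⟩
  obtain ⟨N, hN⟩ := QuotAlgebra.exists_length_lt I
  refine ⟨_, key N fun n hn => ?_⟩
  rw [QuotAlgebra.grading, Submodule.span_eq_bot]
  rintro _ ⟨p, hp, rfl⟩
  refine QuotAlgebra.path_eq_zero fun h => ?_
  have := hN p h
  lia
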